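/- Let $P=\{P_n\}_{n\in\{0_+,0_-,1,2,\dots\}}$ be any planar algebra over a field $K$, i.e. an algebra over the coloured operad of (shaded) planar tangles: $K$-vector spaces $P_n$ with a linear map $Z_T:P_{n_1}\otimes\cdots\otimes P_{n_b}\to P_{n_0}$ for every planar tangle $T$ with internal boxes of colours $n_1,\dots,n_b$ and external box of colour $n_0$, depending only on the planar isotopy class of $T$, compatible with substitution of tangles and with renumbering of internal boxes, identity tangles acting as identity maps. (No finite-dimensionality, connectedness, modulus, sphericality or positivity is assumed.) Write $P_0=P_{0_+}$. For $n\ge 0$, $P_n$ is a unital algebra under the multiplication tangle, with unit $1_n$; for $j\le n$, $P_j$ acts on $P_n$ on the left and on the right by multiplication after the inclusion $P_j\to P_n$ that adds $n-j$ vertical strings on the right; $E_{n}\in P_{n}$ ($n\ge2$) is the non-normalised Jones projection, given by the tangle with $n-2$ vertical strings followed by one arc joining the last two top points and one joining the last two bottom points; and $P_kE_{k+1}P_k\subseteq P_{k+1}$ is the linear span of the products $xE_{k+1}y$ with $x,y\in P_k$. For $|m-n|\le p\le m+n$, let $M_{m,n}^{p}$ be the tangle with internal boxes $D_1$ of colour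 $m$ and $D_2$ of colour $n$, $D_1$ above $D_2$, and external box of colour $p$, in which $m+n-p$ strings join $D_1$ to $D_2$, $m+p-n$ strings join $D_1$ to the external box, $n+p-m$ strings join $D_2$ to the external box, and the $*$ of each of the three boxes lies in the leftmost region. Suppose that $1_{k+1}\in P_kE_{k+1}P_k$ for some positive integer $k$. Then: 1. For all $m,n\ge k$, the map $Z_{M}$ of the tangle $M=M_{m,n}^{\,m+n-(k-1)}$ induces an isomorphism of $P_{k-1}$–$P_{k-1}$-bimodules $$P_m\otimes_{P_{k-1}}P_n\;\xrightarrow{\ \cong\ }\;P_{m+n-(k-1)},\qquad x\otimes y\mapsto Z_M(x\otimes y).$$ 2. Consequently, for every $n\ge k$, there is an isomorphism of $P_{k-1}$–$P_{k-1}$-bimodules $$\underbrace{P_k\otimes_{P_{k-1}}P_k\otimes_{P_{k-1}}\cdots\otimes_{P_{k-1}}P_k}_{n+1-k\text{ factors}}\;\cong\;P_n,$$ induced by iterating the maps of the tangles $M_{l,k}^{\,l+1}$, $l=k,\dots,n-1$. -/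

import Mathlib

open scoped TensorProduct

universe u v

/-! ### Colours and the boundary of a box -/

/-- The set of colours `{0₊, 0₋, 1, 2, …}`: `nat 0` is `0₊`, `nat n` is `n`, and `zeroMinus`
is `0₋`. -/
inductive Col : Type
  | nat (n : ℕ) : Col
  | zeroMinus : Col

namespace Col

/-- A box of colour `c` has `2 * c.num` marked points on its boundary. -/
def num : Col → ℕ
  | nat n => n
  | zeroMinus => 0

/-- Marked points of a box, numbered clockwise starting from the `*`
(for internal boxes as well as for the external one). -/
abbrev Pt (c : Col) : Type := Fin (2 * c.num)

/-- The boundary intervals of a box. For a box with `2n > 0` marked points, interval `j` is the one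
that ends, clockwise, at the point `j`, so that interval `0` is the `*`-interval and the interval
that begins at `j` is `j + 1` modulo `2n`. For a box without marked points there is one interval,
namely the whole boundary circle. -/
abbrev Ivl (c : Col) : Type := Fin (max 1 (2 * c.num))

/-- The shading of the intervals; `true` is white and `false` is black. -/
def shade : (c : Col) → c.Ivl → Bool
  | nat _, I => I.val % 2 == 0
  | zeroMinus, _ => false

/-- The `*`-interval of a box (the whole circle, if the box has no marked points). -/
def star (c : Col) : c.Ivl := ⟨0, by omega⟩

/-- Of the two intervals that meet at the marked point `p`, the one with shade `s`. -/
def adj (c : Col) (p : c.Pt) (s : Bool) : c.Ivl :=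
  if (p.val % 2 == 0) = s then ⟨p.val, by omega⟩
  else ⟨(p.val + 1) % (2 * c.num), by
    have hp := p.isLt
    have := Nat.mod_lt (p.val + 1) (show 0 < 2 * c.num by omega)
    omega⟩

end Col

/-- The colours of all boxes of a tangle: `none` is the external box `D₀`, `some i` is an internal
box. -/
abbrev boxCol {ι : Type} (c : ι → Col) (c₀ : Col) : Option ι → Col
  | none => c₀
  | some i => c i

/-! ### Tangles -/

/-- The combinatorial data of a tangle with internal boxes of colours `c i` and external box of
colour `c₀`: its strings (arcs and closed curves), its regions, the string that ends at each marked
point, the region that touches each boundary interval, and the white (`true`) and the black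
(`false`) region adjacent to each string. Planarity is the separate predicate `Tangle.Planar`;
a planar tangle up to planar isotopy is a `Planar` element of this type up to `Tangle.Iso`. -/
structure Tangle {ι : Type} (c : ι → Col) (c₀ : Col) : Type 1 where
  Str : Type
  Reg : Type
  str : (b : Option ι) → (boxCol c c₀ b).Pt → Str
  reg : (b : Option ι) → (boxCol c c₀ b).Ivl → Reg
  side : Str → Bool → Reg
  /-- The region next to a string, near one of its end points, is the region that touches the
  boundary interval there. -/
  side_str : ∀ b p s, side (str b p) s = reg b ((boxCol c c₀ b).adj p s)

namespace Tangle

variable {ι : Type} {c : ι → Col} {c₀ : Col}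

/-- Orient the strings so that they have their white side on the left. Then `outgoing b p` says
that the string at the marked point `p` of the box `b` starts there: this happens at the even
points of the internal boxes and at the odd points of the external box. -/
def outgoing (b : Option ι) (p : ℕ) : Bool :=
  match b with
  | none => p % 2 == 1
  | some _ => p % 2 == 0

/-- The arcs, that is, the strings which are not closed curves. -/
def arcs (T : Tangle c c₀) : Set T.Str := {x | ∃ b p, T.str b p = x}

/-- Two pieces of the boundaries of the regions, a side of a string and a boundary interval of a
box, meet at a marked point. -/
inductive Meet (T : Tangle c c₀) :
    (T.Str × Bool) ⊕ (Σ b, (boxCol c c₀ b).Ivl) → (T.Str × Bool) ⊕ (Σ b, (boxCol c c₀ b).Ivl) → Prop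
  | mk (b : Option ι) (p : (boxCol c c₀ b).Pt) (s : Bool) :
      Meet T (.inl (T.str b p, s)) (.inr ⟨b, (boxCol c c₀ b).adj p s⟩)

/-- The boundary circles of the regions: maximal chains of string sides and boundary intervals
that meet end to end. Each side of a closed curve is a boundary circle by itself, and so is the
boundary of a box without marked points. -/
def BdryCircle (T : Tangle c c₀) : Type := Quot T.Meet

/-- `T` is a planar tangle.

The data `T` determine a closed surface: start with a disc for every box (the external box is the
disc outside of it on the sphere) and with the strings, and for every region take a sphere with as
many holes as the region has boundary circles and glue it in along these circles. The tangle is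
planar when that surface is a sphere, that is, connected and of Euler characteristic `2`. A disc
contributes `1`, an (open) arc `-1`, a closed curve `0`, and a region with `h` boundary circles
contributes `2 - h`. -/
structure Planar (T : Tangle c c₀) : Prop where
  finite_box : Finite ι
  finite_str : Finite T.Str
  finite_reg : Finite T.Reg
  /-- Every string that ends at a marked point has exactly two ends, … -/
  exists_other : ∀ b p, ∃ b' p', (⟨b', p'⟩ : Σ b, (boxCol c c₀ b).Pt) ≠ ⟨b, p⟩ ∧
    T.str b' p' = T.str b p
  /-- … one where it starts and one where it stops. -/
  outgoing_ne : ∀ b p b' p', (⟨b', p'⟩ : Σ b, (boxCol c c₀ b).Pt) ≠ ⟨b, p⟩ →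
    T.str b' p' = T.str b p → outgoing b' p'.val ≠ outgoing b p.val
  /-- The chequerboard shading. -/
  shading : ∃ sh : T.Reg → Bool, (∀ x s, sh (T.side x s) = s) ∧
    ∀ b I, sh (T.reg b I) = (boxCol c c₀ b).shade I
  /-- Any two regions can be joined by a path that crosses strings. -/
  connected : ∀ r r' : T.Reg,
    Relation.EqvGen (fun q q' => ∃ x, q = T.side x true ∧ q' = T.side x false) r r'
  /-- The Euler characteristic is `2`. -/
  euler : (Nat.card ι + 1) + 2 * Nat.card T.Reg = 2 + Nat.card T.arcs + Nat.card T.BdryCircle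

/-- Two tangles are the same up to planar isotopy. -/
def Iso (T T' : Tangle c c₀) : Prop :=
  ∃ (f : T.Str ≃ T'.Str) (g : T.Reg ≃ T'.Reg),
    (∀ b p, f (T.str b p) = T'.str b p) ∧ (∀ b I, g (T.reg b I) = T'.reg b I) ∧
    ∀ x s, g (T.side x s) = T'.side (f x) s

/-- Renumbering of the internal boxes: box `i` of the new tangle is box `e i` of the old one. -/
def reindex {ι' : Type} (e : ι' ≃ ι) (T : Tangle c c₀) : Tangle (fun i => c (e i)) c₀ where
  Str := T.Str
  Reg := T.Reg
  str b := match b with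
    | none => T.str none
    | some i => T.str (some (e i))
  reg b := match b with
    | none => T.reg none
    | some i => T.reg (some (e i))
  side := T.side
  side_str b p s := by
    cases b with
    | none => exact T.side_str none p s
    | some i => exact T.side_str (some (e i)) p s

section Subst

variable {κ : ι → Type} {d : (i : ι) → κ i → Col}

/-- On substitution, the string of `T` at a point of the internal box `i` is joined to the string
of `S i` at the same point of its external box. -/
inductive SubstStr (T : Tangle c c₀) (S : (i : ι) → Tangle (d i) (c i)) :
    T.Str ⊕ (Σ i, (S i).Str) → T.Str ⊕ (Σ i, (S i).Str) → Prop
  | mk (i : ι) (p : (c i).Pt) :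
      SubstStr T S (.inl (T.str (some i) p)) (.inr ⟨i, (S i).str none p⟩)

/-- On substitution, regions of `T` and of `S i` that touch the same interval of the box `i`
are merged. -/
inductive SubstReg (T : Tangle c c₀) (S : (i : ι) → Tangle (d i) (c i)) :
    T.Reg ⊕ (Σ i, (S i).Reg) → T.Reg ⊕ (Σ i, (S i).Reg) → Prop
  | mk (i : ι) (I : (c i).Ivl) :
      SubstReg T S (.inl (T.reg (some i) I)) (.inr ⟨i, (S i).reg none I⟩)

/-- The tangle obtained by substituting the tangle `S i` into the internal box `i` of `T`, for
every `i`. -/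
def subst (T : Tangle c c₀) (S : (i : ι) → Tangle (d i) (c i)) :
    Tangle (fun q : (Σ i, κ i) => d q.1 q.2) c₀ where
  Str := Quot (SubstStr T S)
  Reg := Quot (SubstReg T S)
  str b := match b with
    | none => fun p => Quot.mk _ (.inl (T.str none p))
    | some q => fun p => Quot.mk _ (.inr ⟨q.1, (S q.1).str (some q.2) p⟩)
  reg b := match b with
    | none => fun I => Quot.mk _ (.inl (T.reg none I))
    | some q => fun I => Quot.mk _ (.inr ⟨q.1, (S q.1).reg (some q.2) I⟩)
  side x s := Quot.lift
    (fun y : T.Str ⊕ (Σ i, (S i).Str) => (match y with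
      | .inl x => Quot.mk (SubstReg T S) (.inl (T.side x s))
      | .inr x => Quot.mk (SubstReg T S) (.inr ⟨x.1, (S x.1).side x.2 s⟩)))
    (by
      rintro _ _ ⟨i, p⟩
      have h₁ := T.side_str (some i) p s
      have h₂ := (S i).side_str none p s
      simp only [h₁, h₂]
      exact Quot.sound (SubstReg.mk i ((c i).adj p s))) x
  side_str b p s := by
    cases b with
    | none => exact congrArg (fun r => Quot.mk (SubstReg T S) (.inl r)) (T.side_str none p s)
    | some q =>
      exact congrArg (fun r : (S q.1).Reg => Quot.mk (SubstReg T S) (.inr ⟨q.1, r⟩))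
        ((S q.1).side_str (some q.2) p s)

end Subst

/-- The tangle, without closed curves, given by the relation `J` on marked points (which points are
joined by a string) and the relation `G` on boundary intervals. Two intervals touch the same region
if they have the same shade and are adjacent to the two ends of a string, or if they are related by
`G`; the latter is needed only for pictures that are not connected. -/
def ofJoin (c : ι → Col) (c₀ : Col)
    (J : (Σ b, (boxCol c c₀ b).Pt) → (Σ b, (boxCol c c₀ b).Pt) → Prop)
    (G : (Σ b, (boxCol c c₀ b).Ivl) → (Σ b, (boxCol c c₀ b).Ivl) → Prop) : Tangle c c₀ where
  Str := Quot J
  Reg := Quot (fun I I' : (Σ b, (boxCol c c₀ b).Ivl) => G I I' ∨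
    ∃ p q s, J p q ∧ I = ⟨p.1, (boxCol c c₀ p.1).adj p.2 s⟩ ∧
      I' = ⟨q.1, (boxCol c c₀ q.1).adj q.2 s⟩)
  str b p := Quot.mk _ ⟨b, p⟩
  reg b I := Quot.mk _ ⟨b, I⟩
  side x s := Quot.lift (fun p : (Σ b, (boxCol c c₀ b).Pt) =>
      Quot.mk _ ⟨p.1, (boxCol c c₀ p.1).adj p.2 s⟩)
    (fun p q h => Quot.sound (Or.inr ⟨p, q, s, h, rfl, rfl⟩)) x
  side_str _ _ _ := rfl

/-- The relation that puts the `*`-intervals of all boxes into the same region. -/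
def SameStar (c : ι → Col) (c₀ : Col) (I I' : Σ b, (boxCol c c₀ b).Ivl) : Prop :=
  I.2 = (boxCol c c₀ I.1).star ∧ I'.2 = (boxCol c c₀ I'.1).star

/-! ### The particular tangles -/

/-- The identity tangle of colour `c`: point `j` of the internal box is joined to point `j` of the
external box. -/
def ident (c : Col) : Tangle (fun _ : Unit => c) c :=
  ofJoin _ _
    (fun p q => match p, q with
      | ⟨some _, i⟩, ⟨none, j⟩ => i.val = j.val
      | _, _ => False)
    (SameStar _ _)

/-- The multiplicative identity tangle `1ⁿ`: `n` vertical strings. -/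
def one (n : ℕ) : Tangle (fun i : Empty => nomatch i) (.nat n) :=
  ofJoin _ _ (fun p q => p.2.val + q.2.val + 1 = 2 * n) (fun _ _ => False)

/-- The Jones projection tangle `Eⁿ`, for `n ≥ 2`: the first `n - 2` strings are vertical, the last
two points at the top are joined, and so are the last two points at the bottom. -/
def jones (n : ℕ) : Tangle (fun i : Empty => nomatch i) (.nat n) :=
  ofJoin _ _
    (fun p q =>
      (p.2.val + 2 < n ∧ p.2.val + q.2.val + 1 = 2 * n) ∨
      (p.2.val + 2 = n ∧ q.2.val + 1 = n) ∨
      (p.2.val = n ∧ q.2.val = n + 1))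
    (fun _ _ => False)

/-- The inclusion tangle `I_n^N`, for `n ≤ N`: the internal `n`-box is joined to the first `n`
points at the top and at the bottom, and `N - n` vertical strings are added on its right. -/
def incl (n N : ℕ) : Tangle (fun _ : Unit => .nat n) (.nat N) :=
  ofJoin _ _
    (fun p q => match p, q with
      | ⟨some _, i⟩, ⟨none, j⟩ =>
          (i.val < n ∧ j.val = i.val) ∨ (n ≤ i.val ∧ j.val + 2 * n = i.val + 2 * N)
      | ⟨none, i⟩, ⟨none, j⟩ => n ≤ i.val ∧ n ≤ j.val ∧ i.val + j.val + 1 = 2 * N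
      | _, _ => False)
    (SameStar _ _)

/-- The colours of the two internal boxes `D₁` (`false`) and `D₂` (`true`). -/
def pairCol (m n : ℕ) : Bool → Col
  | false => .nat m
  | true => .nat n

/-- The multiplication tangle `M_{m,n}^p`, for `|m - n| ≤ p ≤ m + n`, with `D₁` on top of `D₂`.
There are `m + p - n` strings from `D₁` to the external box, `m + n - p` from `D₁` to `D₂`, and
`n + p - m` from `D₂` to the external box, and the `*`-intervals of the three boxes touch the
leftmost region. -/
def mult (m n p : ℕ) : Tangle (pairCol m n) (.nat p) :=
  ofJoin _ _
    (fun x y => match x, y with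
      | ⟨some false, i⟩, ⟨none, j⟩ => i.val = j.val ∧ i.val + n < m + p
      | ⟨some false, i⟩, ⟨some true, j⟩ => i.val + j.val + 1 = 2 * m ∧ j.val + p < m + n
      | ⟨some true, i⟩, ⟨none, j⟩ => m + n ≤ i.val + p ∧ j.val + 2 * n = i.val + 2 * p
      | _, _ => False)
    (SameStar _ _)

end Tangle

/-! ### Planar algebras -/

/-- A planar algebra over the field `K`: an algebra over the coloured operad of planar tangles.
(The maps `Z T` are constrained, and used, only for planar tangles `T`; their values on other data
are irrelevant.) -/
structure PlanarAlgebra (K : Type u) [Field K] where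
  space : Col → Type v
  [addCommGroup : ∀ c, AddCommGroup (space c)]
  [module : ∀ c, Module K (space c)]
  /-- The multilinear map of a tangle, that is, a linear map on the tensor product. -/
  Z : ∀ {ι : Type} {c : ι → Col} {c₀ : Col}, Tangle c c₀ →
    MultilinearMap K (fun i => space (c i)) (space c₀)
  Z_iso : ∀ {ι : Type} {c : ι → Col} {c₀ : Col} (T T' : Tangle c c₀),
    T.Planar → T.Iso T' → Z T = Z T'
  Z_reindex : ∀ {ι ι' : Type} {c : ι → Col} {c₀ : Col} (e : ι' ≃ ι) (T : Tangle c c₀),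
    T.Planar → ∀ x : (∀ i, space (c i)), Z (T.reindex e) (fun i => x (e i)) = Z T x
  Z_ident : ∀ (c : Col) (x : space c), Z (Tangle.ident c) (fun _ => x) = x
  Z_subst : ∀ {ι : Type} {c : ι → Col} {c₀ : Col} {κ : ι → Type} {d : (i : ι) → κ i → Col}
    (T : Tangle c c₀) (S : (i : ι) → Tangle (d i) (c i)),
    T.Planar → (∀ i, (S i).Planar) → ∀ x : (∀ q : (Σ i, κ i), space (d q.1 q.2)),
      Z (T.subst S) x = Z T (fun i => Z (S i) (fun j => x ⟨i, j⟩))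

attribute [instance] PlanarAlgebra.addCommGroup PlanarAlgebra.module

namespace PlanarAlgebra

variable {K : Type u} [Field K] (A : PlanarAlgebra.{u, v} K)

/-- The space `P_n` (with `P_0 = P_{0₊}`). -/
abbrev P (n : ℕ) : Type v := A.space (.nat n)

variable {A}

/-- A pair of inputs for the boxes `D₁`, `D₂`. -/
def pair {m n : ℕ} (x : A.P m) (y : A.P n) : ∀ b : Bool, A.space (Tangle.pairCol m n b)
  | false => x
  | true => y

/-- The map `P_m × P_n → P_p` of the tangle `M_{m,n}^p`. -/
def mulTo {m n : ℕ} (p : ℕ) (x : A.P m) (y : A.P n) : A.P p :=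
  A.Z (Tangle.mult m n p) (pair x y)

/-- The multiplication of the algebra `P_n`. -/
def mul {n : ℕ} (x y : A.P n) : A.P n := mulTo n x y

/-- The inclusion `P_n → P_N`. -/
def incl {n : ℕ} (N : ℕ) (x : A.P n) : A.P N := A.Z (Tangle.incl n N) (fun _ => x)

/-- The left action of `P_j` on `P_m`, for `j ≤ m`: multiplication after inclusion. -/
def lact {j m : ℕ} (a : A.P j) (x : A.P m) : A.P m := mul (incl m a) x

/-- The right action of `P_j` on `P_m`, for `j ≤ m`: multiplication after inclusion. -/
def ract {j m : ℕ} (x : A.P m) (a : A.P j) : A.P m := mul x (incl m a)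

variable (A)

/-- The multiplicative identity `1_n` of `P_n`. -/
def one (n : ℕ) : A.P n := A.Z (Tangle.one n) (fun i => nomatch i)

/-- The (non-normalised) Jones projection `E_n` in `P_n`, for `n ≥ 2`. -/
def E (n : ℕ) : A.P n := A.Z (Tangle.jones n) (fun i => nomatch i)

/-- The subspace `P_k E_{k+1} P_k` of `P_{k+1}`, the linear span of the products `x E_{k+1} y`. -/
def PEP (k : ℕ) : Submodule K (A.P (k + 1)) :=
  Submodule.span K {z | ∃ x y : A.P k, z = mul (mul (incl (k + 1) x) (A.E (k + 1))) (incl (k + 1) y)}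

/-- The subspace of `P_m ⊗ P_n` spanned by all `x a ⊗ y - x ⊗ a y` with `a` in `P_j`. -/
def balanced (j m n : ℕ) : Submodule K (A.P m ⊗[K] A.P n) :=
  Submodule.span K {t | ∃ (x : A.P m) (a : A.P j) (y : A.P n), t = ract x a ⊗ₜ[K] y - x ⊗ₜ[K] lact a y}

/-- The tensor product `P_m ⊗_{P_j} P_n`, for `j ≤ m` and `j ≤ n`. -/
abbrev BalTensor (j m n : ℕ) : Type v := (A.P m ⊗[K] A.P n) ⧸ A.balanced j m n

/-- The subspace of the tensor power `P_k ⊗ ⋯ ⊗ P_k` (`s + 1` factors) spanned by all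
`⋯ ⊗ x_i a ⊗ x_{i+1} ⊗ ⋯ - ⋯ ⊗ x_i ⊗ a x_{i+1} ⊗ ⋯` with `a` in `P_j`. -/
def balancedPow (j k s : ℕ) : Submodule K (⨂[K] _ : Fin (s + 1), A.P k) :=
  Submodule.span K {t | ∃ (x : Fin (s + 1) → A.P k) (i : Fin s) (a : A.P j),
    t = PiTensorProduct.tprod K (Function.update x i.castSucc (ract (x i.castSucc) a)) -
      PiTensorProduct.tprod K (Function.update x i.succ (lact a (x i.succ)))}

/-- The tensor power `P_k ⊗_{P_j} ⋯ ⊗_{P_j} P_k` with `s + 1` factors, for `j ≤ k`. -/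
abbrev BalPow (j k s : ℕ) : Type (max u v) := (⨂[K] _ : Fin (s + 1), A.P k) ⧸ A.balancedPow j k s

variable {A}

/-- The iterated multiplication `P_k × ⋯ × P_k → P_{k+s}` with `s + 1` factors; each step is
the map of the tangle `M_{k+s,k}^{k+s+1}`. -/
def iterMul {k : ℕ} : (s : ℕ) → (Fin (s + 1) → A.P k) → A.P (k + s)
  | 0, x => x 0
  | s + 1, x => mulTo (k + s + 1) (iterMul s (fun i => x i.castSucc)) (x (Fin.last (s + 1)))

end PlanarAlgebra

/-! Write x·y for the image of x ⊗ y under a tangle M_{m,n}^p, where the colour p is clear from the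
context; the two boxes are then joined by m + n - p strings. Such products are associative when both
bracketings describe the same picture of three boxes (`mulTo_assoc`), and 1_N acts as an identity on
P_n whenever N ≤ 2n (`mulTo_one`, `one_mulTo`). Inclusions are products with an identity, and
E_{k+1} is 1_k·1_k in P_{k+1}; so x E_{k+1} y is x·y in P_{k+1}, with k - 1 strings between x and y
(`mul_E_mul`). The hypothesis thus reads 1_{k+1} = Σ x_i·y_i with x_i, y_i in P_k.

Let j = k - 1. Inserting this relation into itself gives, for every m ≥ k and a = 2m - j, a relation
1_a = Σ U_i·V_i with U_i, V_i in P_m joined by j strings (`one_mem_span`). For z in P_{m+n-j} it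
follows that z = 1_a·z = Σ U_i·(V_i·z) with V_i·z in P_n, which is surjectivity. The map z ↦ Σ U_i ⊗
V_i·z is a left inverse: if z = x·y, then V_i·z = (V_i·x)·y with V_i·x in P_j, which may cross the
tensor sign, and Σ U_i·(V_i·x) ⊗ y = 1_a·x ⊗ y = x ⊗ y (`exists_leftInverse`, `balMul_bijective`).
The tensor power follows by induction on the number of factors (`powMul_bijective`).

Most of the work goes into the pictures. An equality of pictures is an isomorphism of tangles.
Tangles given by joining points, and substitutions, both have universal properties (`ofJoin_homTo`,
`subst_homTo`), and maps in opposite directions that respect the boxes are mutually inverse because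
every string and every region reaches a box (`iso_of_homTo`).

The axioms speak only of planar tangles, and planarity is a statement about an Euler characteristic.
Cutting along paths between the `*`-intervals turns the strings into a non-crossing matching of
points on a line. Counting the faces of the matching, and the boundary circles of the regions, gives
the characteristic (`IsWord.planar`). -/

namespace Tangle

/-! ### Regions along the boundary of a box -/

variable {ι ι' : Type} {c : ι → Col} {c' : ι' → Col} {c₀ : Col}

/-- The region at the boundary interval `v` of the box `b`, where `2 * n` also denotes the
`*`-interval of a box of colour `n`. -/
def regN (T : Tangle c c₀) (b : Option ι) (v : ℕ) : T.Reg :=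
  T.reg b ⟨if v < 2 * (boxCol c c₀ b).num then v else 0, by split <;> omega⟩

theorem reg_eq_regN (T : Tangle c c₀) (b : Option ι) (I : (boxCol c c₀ b).Ivl) :
    T.reg b I = T.regN b I.val := by
  unfold regN
  congr 1
  apply Fin.ext
  have := I.isLt
  dsimp only
  split <;> omega

theorem regN_end (T : Tangle c c₀) (b : Option ι) :
    T.regN b (2 * (boxCol c c₀ b).num) = T.regN b 0 := by
  unfold regN
  congr 1
  apply Fin.ext
  simp

theorem regN_zero (T : Tangle c c₀) (b : Option ι) :
    T.regN b 0 = T.reg b (boxCol c c₀ b).star := by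
  rw [reg_eq_regN]; rfl

/-- The reduction modulo `2 * d.num` matters only after the last point, where it returns to the
`*`-interval. Since `regN` gives that interval both indices, `0` and `2 * n`, the region after the
point `v` can always be written with index `v + 1`. -/
theorem _root_.Col.adj_val_cases (d : Col) (p : d.Pt) (s : Bool) :
    ((d.adj p s).val = if (p.val % 2 == 0) = s then p.val else p.val + 1) ∨
    ((d.adj p s).val = 0 ∧ (if (p.val % 2 == 0) = s then p.val else p.val + 1) = 2 * d.num) := by
  have hp := p.isLt
  unfold Col.adj
  split
  · left; rfl
  · dsimp only
    rcases Nat.lt_or_ge (p.val + 1) (2 * d.num) with h | h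
    · left; exact Nat.mod_eq_of_lt h
    · right
      have : p.val + 1 = 2 * d.num := by omega
      rw [this]; simp

theorem reg_adj (T : Tangle c c₀) (b : Option ι) (p : (boxCol c c₀ b).Pt) (s : Bool) :
    T.reg b ((boxCol c c₀ b).adj p s) =
      T.regN b (if (p.val % 2 == 0) = s then p.val else p.val + 1) := by
  rw [reg_eq_regN]
  rcases Col.adj_val_cases _ p s with h | ⟨h, h'⟩
  · rw [h]
  · rw [h, h', regN_end]

theorem side_str_regN (T : Tangle c c₀) (b : Option ι) (p : (boxCol c c₀ b).Pt) (s : Bool) :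
    T.side (T.str b p) s = T.regN b (if (p.val % 2 == 0) = s then p.val else p.val + 1) := by
  rw [side_str, reg_adj]

/-- The region before a point is the region after any point of opposite parity on its string. -/
theorem regN_of_str_eq_odd (T : Tangle c c₀) {b b' : Option ι} {p : (boxCol c c₀ b).Pt}
    {q : (boxCol c c₀ b').Pt} (h : T.str b p = T.str b' q) (hpq : (p.val + q.val) % 2 = 1) :
    T.regN b p.val = T.regN b' (q.val + 1) := by
  have h1 := T.side_str_regN b p (p.val % 2 == 0)
  have h2 := T.side_str_regN b' q (p.val % 2 == 0)
  rw [if_pos rfl] at h1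
  rw [if_neg] at h2
  · rw [← h1, ← h2, h]
  · rw [Bool.eq_iff_iff]; simp; omega

/-- The regions on either side of points of equal parity on a string. -/
theorem regN_of_str_eq_even (T : Tangle c c₀) {b b' : Option ι} {p : (boxCol c c₀ b).Pt}
    {q : (boxCol c c₀ b').Pt} (h : T.str b p = T.str b' q) (hpq : (p.val + q.val) % 2 = 0) :
    T.regN b p.val = T.regN b' q.val ∧ T.regN b (p.val + 1) = T.regN b' (q.val + 1) := by
  constructor
  · have h1 := T.side_str_regN b p (p.val % 2 == 0)
    have h2 := T.side_str_regN b' q (p.val % 2 == 0)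
    rw [if_pos rfl] at h1
    rw [if_pos] at h2
    · rw [← h1, ← h2, h]
    · rw [Bool.eq_iff_iff]; simp; omega
  · have h1 := T.side_str_regN b p (p.val % 2 == 1)
    have h2 := T.side_str_regN b' q (p.val % 2 == 1)
    rw [if_neg] at h1 h2
    · rw [← h1, ← h2, h]
    · rw [Bool.eq_iff_iff]; simp; omega
    · rw [Bool.eq_iff_iff]; simp; omega

theorem str_congr (T : Tangle c c₀) {b b' : Option ι} (h : b = b') (p : (boxCol c c₀ b).Pt)
    (q : (boxCol c c₀ b').Pt) (hpq : p.val = q.val) : T.str b p = T.str b' q := by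
  subst h
  rw [Fin.ext hpq]

theorem reg_congr (T : Tangle c c₀) {b b' : Option ι} (h : b = b') (p : (boxCol c c₀ b).Ivl)
    (q : (boxCol c c₀ b').Ivl) (hpq : p.val = q.val) : T.reg b p = T.reg b' q := by
  subst h
  rw [Fin.ext hpq]

/-! ### Maps of tangles -/

/-- There are maps of strings and of regions that are compatible with the boundaries of the
boxes. -/
def HomTo (T T' : Tangle c c₀) : Prop :=
  ∃ (f : T.Str → T'.Str) (g : T.Reg → T'.Reg),
    (∀ b p, f (T.str b p) = T'.str b p) ∧ ∀ b I, g (T.reg b I) = T'.reg b I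

/-- Every string ends at a box, and every region touches a box. -/
def Spanned (T : Tangle c c₀) : Prop :=
  (∀ x, ∃ b p, T.str b p = x) ∧ ∀ r, ∃ b I, T.reg b I = r

/-- A map that respects the boxes is determined on the strings and regions that meet a box; if all
of them do, both composites are identities. Compatibility with `side` is then automatic, as the
sides of a string can be read off at one of its ends. -/
theorem iso_of_homTo {T T' : Tangle c c₀} (h : T.HomTo T') (h' : T'.HomTo T) (s : T.Spanned)
    (s' : T'.Spanned) : T.Iso T' := by
  obtain ⟨f, g, hf, hg⟩ := h
  obtain ⟨f', g', hf', hg'⟩ := h'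
  refine ⟨⟨f, f', fun x => ?_, fun x => ?_⟩, ⟨g, g', fun x => ?_, fun x => ?_⟩, hf, hg, ?_⟩
  · obtain ⟨b, p, rfl⟩ := s.1 x
    rw [hf, hf']
  · obtain ⟨b, p, rfl⟩ := s'.1 x
    rw [hf', hf]
  · obtain ⟨b, p, rfl⟩ := s.2 x
    rw [hg, hg']
  · obtain ⟨b, p, rfl⟩ := s'.2 x
    rw [hg', hg]
  · intro x t
    obtain ⟨b, p, rfl⟩ := s.1 x
    change g _ = T'.side (f _) t
    rw [hf, side_str, side_str, hg]

theorem ofJoin_spanned (c : ι → Col) (c₀ : Col) (J G) : (ofJoin c c₀ J G).Spanned := by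
  constructor
  · rintro ⟨b, p⟩; exact ⟨b, p, rfl⟩
  · rintro ⟨b, p⟩; exact ⟨b, p, rfl⟩

/-- Universal property of a quotient. Only `G` needs a hypothesis on regions: the other intervals
that are identified are sides of strings which `hJ` makes equal in `T`. -/
theorem ofJoin_homTo {J G} (T : Tangle c c₀)
    (hJ : ∀ b p b' q, J ⟨b, p⟩ ⟨b', q⟩ → T.str b p = T.str b' q)
    (hG : ∀ I I', G I I' → T.reg I.1 I.2 = T.reg I'.1 I'.2) : (ofJoin c c₀ J G).HomTo T := by
  refine ⟨Quot.lift (fun p => T.str p.1 p.2) fun p q h => hJ _ _ _ _ h,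
    Quot.lift (fun I => T.reg I.1 I.2) ?_, fun _ _ => rfl, fun _ _ => rfl⟩
  rintro I I' (h | ⟨p, q, s, h, rfl, rfl⟩)
  · exact hG _ _ h
  · dsimp only
    rw [← T.side_str, ← T.side_str, hJ _ _ _ _ h]

theorem ofJoin_sameStar_homTo {J} (T : Tangle c c₀)
    (hJ : ∀ b p b' q, J ⟨b, p⟩ ⟨b', q⟩ → T.str b p = T.str b' q)
    (hG : ∀ i, T.regN (some i) 0 = T.regN none 0) :
    (ofJoin c c₀ J (SameStar c c₀)).HomTo T := by
  apply ofJoin_homTo T hJ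
  have key : ∀ b, T.regN b 0 = T.regN none 0 := by
    rintro (_ | i)
    · rfl
    · exact hG i
  rintro ⟨b, I⟩ ⟨b', I'⟩ ⟨h, h'⟩
  dsimp only at h h' ⊢
  rw [h, h', ← regN_zero, ← regN_zero, key b, key b']

theorem ofJoin_sameStar_regN {J} (b b' : Option ι) :
    (ofJoin c c₀ J (SameStar c c₀)).regN b 0 = (ofJoin c c₀ J (SameStar c c₀)).regN b' 0 := by
  rw [regN_zero, regN_zero]
  exact Quot.sound (Or.inl ⟨rfl, rfl⟩)

/-! ### Pulling a tangle back along a map of boxes -/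

theorem _root_.Col.adj_cast {d d' : Col} (h : d = d') (p : d.Pt) (s : Bool)
    (h₁ : 2 * d.num = 2 * d'.num) (h₂ : max 1 (2 * d.num) = max 1 (2 * d'.num)) :
    Fin.cast h₂ (d.adj p s) = d'.adj (Fin.cast h₁ p) s := by
  subst h; rfl

/-- The tangle with a box of colour `c i` for every `i`, namely the box `e i` of `T`. -/
def pull (e : ι → ι') (hc : ∀ i, c i = c' (e i)) (T : Tangle c' c₀) : Tangle c c₀ where
  Str := T.Str
  Reg := T.Reg
  str b := match b with
    | none => T.str none
    | some i => fun p => T.str (some (e i)) (Fin.cast (by simp [hc]) p)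
  reg b := match b with
    | none => T.reg none
    | some i => fun I => T.reg (some (e i)) (Fin.cast (by simp [hc]) I)
  side := T.side
  side_str b p s := by
    cases b with
    | none => exact T.side_str none p s
    | some i =>
      refine (T.side_str (some (e i)) _ s).trans (congrArg _ ?_)
      exact (Col.adj_cast (hc i) p s _ _).symm

theorem pull_spanned {e : ι ≃ ι'} {hc : ∀ i, c i = c' (e i)} {T : Tangle c' c₀} (h : T.Spanned) :
    (T.pull e hc).Spanned := by
  constructor
  · intro x
    obtain ⟨b, p, rfl⟩ := h.1 x
    rcases b with _ | i
    · exact ⟨none, p, rfl⟩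
    · obtain ⟨i, rfl⟩ := e.surjective i
      exact ⟨some i, Fin.cast (by simp [hc]) p, rfl⟩
  · intro x
    obtain ⟨b, p, rfl⟩ := h.2 x
    rcases b with _ | i
    · exact ⟨none, p, rfl⟩
    · obtain ⟨i, rfl⟩ := e.surjective i
      exact ⟨some i, Fin.cast (by simp [hc]) p, rfl⟩

/-- Moves the renumbering of boxes to the other side of a map, so that a map out of a pulled back
tangle can be built from the universal property of the tangle itself. -/
theorem pull_homTo {e : ι ≃ ι'} {hc : ∀ i, c i = c' (e i)} {hc' : ∀ i, c' i = c (e.symm i)}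
    {T : Tangle c c₀} {T' : Tangle c' c₀} (h : T'.HomTo (T.pull e.symm hc')) :
    (T'.pull e hc).HomTo T := by
  obtain ⟨f, g, hf, hg⟩ := h
  refine ⟨f, g, ?_, ?_⟩
  · rintro (_ | i) p
    · exact hf none p
    · exact (hf (some (e i)) _).trans (T.str_congr (by simp) _ _ rfl)
  · rintro (_ | i) p
    · exact hg none p
    · exact (hg (some (e i)) _).trans (T.reg_congr (by simp) _ _ rfl)

theorem iso_pull {e : ι ≃ ι'} {hc : ∀ i, c i = c' (e i)} (hc' : ∀ i, c' i = c (e.symm i))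
    {T : Tangle c c₀} {T' : Tangle c' c₀} (h : T.HomTo (T'.pull e hc))
    (h' : T'.HomTo (T.pull e.symm hc')) (s : T.Spanned) (s' : T'.Spanned) :
    T.Iso (T'.pull e hc) :=
  iso_of_homTo h (pull_homTo h') s (pull_spanned s')

/-! ### Substitution -/

section Subst

variable {κ : ι → Type} {d : (i : ι) → κ i → Col}

theorem subst_glue (T : Tangle c c₀) (S : (i : ι) → Tangle (d i) (c i)) (i : ι) (p : (c i).Pt) :
    (Quot.mk _ (.inl (T.str (some i) p)) : (T.subst S).Str) =
      Quot.mk _ (.inr ⟨i, (S i).str none p⟩) :=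
  Quot.sound (SubstStr.mk i p)

/-- The end points in `T.subst S` of its strings, including those on the boundary of the boxes
into which the tangles are substituted. -/
def substStr (T : Tangle c c₀) (S : (i : ι) → Tangle (d i) (c i)) (i : ι) (p : (c i).Pt) :
    (T.subst S).Str := Quot.mk _ (.inl (T.str (some i) p))

theorem subst_str_eq_outer {T : Tangle c c₀} {S : (i : ι) → Tangle (d i) (c i)} {x y : T.Str}
    (h : x = y) : (Quot.mk _ (.inl x) : (T.subst S).Str) = Quot.mk _ (.inl y) := by rw [h]

theorem subst_str_eq_inner {T : Tangle c c₀} {S : (i : ι) → Tangle (d i) (c i)} {i : ι}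
    {x y : (S i).Str} (h : x = y) :
    (Quot.mk _ (.inr ⟨i, x⟩) : (T.subst S).Str) = Quot.mk _ (.inr ⟨i, y⟩) := by rw [h]

theorem subst_regN_star (T : Tangle c c₀) (S : (i : ι) → Tangle (d i) (c i))
    (hT : ∀ i, T.regN (some i) 0 = T.regN none 0)
    (hS : ∀ i j, (S i).regN (some j) 0 = (S i).regN none 0) (q : Σ i, κ i) :
    (T.subst S).regN (some q) 0 = (T.subst S).regN none 0 := by
  have h1 := hT q.1
  have h2 := hS q.1 q.2
  rw [regN_zero, regN_zero] at h1 h2 ⊢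
  have h3 : (Quot.mk _ (.inl (T.reg (some q.1) (c q.1).star)) : (T.subst S).Reg) =
      Quot.mk _ (.inr ⟨q.1, (S q.1).reg none (c q.1).star⟩) := Quot.sound (SubstReg.mk q.1 _)
  have h4 : (T.subst S).reg (some q) (d q.1 q.2).star =
    Quot.mk _ (.inr ⟨q.1, (S q.1).reg (some q.2) (d q.1 q.2).star⟩) := rfl
  have h5 : (T.subst S).reg none c₀.star = Quot.mk _ (.inl (T.reg none c₀.star)) := rfl
  change (T.subst S).reg (some q) (d q.1 q.2).star = (T.subst S).reg none c₀.star
  rw [h4, h5]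
  refine (congrArg (fun r => (Quot.mk _ (.inr ⟨q.1, r⟩) : (T.subst S).Reg)) h2).trans
    (h3.symm.trans (congrArg (fun r => (Quot.mk _ (.inl r) : (T.subst S).Reg)) h1))

/-- To span a tangle obtained by substitution, it suffices to join the points of the boundaries
that have been removed to other points. -/
theorem subst_spanned (T : Tangle c c₀) (S : (i : ι) → Tangle (d i) (c i))
    (hT : ∀ i, T.regN (some i) 0 = T.regN none 0) (sT : T.Spanned) (sS : ∀ i, (S i).Spanned)
    (h : ∀ i p, ∃ b q, (T.subst S).str b q = substStr T S i p) : (T.subst S).Spanned := by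
  -- A region at a removed interval is a side of the string that ends there, and this string reaches
  -- a remaining point by `h`. A removed circle without points has only its `*`-interval, whose
  -- region touches the external box by `hT`.
  have hreg : ∀ i I, ∃ b I', (T.subst S).reg b I' = Quot.mk _ (.inl (T.reg (some i) I)) := by
    intro i I
    rcases Nat.eq_zero_or_pos (c i).num with h0 | h0
    · have hI : I = (c i).star := by
        apply Fin.ext
        have h1 : I.val < max 1 (2 * (c i).num) := I.isLt
        change I.val = 0
        omega
      refine ⟨none, c₀.star, ?_⟩
      have h1 := hT i
      rw [regN_zero, regN_zero] at h1
      rw [hI]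
      exact congrArg (fun r => (Quot.mk _ (.inl r) : (T.subst S).Reg)) h1.symm
    · have hlt : I.val < 2 * (c i).num := by
        have h1 : I.val < max 1 (2 * (c i).num) := I.isLt
        omega
      obtain ⟨b, q, hq⟩ := h i ⟨I.val, hlt⟩
      have hI : I = (c i).adj ⟨I.val, hlt⟩ (I.val % 2 == 0) := by
        unfold Col.adj
        rw [if_pos rfl]
      refine ⟨b, (boxCol _ _ b).adj q (I.val % 2 == 0), ?_⟩
      rw [← side_str, hq]
      change (Quot.mk _ (.inl (T.side (T.str (some i) ⟨I.val, hlt⟩) _)) : (T.subst S).Reg) = _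
      rw [side_str]
      exact congrArg (fun J => (Quot.mk _ (.inl (T.reg (some i) J)) : (T.subst S).Reg)) hI.symm
  constructor
  · rintro ⟨x | ⟨i, x⟩⟩
    · obtain ⟨b, p, rfl⟩ := sT.1 x
      rcases b with _ | i
      · exact ⟨none, p, rfl⟩
      · exact h i p
    · obtain ⟨b, p, rfl⟩ := (sS i).1 x
      rcases b with _ | j
      · obtain ⟨b, q, hq⟩ := h i p
        exact ⟨b, q, hq.trans (subst_glue T S i p)⟩
      · exact ⟨some ⟨i, j⟩, p, rfl⟩
  · rintro ⟨x | ⟨i, x⟩⟩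
    · obtain ⟨b, p, rfl⟩ := sT.2 x
      rcases b with _ | i
      · exact ⟨none, p, rfl⟩
      · exact hreg i p
    · obtain ⟨b, p, rfl⟩ := (sS i).2 x
      rcases b with _ | j
      · obtain ⟨b, q, hq⟩ := hreg i p
        exact ⟨b, q, hq.trans (Quot.sound (SubstReg.mk i p))⟩
      · exact ⟨some ⟨i, j⟩, p, rfl⟩

variable (U : Tangle (fun q : (Σ i, κ i) => d q.1 q.2) c₀) (vs : ∀ i, (c i).Pt → U.Str)
  (w : ι → ℕ → U.Reg) (hw : ∀ i, w i (2 * (c i).num) = w i 0)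
  (hv : ∀ i (p : (c i).Pt) s,
    U.side (vs i p) s = w i (if (p.val % 2 == 0) = s then p.val else p.val + 1))

theorem apply_adj (hw : ∀ i, w i (2 * (c i).num) = w i 0) {i : ι} (p : (c i).Pt) (s : Bool) :
    w i ((c i).adj p s).val = w i (if (p.val % 2 == 0) = s then p.val else p.val + 1) := by
  rcases Col.adj_val_cases _ p s with h | ⟨h, h'⟩
  · rw [h]
  · rw [h, h', hw]

/-- The strings and regions of `U`, seen from outside of circles around some of its boxes. -/
def outer : Tangle c c₀ where
  Str := U.Str
  Reg := U.Reg
  str b := match b with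
    | none => U.str none
    | some i => vs i
  reg b := match b with
    | none => U.reg none
    | some i => fun I => w i I.val
  side := U.side
  side_str b p s := by
    cases b with
    | none => exact U.side_str none p s
    | some i => exact (hv i p s).trans (apply_adj U w hw p s).symm

/-- The strings and regions of `U`, seen from inside of a circle around some of its boxes. -/
def inner (i : ι) : Tangle (d i) (c i) where
  Str := U.Str
  Reg := U.Reg
  str b := match b with
    | none => vs i
    | some j => U.str (some ⟨i, j⟩)
  reg b := match b with
    | none => fun I => w i I.val
    | some j => U.reg (some ⟨i, j⟩)
  side := U.side
  side_str b p s := by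
    cases b with
    | none => exact (hv i p s).trans (apply_adj U w hw p s).symm
    | some j => exact U.side_str (some ⟨i, j⟩) p s

/-- Universal property of substitution: `vs` and `w` record which strings and regions of `U` meet
the circle around each group of boxes, and maps from the outer and inner tangles that agree on these
circles can be glued. -/
theorem subst_homTo {T : Tangle c c₀} {S : (i : ι) → Tangle (d i) (c i)}
    (h : T.HomTo (U.outer vs w hw hv)) (h' : ∀ i, (S i).HomTo (U.inner vs w hw hv i)) :
    (T.subst S).HomTo U := by
  obtain ⟨f, g, hf, hg⟩ := h
  choose f' g' hf' hg' using h'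
  refine ⟨Quot.lift (Sum.elim f fun x => f' x.1 x.2) ?_,
    Quot.lift (Sum.elim g fun x => g' x.1 x.2) ?_, ?_, ?_⟩
  · rintro _ _ ⟨i, p⟩
    exact (hf (some i) p).trans (hf' i none p).symm
  · rintro _ _ ⟨i, p⟩
    exact (hg (some i) p).trans (hg' i none p).symm
  · rintro (_ | ⟨i, j⟩) p
    · exact hf none p
    · exact hf' i (some j) p
  · rintro (_ | ⟨i, j⟩) p
    · exact hg none p
    · exact hg' i (some j) p

end Subst

end Tangle

/-! ### Non-crossing matchings -/

/-- `σ` is a non-crossing perfect matching of `{0, …, N - 1}`. -/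
structure NonCrossing (N : ℕ) (σ : ℕ → ℕ) : Prop where
  lt : ∀ x < N, σ x < N
  invol : ∀ x < N, σ (σ x) = x
  odd : ∀ x < N, (x + σ x) % 2 = 1
  nested : ∀ x y, x < N → x < y → y < σ x → x < σ y ∧ σ y < σ x

/-- The face, of the half plane cut along the arcs of the matching `σ`, that touches the gap before
the point `x`: it is `0` for the unbounded face, and `r + 1` for the face below the arc that begins
at `r`. -/
def arcLabel (σ : ℕ → ℕ) : ℕ → ℕ
  | 0 => 0
  | i + 1 => if h : σ i < i then arcLabel σ (σ i) else i + 1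
termination_by n => n
decreasing_by omega

theorem arcLabel_zero (σ : ℕ → ℕ) : arcLabel σ 0 = 0 := by rw [arcLabel]

theorem arcLabel_succ (σ : ℕ → ℕ) (i : ℕ) :
    arcLabel σ (i + 1) = if σ i < i then arcLabel σ (σ i) else i + 1 := by
  rw [arcLabel]
  split <;> rfl

theorem arcLabel_le (σ : ℕ → ℕ) (x : ℕ) : arcLabel σ x ≤ x := by
  induction x using Nat.strong_induction_on with
  | _ x ih =>
    rcases x with _ | i
    · rw [arcLabel_zero]
    · rw [arcLabel_succ]
      split
      · have := ih (σ i) (by omega)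
        omega
      · omega

namespace NonCrossing

variable {N : ℕ} {σ : ℕ → ℕ}

theorem arcLabel_open (i : ℕ) (h : i < σ i) : arcLabel σ (i + 1) = i + 1 := by
  rw [arcLabel_succ, if_neg (by omega)]

theorem arcLabel_close (i : ℕ) (h : σ i < i) : arcLabel σ (i + 1) = arcLabel σ (σ i) := by
  rw [arcLabel_succ, if_pos h]

theorem arcLabel_parity (h : NonCrossing N σ) (x : ℕ) (hx : x ≤ N) :
    arcLabel σ x % 2 = x % 2 := by
  induction x using Nat.strong_induction_on with
  | _ x ih =>
    rcases x with _ | i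
    · rw [arcLabel_zero]
    · rw [arcLabel_succ]
      split
      · have := ih (σ i) (by omega) (by omega)
        have := h.odd i (by omega)
        omega
      · rfl

/-- Passing the end of an arc leads back to the face before its beginning, and by nesting every
other arc lies above both of these gaps or above neither. So the label always names an arc above the
gap; by `le_arcLabel` it is the innermost one. -/
theorem arcLabel_enclosing (h : NonCrossing N σ) (x : ℕ) (hx : x ≤ N) :
    arcLabel σ x = 0 ∨ ∃ r, arcLabel σ x = r + 1 ∧ r < x ∧ x ≤ σ r := by
  induction x using Nat.strong_induction_on with
  | _ x ih =>
    rcases x with _ | i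
    · left; rw [arcLabel_zero]
    · rw [arcLabel_succ]
      have hodd := h.odd i (by omega)
      split
      · rename_i hi
        rcases ih (σ i) (by omega) (by omega) with h0 | ⟨r, hr, hr1, hr2⟩
        · exact Or.inl h0
        · refine Or.inr ⟨r, hr, by omega, ?_⟩
          have hinv := h.invol i (by omega)
          rcases Nat.lt_or_ge (σ i) (σ r) with hlt | hge
          · have := h.nested r (σ i) (by omega) hr1 hlt
            omega
          · have he : σ i = σ r := by omega
            have := h.invol r (by omega)
            rw [he] at hinv
            omega
      · exact Or.inr ⟨i, rfl, by omega, by omega⟩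

theorem le_arcLabel (h : NonCrossing N σ) (p x : ℕ) (hx : x ≤ N) (hp : p < x) (hp' : x ≤ σ p) :
    p + 1 ≤ arcLabel σ x := by
  induction x using Nat.strong_induction_on with
  | _ x ih =>
    rcases x with _ | i
    · omega
    · rw [arcLabel_succ]
      split
      · rename_i hi
        have hpi : p ≠ i := by rintro rfl; omega
        have := h.nested p i (by omega) (by omega) (by omega)
        exact ih (σ i) (by omega) (by omega) (by omega) (by omega)
      · omega

/-- The arc at `x` is above the gap before its own end, and an arc that begins later cannot be above
that gap without crossing it. -/
theorem arcLabel_inside (h : NonCrossing N σ) (x : ℕ) (hx : x < N) (hx' : x < σ x) :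
    arcLabel σ (σ x) = x + 1 := by
  have hlt := h.lt x hx
  have hge := h.le_arcLabel x (σ x) (by omega) hx' le_rfl
  rcases h.arcLabel_enclosing (σ x) (by omega) with h0 | ⟨r, hr, hr1, hr2⟩
  · omega
  · rcases Nat.lt_or_ge x r with hxr | hxr
    · have := h.nested x r hx hxr hr1
      omega
    · omega

/-- The face below an arc touches the gaps just inside of its two ends, and the face above it the
gaps just outside. Hence labels are constant along either side of a string. -/
theorem arcLabel_side (h : NonCrossing N σ) (x : ℕ) (hx : x < N) :
    arcLabel σ (σ x) = arcLabel σ (x + 1) ∧ arcLabel σ (σ x + 1) = arcLabel σ x := by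
  have hlt := h.lt x hx
  have hinv := h.invol x hx
  have hodd := h.odd x hx
  rcases Nat.lt_or_ge x (σ x) with hx' | hx'
  · rw [arcLabel_open x hx', arcLabel_close (σ x) (by omega), hinv]
    exact ⟨h.arcLabel_inside x hx hx', rfl⟩
  · have := h.arcLabel_inside (σ x) hlt (by omega)
    rw [arcLabel_close x (by omega), arcLabel_open (σ x) (by omega)]
    rw [hinv] at this
    exact ⟨rfl, this.symm⟩

theorem arcLabel_last (h : NonCrossing N σ) : arcLabel σ N = 0 := by
  rcases h.arcLabel_enclosing N le_rfl with h0 | ⟨r, hr, hr1, hr2⟩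
  · exact h0
  · have := h.lt r hr1
    omega

end NonCrossing

namespace Tangle

variable {ι : Type} {c : ι → Col} {c₀ : Col}

/-- The tangle with the same strings as `T`, whose regions are the boundary circles of the regions
of `T`. -/
def bdry (T : Tangle c c₀) : Tangle c c₀ where
  Str := T.Str
  Reg := T.BdryCircle
  str := T.str
  reg b I := Quot.mk _ (.inr ⟨b, I⟩)
  side x s := Quot.mk _ (.inl (x, s))
  side_str b p s := Quot.sound (Meet.mk b p s)

/-- Boundary circles refine regions. Whatever is obtained by following a boundary holds already in
`T.bdry` and is carried to `T` by this map. -/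
theorem bdry_homTo (T : Tangle c c₀) : T.bdry.HomTo T := by
  refine ⟨id, Quot.lift (Sum.elim (fun x => T.side x.1 x.2) fun I => T.reg I.1 I.2) ?_,
    fun _ _ => rfl, fun _ _ => rfl⟩
  rintro _ _ ⟨b, p, s⟩
  exact T.side_str b p s

theorem HomTo.regN_eq {T T' : Tangle c c₀} (h : T.HomTo T') {b b' : Option ι} {v v' : ℕ}
    (hv : T.regN b v = T.regN b' v') : T'.regN b v = T'.regN b' v' := by
  obtain ⟨f, g, hf, hg⟩ := h
  have := congrArg g hv
  unfold regN at this ⊢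
  rwa [hg, hg] at this

/-! ### Tangles given by non-crossing matchings

Join the `*`-intervals of all boxes within one region. Cutting along these paths turns the
complement of the boxes into a disc, on the boundary of which we find the points of the internal
boxes, one box after the other, and then the points of the external box in the reverse order. -/

/-- The place, among `N` points, of the point `v` of the box `b`, where the points of the internal
box `i` begin with number `st i`. -/
def ptPos (st : ι → ℕ) (N : ℕ) : Option ι → ℕ → ℕ
  | none, v => N - 1 - v
  | some i, v => st i + v

/-- The place of the boundary interval `v` of the box `b`. -/
def ivlPos (st : ι → ℕ) (N : ℕ) : Option ι → ℕ → ℕ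
  | none, v => N - v
  | some i, v => st i + v

/-- The interval that, in the order of places, comes before the point `v`. -/
def before : Option ι → ℕ → ℕ
  | none, v => v + 1
  | some _, v => v

/-- The interval that, in the order of places, comes after the point `v`. -/
def after : Option ι → ℕ → ℕ
  | none, v => v
  | some _, v => v + 1

/-- The relation `J` joins the marked points according to the matching `σ`. -/
structure IsWord (c : ι → Col) (c₀ : Col)
    (J : (Σ b, (boxCol c c₀ b).Pt) → (Σ b, (boxCol c c₀ b).Pt) → Prop)
    (st : ι → ℕ) (N : ℕ) (σ : ℕ → ℕ) : Prop where
  nonCrossing : NonCrossing N σ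
  col : ∀ b, ∃ n, boxCol c c₀ b = .nat n
  even : ∀ i, st i % 2 = 0
  even_len : N % 2 = 0
  le : ∀ i, st i + 2 * (c i).num ≤ N
  le_len : 2 * c₀.num ≤ N
  inj : ∀ b v b' v', v < 2 * (boxCol c c₀ b).num → v' < 2 * (boxCol c c₀ b').num →
    ptPos st N b v = ptPos st N b' v' → b = b' ∧ v = v'
  surj : ∀ x < N, ∃ b v, v < 2 * (boxCol c c₀ b).num ∧ ptPos st N b v = x
  joined : ∀ b p b' q, J ⟨b, p⟩ ⟨b', q⟩ → σ (ptPos st N b p.val) = ptPos st N b' q.val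
  join : ∀ b p b' q, σ (ptPos st N b p.val) = ptPos st N b' q.val →
    J ⟨b, p⟩ ⟨b', q⟩ ∨ J ⟨b', q⟩ ⟨b, p⟩
  gap : ∀ b v, 0 < v → v < 2 * (boxCol c c₀ b).num → ∀ b',
    ivlPos st N b v ≠ ivlPos st N b' 0 ∧ ivlPos st N b v ≠ ivlPos st N b' (2 * (boxCol c c₀ b').num)

namespace IsWord

variable {J : (Σ b, (boxCol c c₀ b).Pt) → (Σ b, (boxCol c c₀ b).Pt) → Prop}
  {st : ι → ℕ} {N : ℕ} {σ : ℕ → ℕ}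

theorem ptPos_lt (h : IsWord c c₀ J st N σ) (b : Option ι) (v : ℕ)
    (hv : v < 2 * (boxCol c c₀ b).num) : ptPos st N b v < N := by
  rcases b with _ | i
  · have := h.le_len
    simp only [ptPos, boxCol] at *
    omega
  · have := h.le i
    simp only [ptPos, boxCol] at *
    omega

theorem ivlPos_le (h : IsWord c c₀ J st N σ) (b : Option ι) (v : ℕ)
    (hv : v ≤ 2 * (boxCol c c₀ b).num) : ivlPos st N b v ≤ N := by
  rcases b with _ | i
  · simp only [ivlPos]; omega
  · have := h.le i
    simp only [ivlPos, boxCol] at *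
    omega

theorem ivlPos_before (_ : IsWord c c₀ J st N σ) (b : Option ι) (v : ℕ)
    (hv : v < 2 * (boxCol c c₀ b).num) :
    ivlPos st N b (before b v) = ptPos st N b v ∧ before b v ≤ 2 * (boxCol c c₀ b).num := by
  rcases b with _ | i
  · simp only [ptPos, ivlPos, before]; omega
  · exact ⟨rfl, hv.le⟩

theorem ivlPos_after (h : IsWord c c₀ J st N σ) (b : Option ι) (v : ℕ)
    (hv : v < 2 * (boxCol c c₀ b).num) :
    ivlPos st N b (after b v) = ptPos st N b v + 1 ∧ after b v ≤ 2 * (boxCol c c₀ b).num := by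
  rcases b with _ | i
  · have := h.le_len
    simp only [ptPos, ivlPos, after, boxCol] at *; omega
  · simp only [ptPos, ivlPos, after]; omega

theorem exists_before (_ : IsWord c c₀ J st N σ) (b : Option ι) (v : ℕ) (hv0 : 0 < v)
    (hv : v < 2 * (boxCol c c₀ b).num) :
    ∃ w, w < 2 * (boxCol c c₀ b).num ∧ before b w = v ∧ ptPos st N b w = ivlPos st N b v := by
  rcases b with _ | i
  · refine ⟨v - 1, by omega, ?_, ?_⟩ <;> simp only [ptPos, ivlPos, before] <;> omega
  · exact ⟨v, hv, rfl, rfl⟩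

theorem exists_after (h : IsWord c c₀ J st N σ) (b : Option ι) (v : ℕ) (hv0 : 0 < v)
    (hv : v < 2 * (boxCol c c₀ b).num) :
    ∃ w, w < 2 * (boxCol c c₀ b).num ∧ after b w = v ∧
      ptPos st N b w + 1 = ivlPos st N b v := by
  rcases b with _ | i
  · have := h.le_len
    refine ⟨v, hv, rfl, ?_⟩
    simp only [ptPos, ivlPos, boxCol] at *; omega
  · refine ⟨v - 1, by omega, ?_, ?_⟩ <;> simp only [ptPos, ivlPos, after] <;> omega

theorem ptPos_parity (h : IsWord c c₀ J st N σ) (b : Option ι) (v : ℕ)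
    (hv : v < 2 * (boxCol c c₀ b).num) :
    ptPos st N b v % 2 = if b = none then (v + 1) % 2 else v % 2 := by
  rcases b with _ | i
  · have := h.le_len
    have := h.even_len
    simp only [ptPos, boxCol, if_true] at *; omega
  · have := h.even i
    simp only [ptPos, reduceCtorEq, if_false]; omega

variable {G : (Σ b, (boxCol c c₀ b).Ivl) → (Σ b, (boxCol c c₀ b).Ivl) → Prop}

theorem str_eq (h : IsWord c c₀ J st N σ) {b b' : Option ι} {p : (boxCol c c₀ b).Pt}
    {q : (boxCol c c₀ b').Pt} (hpq : σ (ptPos st N b p.val) = ptPos st N b' q.val) :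
    (ofJoin c c₀ J G).str b p = (ofJoin c c₀ J G).str b' q := by
  rcases h.join _ _ _ _ hpq with hj | hj
  · exact Quot.sound hj
  · exact (Quot.sound hj).symm

theorem regN_before_after (h : IsWord c c₀ J st N σ) (T : Tangle c c₀) {b b' : Option ι}
    {p : (boxCol c c₀ b).Pt} {q : (boxCol c c₀ b').Pt} (hpq : T.str b p = T.str b' q)
    (hpar : (ptPos st N b p.val + ptPos st N b' q.val) % 2 = 1) :
    T.regN b (before b p.val) = T.regN b' (after b' q.val) := by
  have h1 := h.ptPos_parity b p.val p.isLt
  have h2 := h.ptPos_parity b' q.val q.isLt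
  rcases b with _ | i <;> rcases b' with _ | i' <;>
    simp only [reduceCtorEq, if_true, if_false] at h1 h2 <;> simp only [before, after]
  · exact (T.regN_of_str_eq_odd hpq.symm (by omega)).symm
  · exact (T.regN_of_str_eq_even hpq (by omega)).2
  · exact (T.regN_of_str_eq_even hpq (by omega)).1
  · exact T.regN_of_str_eq_odd hpq (by omega)

/-- Following the boundary of a region forward. -/
theorem exists_forward (h : IsWord c c₀ J st N σ) (b : Option ι) (v : ℕ) (hv0 : 0 < v)
    (hv : v < 2 * (boxCol c c₀ b).num) : ∃ b' v', v' ≤ 2 * (boxCol c c₀ b').num ∧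
      ivlPos st N b' v' = σ (ivlPos st N b v) + 1 ∧
      (ofJoin c c₀ J G).bdry.regN b v = (ofJoin c c₀ J G).bdry.regN b' v' := by
  obtain ⟨w, hw, rfl, hw'⟩ := h.exists_before b v hv0 hv
  rw [← hw']
  have hlt := h.ptPos_lt b w hw
  obtain ⟨b', q, hq, hq'⟩ := h.surj _ (h.nonCrossing.lt _ hlt)
  have hodd := h.nonCrossing.odd _ hlt
  refine ⟨b', after b' q, (h.ivlPos_after b' q hq).2, ?_, ?_⟩
  · rw [(h.ivlPos_after b' q hq).1, hq']
  · refine h.regN_before_after (ofJoin c c₀ J G).bdry (p := ⟨w, hw⟩) (q := ⟨q, hq⟩) ?_ ?_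
    · exact h.str_eq (G := G) (p := ⟨w, hw⟩) (q := ⟨q, hq⟩) hq'.symm
    · rw [hq']; exact hodd

/-- Following the boundary of a region backward. -/
theorem exists_backward (h : IsWord c c₀ J st N σ) (b : Option ι) (v : ℕ) (hv0 : 0 < v)
    (hv : v < 2 * (boxCol c c₀ b).num) : ∃ b' v', v' ≤ 2 * (boxCol c c₀ b').num ∧
      ivlPos st N b' v' = σ (ivlPos st N b v - 1) ∧
      (ofJoin c c₀ J G).bdry.regN b v = (ofJoin c c₀ J G).bdry.regN b' v' := by
  obtain ⟨w, hw, rfl, hw'⟩ := h.exists_after b v hv0 hv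
  rw [← hw', Nat.add_sub_cancel]
  have hlt := h.ptPos_lt b w hw
  obtain ⟨b', q, hq, hq'⟩ := h.surj _ (h.nonCrossing.lt _ hlt)
  have hodd := h.nonCrossing.odd _ hlt
  refine ⟨b', before b' q, (h.ivlPos_before b' q hq).2, ?_, ?_⟩
  · rw [(h.ivlPos_before b' q hq).1, hq']
  · refine (h.regN_before_after (ofJoin c c₀ J G).bdry (p := ⟨q, hq⟩) (q := ⟨w, hw⟩) ?_ ?_).symm
    · exact (h.str_eq (G := G) (p := ⟨w, hw⟩) (q := ⟨q, hq⟩) hq'.symm).symm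
    · rw [hq', Nat.add_comm]; exact hodd

/-- A place between two boxes. -/
def IsGap (c : ι → Col) (c₀ : Col) (st : ι → ℕ) (N : ℕ) (g : ℕ) : Prop :=
  ∃ b : Option ι, g = ivlPos st N b 0 ∨ g = ivlPos st N b (2 * (boxCol c c₀ b).num)

theorem gap_le (h : IsWord c c₀ J st N σ) {g : ℕ} (hg : IsGap c c₀ st N g) : g ≤ N := by
  obtain ⟨b, rfl | rfl⟩ := hg
  · exact h.ivlPos_le b 0 (Nat.zero_le _)
  · exact h.ivlPos_le b _ le_rfl

theorem ne_gap (h : IsWord c c₀ J st N σ) {g : ℕ} (hg : IsGap c c₀ st N g) (b : Option ι) (v : ℕ)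
    (hv0 : 0 < v) (hv : v < 2 * (boxCol c c₀ b).num) : ivlPos st N b v ≠ g := by
  obtain ⟨b', rfl | rfl⟩ := hg
  · exact (h.gap b v hv0 hv b').1
  · exact (h.gap b v hv0 hv b').2

/-- The boundary is followed from place to place, jumping from the beginning of an arc to the gap
after its end. Every jump stays in the face of `g` and does not pass `g`. Since intervals in the
interior of a box's range never occupy a gap between boxes, the walk must end at a `*`-interval, at
the latest when it arrives at `g`. -/
theorem exists_star_of_lt (h : IsWord c c₀ J st N σ) {g : ℕ} (hg : IsGap c c₀ st N g) (n : ℕ)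
    (b : Option ι) (v : ℕ) (hv : v ≤ 2 * (boxCol c c₀ b).num)
    (hlab : arcLabel σ (ivlPos st N b v) = arcLabel σ g) (hle : ivlPos st N b v ≤ g)
    (hn : g - ivlPos st N b v ≤ n) :
    ∃ b', (ofJoin c c₀ J G).bdry.regN b v = (ofJoin c c₀ J G).bdry.regN b' 0 := by
  induction n using Nat.strong_induction_on generalizing b v with
  | _ n ih =>
    rcases Nat.eq_zero_or_pos v with rfl | hv0
    · exact ⟨b, rfl⟩
    rcases Nat.lt_or_ge v (2 * (boxCol c c₀ b).num) with hv1 | hv1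
    swap
    · obtain rfl : v = 2 * (boxCol c c₀ b).num := by omega
      exact ⟨b, regN_end _ _⟩
    have hne := h.ne_gap hg b v hv0 hv1
    have hgN := h.gap_le hg
    have nc := h.nonCrossing
    obtain ⟨b', v', hv', hpos, heq⟩ := h.exists_forward (G := G) b v hv0 hv1
    generalize ivlPos st N b v = y at *
    have hodd := nc.odd y (by omega)
    have hyN := nc.lt y (by omega)
    rw [heq]
    -- Otherwise `y` would lie in the face below the arc that ends there, and this arc is not above
    -- `g`.
    have hopen : y < σ y := by
      by_contra hcon
      have hr := nc.arcLabel_inside (σ y) hyN (by rw [nc.invol y (by omega)]; omega)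
      rw [nc.invol y (by omega)] at hr
      rcases nc.arcLabel_enclosing g hgN with h0 | ⟨r, hr1, hr2, hr3⟩
      · omega
      · obtain rfl : r = σ y := by omega
        rw [nc.invol y (by omega)] at hr3
        omega
    have hlt : σ y < g := by
      by_contra hcon
      have := nc.le_arcLabel y g hgN (by omega) (by omega)
      have := arcLabel_le σ y
      omega
    have hside := (nc.arcLabel_side y (by omega)).2
    exact ih (g - (σ y + 1)) (by omega) b' v' hv' (by rw [hpos, hside, hlab]) (by omega) (by omega)

/-- The mirror image of `exists_star_of_lt`, jumping backward from the ends of arcs to their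
beginnings. -/
theorem exists_star_of_gt (h : IsWord c c₀ J st N σ) {g : ℕ} (hg : IsGap c c₀ st N g) (n : ℕ)
    (b : Option ι) (v : ℕ) (hv : v ≤ 2 * (boxCol c c₀ b).num)
    (hlab : arcLabel σ (ivlPos st N b v) = arcLabel σ g) (hle : g ≤ ivlPos st N b v)
    (hn : ivlPos st N b v ≤ n) :
    ∃ b', (ofJoin c c₀ J G).bdry.regN b v = (ofJoin c c₀ J G).bdry.regN b' 0 := by
  induction n using Nat.strong_induction_on generalizing b v with
  | _ n ih =>
    rcases Nat.eq_zero_or_pos v with rfl | hv0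
    · exact ⟨b, rfl⟩
    rcases Nat.lt_or_ge v (2 * (boxCol c c₀ b).num) with hv1 | hv1
    swap
    · obtain rfl : v = 2 * (boxCol c c₀ b).num := by omega
      exact ⟨b, regN_end _ _⟩
    have hne := h.ne_gap hg b v hv0 hv1
    have hgN := h.gap_le hg
    have nc := h.nonCrossing
    have hbN := h.ivlPos_le b v hv
    obtain ⟨b', v', hv', hpos, heq⟩ := h.exists_backward (G := G) b v hv0 hv1
    generalize ivlPos st N b v = y at *
    obtain ⟨i, rfl⟩ : ∃ i, y = i + 1 := ⟨y - 1, by omega⟩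
    rw [Nat.add_sub_cancel] at hpos
    have hodd := nc.odd i (by omega)
    have hyN := nc.lt i (by omega)
    rw [heq]
    have hlabg := arcLabel_le σ g
    have hclose : σ i < i := by
      by_contra hcon
      rw [NonCrossing.arcLabel_open i (by omega)] at hlab
      omega
    rw [NonCrossing.arcLabel_close i hclose] at hlab
    have hlt : g ≤ σ i := by
      by_contra hcon
      have := nc.le_arcLabel (σ i) g hgN (by omega) (by rw [nc.invol i (by omega)]; omega)
      have := arcLabel_le σ (σ i)
      omega
    exact ih (σ i) (by omega) b' v' hv' (by rw [hpos, hlab]) (by omega) (by omega)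

theorem exists_star (h : IsWord c c₀ J st N σ) {g : ℕ} (hg : IsGap c c₀ st N g)
    (b : Option ι) (v : ℕ) (hv : v ≤ 2 * (boxCol c c₀ b).num)
    (hlab : arcLabel σ (ivlPos st N b v) = arcLabel σ g) :
    ∃ b', (ofJoin c c₀ J G).bdry.regN b v = (ofJoin c c₀ J G).bdry.regN b' 0 := by
  rcases Nat.le_total (ivlPos st N b v) g with hle | hle
  · exact h.exists_star_of_lt hg _ b v hv hlab hle le_rfl
  · exact h.exists_star_of_gt hg _ b v hv hlab hle le_rfl

/-- A face without gaps has a single boundary circle: going backward along it never leads to the end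
of a box's range, so the walk can only stop at the beginning of the arc that names the face. -/
theorem regN_eq_after (h : IsWord c c₀ J st N σ) (b : Option ι) (v : ℕ)
    (hv : v ≤ 2 * (boxCol c c₀ b).num)
    (hlab : ∀ g, IsGap c c₀ st N g → arcLabel σ (ivlPos st N b v) ≠ arcLabel σ g)
    (b₁ : Option ι) (q : ℕ) (hq : q < 2 * (boxCol c c₀ b₁).num)
    (hpos : arcLabel σ (ivlPos st N b v) = ptPos st N b₁ q + 1) :
    (ofJoin c c₀ J G).bdry.regN b v = (ofJoin c c₀ J G).bdry.regN b₁ (after b₁ q) := by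
  induction hn : ivlPos st N b v using Nat.strong_induction_on generalizing b v with
  | _ n ih =>
    have hv0 : 0 < v := by
      rcases Nat.eq_zero_or_pos v with rfl | hv0
      · exact absurd rfl (hlab _ ⟨b, Or.inl rfl⟩)
      · exact hv0
    have hv1 : v < 2 * (boxCol c c₀ b).num := by
      rcases Nat.lt_or_ge v (2 * (boxCol c c₀ b).num) with hv1 | hv1
      · exact hv1
      · obtain rfl : v = 2 * (boxCol c c₀ b).num := by omega
        exact absurd rfl (hlab _ ⟨b, Or.inr rfl⟩)
    obtain ⟨w, hw, hw', hw''⟩ := h.exists_after b v hv0 hv1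
    obtain ⟨b', v', hv', hpos', heq⟩ := h.exists_backward (G := G) b v hv0 hv1
    rw [← hw''] at hn
    rw [← hw'', Nat.add_sub_cancel] at hpos'
    rw [← hw''] at hpos
    have hodd := h.nonCrossing.odd _ (h.ptPos_lt b w hw)
    rcases Nat.lt_or_ge (σ (ptPos st N b w)) (ptPos st N b w) with hc | hc
    · rw [heq]
      rw [NonCrossing.arcLabel_close _ hc, ← hpos'] at hpos
      refine ih _ (by omega) b' v' hv' ?_ hpos rfl
      intro g hg
      rw [hpos', ← NonCrossing.arcLabel_close _ hc, hw'']
      exact hlab g hg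
    · rw [NonCrossing.arcLabel_open _ (by omega)] at hpos
      obtain ⟨rfl, rfl⟩ := h.inj b w b₁ q hw hq (by omega)
      rw [hw']

end IsWord

end Tangle

/-! ### Counting regions and strings -/

theorem Nat.card_eq_of_injective {α β : Type*} (f : α → β) (hf : Function.Injective f)
    (R : Finset β) (hR : ∀ y, y ∈ R ↔ ∃ a, f a = y) : Nat.card α = R.card := by
  have h : Set.range f = ↑R := by
    ext y
    simp [hR]
  rw [← Nat.card_range_of_injective hf, h]
  simp

namespace Tangle

variable {ι : Type} {c : ι → Col} {c₀ : Col}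

namespace IsWord

variable {J : (Σ b, (boxCol c c₀ b).Pt) → (Σ b, (boxCol c c₀ b).Pt) → Prop}
  {st : ι → ℕ} {N : ℕ} {σ : ℕ → ℕ}
  {G : (Σ b, (boxCol c c₀ b).Ivl) → (Σ b, (boxCol c c₀ b).Ivl) → Prop}

/-- The label of a region, which is `0` for the region that touches the `*`-intervals. Here `Γ`
is the set of labels of the gaps between boxes. -/
def regLabel (σ : ℕ → ℕ) (Γ : Finset ℕ) (x : ℕ) : ℕ :=
  if arcLabel σ x ∈ Γ then 0 else arcLabel σ x

theorem regLabel_adj (h : IsWord c c₀ J st N σ) {Γ : Finset ℕ}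
    (hΓ : ∀ y, y ∈ Γ ↔ ∃ g, IsGap c c₀ st N g ∧ arcLabel σ g = y)
    (b : Option ι) (p : (boxCol c c₀ b).Pt) (s : Bool) :
    regLabel σ Γ (ivlPos st N b ((boxCol c c₀ b).adj p s).val) =
      regLabel σ Γ (if (ptPos st N b p.val % 2 == 0) = s then ptPos st N b p.val
        else ptPos st N b p.val + 1) := by
  have h1 := h.ptPos_parity b p.val p.isLt
  have h2 : regLabel σ Γ (ivlPos st N b ((boxCol c c₀ b).adj p s).val) =
      regLabel σ Γ (ivlPos st N b (if (p.val % 2 == 0) = s then p.val else p.val + 1)) := by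
    rcases Col.adj_val_cases _ p s with h | ⟨h, h'⟩
    · rw [h]
    · rw [h, h']
      unfold regLabel
      rw [if_pos ((hΓ _).2 ⟨_, ⟨b, Or.inl rfl⟩, rfl⟩),
        if_pos ((hΓ _).2 ⟨_, ⟨b, Or.inr rfl⟩, rfl⟩)]
  rw [h2]
  have h3 := (h.ivlPos_before b p.val p.isLt).1
  have h4 := (h.ivlPos_after b p.val p.isLt).1
  rcases b with _ | i
  · simp only [if_true] at h1
    by_cases hs : (p.val % 2 == 0) = s
    · rw [if_pos hs, if_neg]
      · exact congrArg _ h4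
      · rw [h1, ← hs, Bool.eq_iff_iff]; simp; omega
    · rw [if_neg hs, if_pos]
      · exact congrArg _ h3
      · rw [h1, ← Bool.not_eq.2 hs, Bool.eq_iff_iff]; simp; omega
  · simp only [reduceCtorEq, if_false] at h1
    rw [h1]
    split_ifs <;> rfl

/-- The two ends of an arc have opposite parities, so a fixed shade selects the gap before one end
and the gap after the other; these have equal labels by `arcLabel_side`. -/
theorem regLabel_joined (h : IsWord c c₀ J st N σ) {Γ : Finset ℕ}
    (x : ℕ) (hx : x < N) (s : Bool) :
    regLabel σ Γ (if (σ x % 2 == 0) = s then σ x else σ x + 1) =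
      regLabel σ Γ (if (x % 2 == 0) = s then x else x + 1) := by
  have h1 := h.nonCrossing.odd x hx
  have h2 := h.nonCrossing.arcLabel_side x hx
  have : (σ x % 2 == 0) = !(x % 2 == 0) := by
    rw [Bool.eq_iff_iff]; simp; omega
  rw [this]
  unfold regLabel
  cases (x % 2 == 0) <;> cases s <;> simp [h2]

/-- The labelling of the regions. -/
theorem exists_regLabel (h : IsWord c c₀ J st N σ)
    (hG : ∀ I I', G I I' → SameStar c c₀ I I') {Γ : Finset ℕ}
    (hΓ : ∀ y, y ∈ Γ ↔ ∃ g, IsGap c c₀ st N g ∧ arcLabel σ g = y) :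
    ∃ f : (ofJoin c c₀ J G).Reg → ℕ,
      (∀ b I, f ((ofJoin c c₀ J G).reg b I) = regLabel σ Γ (ivlPos st N b I.val)) ∧
      ∀ b p s, f ((ofJoin c c₀ J G).side ((ofJoin c c₀ J G).str b p) s) =
        regLabel σ Γ (if (ptPos st N b p.val % 2 == 0) = s then ptPos st N b p.val
        else ptPos st N b p.val + 1) := by
  refine ⟨Quot.lift (fun I => regLabel σ Γ (ivlPos st N I.1 I.2.val)) ?_, fun _ _ => rfl,
    fun b p s => ?_⟩
  · rintro ⟨b, I⟩ ⟨b', I'⟩ (hg | ⟨⟨b₁, p⟩, ⟨b₂, q⟩, s, hj, h1, h2⟩)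
    · obtain ⟨h1, h2⟩ := hG _ _ hg
      dsimp only at h1 h2 ⊢
      subst h1 h2
      change regLabel σ Γ (ivlPos st N b 0) = regLabel σ Γ (ivlPos st N b' 0)
      unfold regLabel
      rw [if_pos ((hΓ _).2 ⟨_, ⟨b, Or.inl rfl⟩, rfl⟩),
        if_pos ((hΓ _).2 ⟨_, ⟨b', Or.inl rfl⟩, rfl⟩)]
    · rw [h1, h2]
      dsimp only
      rw [h.regLabel_adj hΓ, h.regLabel_adj hΓ, ← h.joined _ _ _ _ hj,
        h.regLabel_joined _ (h.ptPos_lt b₁ p.val p.isLt)]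
  · exact h.regLabel_adj hΓ b p s

theorem bdry_regN_eq (h : IsWord c c₀ J st N σ) {Γ : Finset ℕ}
    (hΓ : ∀ y, y ∈ Γ ↔ ∃ g, IsGap c c₀ st N g ∧ arcLabel σ g = y)
    (b b' : Option ι) (v v' : ℕ) (hv : v ≤ 2 * (boxCol c c₀ b).num)
    (hv' : v' ≤ 2 * (boxCol c c₀ b').num)
    (heq : regLabel σ Γ (ivlPos st N b v) = regLabel σ Γ (ivlPos st N b' v'))
    (hne : regLabel σ Γ (ivlPos st N b v) ≠ 0) :
    (ofJoin c c₀ J G).bdry.regN b v = (ofJoin c c₀ J G).bdry.regN b' v' := by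
  unfold regLabel at heq hne
  split at hne
  · exact absurd rfl hne
  rename_i hn
  rw [if_neg hn] at heq
  split at heq
  · exact absurd heq hne
  rename_i hn'
  have hgap : ∀ y, y ∉ Γ → ∀ g, IsGap c c₀ st N g → y ≠ arcLabel σ g := by
    rintro y hy g hg rfl
    exact hy ((hΓ _).2 ⟨g, hg, rfl⟩)
  have hle := h.ivlPos_le b v hv
  rcases h.nonCrossing.arcLabel_enclosing _ hle with h0 | ⟨r, hr, hr1, hr2⟩
  · exact absurd h0 hne
  · obtain ⟨b₁, q, hq, hq'⟩ := h.surj r (by omega)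
    rw [h.regN_eq_after b v hv (hgap _ hn) b₁ q hq (by rw [hq', hr]),
      h.regN_eq_after b' v' hv' (hgap _ hn') b₁ q hq (by rw [hq', ← hr, heq])]

theorem exists_star_of_regLabel (h : IsWord c c₀ J st N σ) {Γ : Finset ℕ}
    (hΓ : ∀ y, y ∈ Γ ↔ ∃ g, IsGap c c₀ st N g ∧ arcLabel σ g = y)
    (b : Option ι) (v : ℕ) (hv : v ≤ 2 * (boxCol c c₀ b).num)
    (hz : regLabel σ Γ (ivlPos st N b v) = 0) :
    ∃ b', (ofJoin c c₀ J G).bdry.regN b v = (ofJoin c c₀ J G).bdry.regN b' 0 := by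
  unfold regLabel at hz
  split at hz
  · rename_i hn
    obtain ⟨g, hg, hg'⟩ := (hΓ _).1 hn
    exact h.exists_star hg b v hv hg'.symm
  · have h0 : IsGap c c₀ st N N := ⟨none, Or.inl rfl⟩
    exact h.exists_star h0 b v hv (by rw [hz, h.nonCrossing.arcLabel_last])

/-- The beginnings of the arcs. -/
def opens (N : ℕ) (σ : ℕ → ℕ) : Finset ℕ := (Finset.range N).filter fun x => x < σ x

theorem mem_opens {x : ℕ} : x ∈ opens N σ ↔ x < N ∧ x < σ x := by simp [opens]

theorem ivl_le (b : Option ι) (I : (boxCol c c₀ b).Ivl) : I.val ≤ 2 * (boxCol c c₀ b).num := by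
  have := I.isLt
  omega

theorem reg_eq_of_label (h : IsWord c c₀ J st N σ) {Γ : Finset ℕ}
    (hΓ : ∀ y, y ∈ Γ ↔ ∃ g, IsGap c c₀ st N g ∧ arcLabel σ g = y)
    (hstar : ∀ b b', (ofJoin c c₀ J G).regN b 0 = (ofJoin c c₀ J G).regN b' 0)
    (b b' : Option ι) (I : (boxCol c c₀ b).Ivl) (I' : (boxCol c c₀ b').Ivl)
    (heq : regLabel σ Γ (ivlPos st N b I.val) = regLabel σ Γ (ivlPos st N b' I'.val)) :
    (ofJoin c c₀ J G).reg b I = (ofJoin c c₀ J G).reg b' I' := by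
  rw [reg_eq_regN, reg_eq_regN]
  by_cases hz : regLabel σ Γ (ivlPos st N b I.val) = 0
  · obtain ⟨b₁, h1⟩ := h.exists_star_of_regLabel (G := G) hΓ b I.val (ivl_le b I) hz
    obtain ⟨b₂, h2⟩ := h.exists_star_of_regLabel (G := G) hΓ b' I'.val (ivl_le b' I') (heq ▸ hz)
    rw [(bdry_homTo _).regN_eq h1, (bdry_homTo _).regN_eq h2, hstar b₁ b₂]
  · exact (bdry_homTo _).regN_eq
      (h.bdry_regN_eq hΓ b b' _ _ (ivl_le b I) (ivl_le b' I') heq hz)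

/-- The faces number one more than the arcs. Those that contain gaps, `Γ.card` in all, are merged
into the one region of the `*`-intervals, which leaves arcs + 2 - `Γ.card` regions. -/
theorem card_reg (h : IsWord c c₀ J st N σ)
    (hG : ∀ I I', G I I' → SameStar c c₀ I I') {Γ : Finset ℕ}
    (hΓ : ∀ y, y ∈ Γ ↔ ∃ g, IsGap c c₀ st N g ∧ arcLabel σ g = y)
    (hstar : ∀ b b', (ofJoin c c₀ J G).regN b 0 = (ofJoin c c₀ J G).regN b' 0) :
    ∃ R : Finset ℕ, 0 ∈ R ∧ R.card + Γ.card = (opens N σ).card + 2 ∧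
      (∀ b I, regLabel σ Γ (ivlPos st N b I) ∈ R ∨ 2 * (boxCol c c₀ b).num < I) ∧
      (∀ y ∈ R, ∃ b v, v < max 1 (2 * (boxCol c c₀ b).num) ∧
        regLabel σ Γ (ivlPos st N b v) = y) ∧
      Nat.card (ofJoin c c₀ J G).Reg = R.card := by
  have nc := h.nonCrossing
  have h0 : 0 ∈ Γ := (hΓ 0).2 ⟨N, ⟨none, Or.inl rfl⟩, nc.arcLabel_last⟩
  have hsucc : Γ.erase 0 ⊆ (opens N σ).image Nat.succ := by
    intro y hy
    obtain ⟨hy0, hy⟩ := Finset.mem_erase.1 hy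
    obtain ⟨g, hg, rfl⟩ := (hΓ y).1 hy
    have hgN := h.gap_le hg
    rcases nc.arcLabel_enclosing g hgN with h0 | ⟨r, hr, hr1, hr2⟩
    · exact absurd h0 hy0
    · exact Finset.mem_image.2 ⟨r, mem_opens.2 ⟨by omega, by omega⟩, hr.symm⟩
  -- The labels in use are `0` and the `r + 1` for those arcs, beginning at `r`, whose inner face
  -- contains no gap.
  have hmemR : ∀ b I, regLabel σ Γ (ivlPos st N b I) ∈
      insert 0 ((opens N σ).image Nat.succ \ Γ.erase 0) ∨ 2 * (boxCol c c₀ b).num < I := by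
    intro b v
    rcases Nat.lt_or_ge (2 * (boxCol c c₀ b).num) v with hlt | hv
    · exact Or.inr hlt
    left
    unfold regLabel
    split
    · exact Finset.mem_insert_self _ _
    · rename_i hn
      rcases nc.arcLabel_enclosing _ (h.ivlPos_le b v hv) with h0 | ⟨r, hr, hr1, hr2⟩
      · rw [h0]; exact Finset.mem_insert_self _ _
      · have := h.ivlPos_le b v hv
        refine Finset.mem_insert_of_mem (Finset.mem_sdiff.2 ⟨Finset.mem_image.2
          ⟨r, mem_opens.2 ⟨by omega, by omega⟩, hr.symm⟩, fun hmem => hn ?_⟩)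
        exact Finset.mem_of_mem_erase hmem
  have hexR : ∀ y ∈ insert 0 ((opens N σ).image Nat.succ \ Γ.erase 0),
      ∃ b v, v < max 1 (2 * (boxCol c c₀ b).num) ∧ regLabel σ Γ (ivlPos st N b v) = y := by
    intro y hy
    rcases Finset.mem_insert.1 hy with rfl | hy
    · refine ⟨none, 0, by omega, ?_⟩
      unfold regLabel
      rw [if_pos ((hΓ _).2 ⟨_, ⟨none, Or.inl rfl⟩, rfl⟩)]
    · obtain ⟨hy, hy'⟩ := Finset.mem_sdiff.1 hy
      obtain ⟨r, hr, rfl⟩ := Finset.mem_image.1 hy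
      obtain ⟨hr, hr'⟩ := mem_opens.1 hr
      have hy'' : r + 1 ∉ Γ := fun hm => hy' (Finset.mem_erase.2 ⟨by simp, hm⟩)
      obtain ⟨b, q, hq, rfl⟩ := h.surj r hr
      have hafter := h.ivlPos_after b q hq
      have hlab := NonCrossing.arcLabel_open _ hr'
      refine ⟨b, after b q, ?_, ?_⟩
      · rcases hafter.2.lt_or_eq with hlt | heq
        · omega
        · exfalso
          apply hy''
          refine (hΓ _).2 ⟨_, ⟨b, Or.inr rfl⟩, ?_⟩
          rw [← heq, hafter.1, hlab]
      · unfold regLabel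
        rw [hafter.1, hlab, if_neg hy'']
  obtain ⟨f, hf, -⟩ := h.exists_regLabel hG hΓ
  refine ⟨insert 0 ((opens N σ).image Nat.succ \ Γ.erase 0), Finset.mem_insert_self _ _, ?_, hmemR,
    hexR, ?_⟩
  · rw [Finset.card_insert_of_notMem (by simp)]
    have h1 := Finset.card_sdiff_add_card_eq_card hsucc
    rw [Finset.card_image_of_injective _ Nat.succ_injective] at h1
    have h2 := Finset.card_erase_add_one h0
    omega
  · have hinj : Function.Injective f := by
      intro r r' hrr
      obtain ⟨b, I, rfl⟩ := (ofJoin_spanned c c₀ J G).2 r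
      obtain ⟨b', I', rfl⟩ := (ofJoin_spanned c c₀ J G).2 r'
      rw [hf, hf] at hrr
      exact h.reg_eq_of_label hΓ hstar b b' I I' hrr
    refine Nat.card_eq_of_injective f hinj _ fun y => ⟨fun hy => ?_, ?_⟩
    swap
    · rintro ⟨r, rfl⟩
      obtain ⟨b, I, rfl⟩ := (ofJoin_spanned c c₀ J G).2 r
      rw [hf]
      rcases hmemR b I.val with hm | hm
      · exact hm
      · have := ivl_le b I
        omega
    · obtain ⟨b, v, hv, rfl⟩ := hexR y hy
      exact ⟨_, hf b ⟨v, hv⟩⟩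

theorem arcs_eq_univ : (ofJoin c c₀ J G).arcs = Set.univ := by
  ext x
  simpa [arcs] using (ofJoin_spanned c c₀ J G).1 x

/-- Each string is counted at the earlier of its two places. -/
theorem card_arcs (h : IsWord c c₀ J st N σ) :
    Nat.card (ofJoin c c₀ J G).arcs = (opens N σ).card := by
  rw [arcs_eq_univ, Nat.card_congr (Equiv.Set.univ _)]
  have nc := h.nonCrossing
  let f : (ofJoin c c₀ J G).Str → ℕ :=
    Quot.lift (fun p => min (ptPos st N p.1 p.2.val) (σ (ptPos st N p.1 p.2.val))) (by
      rintro ⟨b, p⟩ ⟨b', q⟩ hj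
      dsimp only
      have hlt := h.ptPos_lt b p.val p.isLt
      rw [← h.joined _ _ _ _ hj, nc.invol _ hlt, min_comm])
  have hinj : Function.Injective f := by
    rintro ⟨b, p⟩ ⟨b', q⟩ hpq
    change min (ptPos st N b p.val) (σ (ptPos st N b p.val)) =
      min (ptPos st N b' q.val) (σ (ptPos st N b' q.val)) at hpq
    have hlt := h.ptPos_lt b p.val p.isLt
    have hlt' := h.ptPos_lt b' q.val q.isLt
    have h1 := nc.invol _ hlt
    have h2 := nc.invol _ hlt'
    have hcase : ptPos st N b p.val = ptPos st N b' q.val ∨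
        σ (ptPos st N b p.val) = ptPos st N b' q.val := by
      rcases min_choice (ptPos st N b p.val) (σ (ptPos st N b p.val)) with h3 | h3 <;>
      rcases min_choice (ptPos st N b' q.val) (σ (ptPos st N b' q.val)) with h4 | h4 <;>
      rw [h3, h4] at hpq
      · exact Or.inl hpq
      · right; rw [hpq, h2]
      · exact Or.inr hpq
      · left; rw [← h1, ← h2, hpq]
    rcases hcase with hcase | hcase
    · obtain ⟨rfl, hv⟩ := h.inj b p.val b' q.val p.isLt q.isLt hcase
      rw [Fin.ext hv]
    · exact h.str_eq (G := G) hcase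
  refine Nat.card_eq_of_injective f hinj _ fun y => ⟨fun hy => ?_, ?_⟩
  swap
  · rintro ⟨⟨b, p⟩, rfl⟩
    change min (ptPos st N b p.val) (σ (ptPos st N b p.val)) ∈ opens N σ
    have hlt := h.ptPos_lt b p.val p.isLt
    have hlt' := nc.lt _ hlt
    have h1 := nc.invol _ hlt
    have h2 := nc.odd _ hlt
    rw [mem_opens]
    rcases Nat.lt_or_ge (ptPos st N b p.val) (σ (ptPos st N b p.val)) with h3 | h3
    · rw [min_eq_left h3.le]; exact ⟨hlt, h3⟩
    · rw [min_eq_right h3, h1]; exact ⟨hlt', by omega⟩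
  · obtain ⟨hy, hy'⟩ := mem_opens.1 hy
    obtain ⟨b, q, hq, rfl⟩ := h.surj y hy
    refine ⟨Quot.mk _ ⟨b, ⟨q, hq⟩⟩, ?_⟩
    change min (ptPos st N b q) (σ (ptPos st N b q)) = _
    rw [min_eq_left hy'.le]

end IsWord

end Tangle

/-! ### Boundary circles, the Euler characteristic and planarity -/

namespace Tangle

variable {ι : Type} {c : ι → Col} {c₀ : Col}

theorem bdry_spanned {T : Tangle c c₀} (h : T.Spanned) : T.bdry.Spanned := by
  refine ⟨h.1, ?_⟩
  rintro ⟨⟨x, s⟩ | ⟨b, I⟩⟩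
  · obtain ⟨b, p, rfl⟩ := h.1 x
    exact ⟨b, _, (Quot.sound (Meet.mk b p s)).symm⟩
  · exact ⟨b, I, rfl⟩

/-- The two sides of a string, near one of its ends. -/
theorem eqvGen_regN (T : Tangle c c₀) (b : Option ι) (p : (boxCol c c₀ b).Pt) :
    Relation.EqvGen (fun q q' => ∃ x, q = T.side x true ∧ q' = T.side x false)
      (T.regN b (before b p.val)) (T.regN b (after b p.val)) := by
  have h1 := T.side_str_regN b p true
  have h2 := T.side_str_regN b p false
  have key : Relation.EqvGen (fun q q' => ∃ x, q = T.side x true ∧ q' = T.side x false)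
      (T.regN b p.val) (T.regN b (p.val + 1)) := by
    cases hp : (p.val % 2 == 0) <;> rw [hp] at h1 h2
    · exact (Relation.EqvGen.rel _ _ ⟨T.str b p, h1.symm, h2.symm⟩).symm
    · exact Relation.EqvGen.rel _ _ ⟨T.str b p, h1.symm, h2.symm⟩
  rcases b with _ | i
  · exact key.symm
  · exact key

namespace IsWord

variable {J : (Σ b, (boxCol c c₀ b).Pt) → (Σ b, (boxCol c c₀ b).Pt) → Prop}
  {st : ι → ℕ} {N : ℕ} {σ : ℕ → ℕ}
  {G : (Σ b, (boxCol c c₀ b).Ivl) → (Σ b, (boxCol c c₀ b).Ivl) → Prop}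

theorem gap_even (h : IsWord c c₀ J st N σ) {g : ℕ} (hg : IsGap c c₀ st N g) : g % 2 = 0 := by
  have h1 := h.even_len
  obtain ⟨b, rfl | rfl⟩ := hg <;> rcases b with _ | i <;> simp only [ivlPos]
  · omega
  · have := h.even i; omega
  · omega
  · have := h.even i; omega

theorem regLabel_parity (h : IsWord c c₀ J st N σ) {Γ : Finset ℕ}
    (hΓ : ∀ y, y ∈ Γ ↔ ∃ g, IsGap c c₀ st N g ∧ arcLabel σ g = y) (x : ℕ) (hx : x ≤ N) :
    regLabel σ Γ x % 2 = x % 2 := by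
  have h1 := h.nonCrossing.arcLabel_parity x hx
  unfold regLabel
  split
  · rename_i hn
    obtain ⟨g, hg, hg'⟩ := (hΓ _).1 hn
    have h2 := h.nonCrossing.arcLabel_parity g (h.gap_le hg)
    have h3 := h.gap_even hg
    omega
  · exact h1

/-- Going back by one place crosses one string, and both ends of the range of a box are in the
region of the `*`-intervals. -/
theorem connected_star (h : IsWord c c₀ J st N σ)
    (hstar : ∀ b b', (ofJoin c c₀ J G).regN b 0 = (ofJoin c c₀ J G).regN b' 0)
    (b : Option ι) (v : ℕ) (hv : v ≤ 2 * (boxCol c c₀ b).num) :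
    Relation.EqvGen (fun q q' => ∃ x, q = (ofJoin c c₀ J G).side x true ∧
      q' = (ofJoin c c₀ J G).side x false)
      ((ofJoin c c₀ J G).regN b v) ((ofJoin c c₀ J G).regN none 0) := by
  induction hn : ivlPos st N b v using Nat.strong_induction_on generalizing b v with
  | _ n ih =>
    rcases Nat.eq_zero_or_pos v with rfl | hv0
    · rw [hstar b none]; exact Relation.EqvGen.refl _
    rcases hv.lt_or_eq with hv1 | rfl
    · obtain ⟨w, hw, hw', hpos⟩ := h.exists_after b v hv0 hv1
      have hb := h.ivlPos_before b w hw
      have h1 := (ofJoin c c₀ J G).eqvGen_regN b ⟨w, hw⟩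
      dsimp only at h1
      rw [hw'] at h1
      exact h1.symm.trans _ _ _ (ih _ (by omega) b (before b w) hb.2 rfl)
    · rw [regN_end, hstar b none]; exact Relation.EqvGen.refl _

theorem outgoing_ptPos (h : IsWord c c₀ J st N σ) (b : Option ι) (v : ℕ)
    (hv : v < 2 * (boxCol c c₀ b).num) : outgoing b v = (ptPos st N b v % 2 == 0) := by
  have h1 := h.ptPos_parity b v hv
  rcases b with _ | i
  · simp only [if_true] at h1
    rw [h1, Bool.eq_iff_iff]
    simp only [outgoing, beq_iff_eq]
    omega
  · simp only [reduceCtorEq, if_false] at h1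
    rw [h1]; rfl

/-- Each region other than that of the `*`-intervals has one boundary circle. That region has one
circle for each value of `comp`: joined boxes have the same value, so it is constant along circles,
while `hcirc` puts the `*`-intervals of one component on one circle. -/
theorem card_bdry (h : IsWord c c₀ J st N σ)
    (hG : ∀ I I', G I I' → SameStar c c₀ I I') {Γ : Finset ℕ}
    (hΓ : ∀ y, y ∈ Γ ↔ ∃ g, IsGap c c₀ st N g ∧ arcLabel σ g = y)
    {R : Finset ℕ} (h0 : 0 ∈ R)
    (hmem : ∀ b I, regLabel σ Γ (ivlPos st N b I) ∈ R ∨ 2 * (boxCol c c₀ b).num < I)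
    (hex : ∀ y ∈ R, ∃ b v, v < max 1 (2 * (boxCol c c₀ b).num) ∧
        regLabel σ Γ (ivlPos st N b v) = y)
    (comp : Option ι → ℕ) {C : Finset ℕ} (hC : ∀ k, k ∈ C ↔ ∃ b, comp b = k)
    (hcomp : ∀ b p b' q, J ⟨b, p⟩ ⟨b', q⟩ → comp b = comp b')
    (hcirc : ∀ b b', comp b = comp b' →
      (ofJoin c c₀ J G).bdry.regN b 0 = (ofJoin c c₀ J G).bdry.regN b' 0) :
    Nat.card (ofJoin c c₀ J G).BdryCircle + 1 = R.card + C.card := by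
  obtain ⟨f, hf, -⟩ := h.exists_regLabel hG hΓ
  obtain ⟨-, g, -, hg⟩ := bdry_homTo (ofJoin c c₀ J G)
  let κS : (ofJoin c c₀ J G).Str → ℕ := Quot.lift (fun p => comp p.1) (by
    rintro ⟨b, p⟩ ⟨b', q⟩ hj
    exact hcomp _ _ _ _ hj)
  let κ : (ofJoin c c₀ J G).bdry.Reg → ℕ :=
    Quot.lift (Sum.elim (fun x => κS x.1) fun I => comp I.1) (by
      rintro _ _ ⟨b, p, s⟩
      rfl)
  have hκ : ∀ b I, κ ((ofJoin c c₀ J G).bdry.reg b I) = comp b := fun _ _ => rfl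
  -- The component is recorded only for the label `0`, because any other label determines the circle
  -- by itself.
  let F : (ofJoin c c₀ J G).bdry.Reg → ℕ × ℕ :=
    fun z => (f (g z), if f (g z) = 0 then κ z else 0)
  have hF : ∀ b I, F ((ofJoin c c₀ J G).bdry.reg b I) =
      (regLabel σ Γ (ivlPos st N b I.val),
        if regLabel σ Γ (ivlPos st N b I.val) = 0 then comp b else 0) := by
    intro b I
    simp only [F, hg, hκ, hf]
  have hsp := bdry_spanned (ofJoin_spanned c c₀ J G)
  have hinj : Function.Injective F := by
    intro z z' hz
    obtain ⟨b, I, rfl⟩ := hsp.2 z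
    obtain ⟨b', I', rfl⟩ := hsp.2 z'
    rw [hF, hF, Prod.mk.injEq] at hz
    obtain ⟨hz, hz'⟩ := hz
    by_cases hne : regLabel σ Γ (ivlPos st N b I.val) = 0
    · rw [if_pos hne, if_pos (hz ▸ hne)] at hz'
      obtain ⟨b₁, h1⟩ := h.exists_star_of_regLabel (G := G) hΓ b I.val (ivl_le b I) hne
      obtain ⟨b₂, h2⟩ := h.exists_star_of_regLabel (G := G) hΓ b' I'.val (ivl_le b' I') (hz ▸ hne)
      have h3 : comp b = comp b₁ := congrArg κ h1
      have h4 : comp b' = comp b₂ := congrArg κ h2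
      rw [reg_eq_regN, reg_eq_regN, h1, h2]
      exact hcirc _ _ (by omega)
    · rw [reg_eq_regN, reg_eq_regN]
      exact h.bdry_regN_eq hΓ b b' _ _ (ivl_le b I) (ivl_le b' I') hz hne
  have hcard : Nat.card (ofJoin c c₀ J G).bdry.Reg =
      ((R.erase 0).image (fun y => (y, 0)) ∪ C.image (fun k => (0, k))).card := by
    refine Nat.card_eq_of_injective F hinj _ fun y => ⟨fun hy => ?_, ?_⟩
    · rcases Finset.mem_union.1 hy with hy | hy
      · obtain ⟨r, hr, rfl⟩ := Finset.mem_image.1 hy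
        obtain ⟨hr0, hr⟩ := Finset.mem_erase.1 hr
        obtain ⟨b, v, hv, rfl⟩ := hex r hr
        refine ⟨(ofJoin c c₀ J G).bdry.reg b ⟨v, hv⟩, ?_⟩
        rw [hF, if_neg hr0]
      · obtain ⟨k, hk, rfl⟩ := Finset.mem_image.1 hy
        obtain ⟨b, rfl⟩ := (hC k).1 hk
        refine ⟨(ofJoin c c₀ J G).bdry.reg b (boxCol c c₀ b).star, ?_⟩
        have : regLabel σ Γ (ivlPos st N b (boxCol c c₀ b).star.val) = 0 := by
          unfold regLabel
          exact if_pos ((hΓ _).2 ⟨_, ⟨b, Or.inl rfl⟩, rfl⟩)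
        rw [hF, this, if_pos rfl]
    · rintro ⟨z, rfl⟩
      obtain ⟨b, I, rfl⟩ := hsp.2 z
      rw [hF, Finset.mem_union]
      by_cases hne : regLabel σ Γ (ivlPos st N b I.val) = 0
      · rw [if_pos hne, hne]
        exact Or.inr (Finset.mem_image.2 ⟨_, (hC _).2 ⟨b, rfl⟩, rfl⟩)
      · rw [if_neg hne]
        refine Or.inl (Finset.mem_image.2 ⟨_, Finset.mem_erase.2 ⟨hne, ?_⟩, rfl⟩)
        rcases hmem b I.val with hm | hm
        · exact hm
        · have := ivl_le b I
          omega
  change Nat.card (ofJoin c c₀ J G).bdry.Reg + 1 = _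
  rw [hcard, Finset.card_union_of_disjoint, Finset.card_image_of_injective,
    Finset.card_image_of_injective]
  · have := Finset.card_erase_add_one h0
    omega
  · intro a b hab; simpa using hab
  · intro a b hab; simpa using hab
  · rw [Finset.disjoint_left]
    rintro ⟨a, b⟩ h1 h2
    simp at h1 h2
    omega

/-- A tangle given by a non-crossing matching is planar. The number of its connected components is
given in terms of the number of faces that contain the gaps between the boxes. -/
theorem planar (h : IsWord c c₀ J st N σ) (hfin : Finite ι)
    (hG : ∀ I I', G I I' → SameStar c c₀ I I')
    (hstar : ∀ i, (ofJoin c c₀ J G).regN (some i) 0 = (ofJoin c c₀ J G).regN none 0)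
    (Γ : Finset ℕ) (hΓ : ∀ y, y ∈ Γ ↔ ∃ g, IsGap c c₀ st N g ∧ arcLabel σ g = y)
    (comp : Option ι → ℕ) (C : Finset ℕ) (hC : ∀ k, k ∈ C ↔ ∃ b, comp b = k)
    (hcomp : ∀ b p b' q, J ⟨b, p⟩ ⟨b', q⟩ → comp b = comp b')
    (hcirc : ∀ b b', comp b = comp b' →
      (ofJoin c c₀ J G).bdry.regN b 0 = (ofJoin c c₀ J G).bdry.regN b' 0)
    (hcard : C.card + Γ.card = Nat.card ι + 2) : (ofJoin c c₀ J G).Planar := by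
  have hstar' : ∀ b b', (ofJoin c c₀ J G).regN b 0 = (ofJoin c c₀ J G).regN b' 0 := by
    have key : ∀ b, (ofJoin c c₀ J G).regN b 0 = (ofJoin c c₀ J G).regN none 0 := by
      rintro (_ | i)
      · rfl
      · exact hstar i
    intro b b'
    rw [key b, key b']
  have nc := h.nonCrossing
  obtain ⟨f, hf, hf'⟩ := h.exists_regLabel hG hΓ
  obtain ⟨R, hR0, hRcard, hmem, hex, hRcard'⟩ := h.card_reg (G := G) hG hΓ hstar'
  have hfP : Finite (Σ b, (boxCol c c₀ b).Pt) := inferInstance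
  have hfI : Finite (Σ b, (boxCol c c₀ b).Ivl) := inferInstance
  refine ⟨hfin, ?_, ?_, ?_, ?_, ?_, ?_, ?_⟩
  · exact Finite.of_surjective (Quot.mk J) Quot.mk_surjective
  · exact Finite.of_surjective (Quot.mk _) Quot.mk_surjective
  · intro b p
    have hlt := h.ptPos_lt b p.val p.isLt
    obtain ⟨b', q, hq, hq'⟩ := h.surj _ (nc.lt _ hlt)
    have hodd := nc.odd _ hlt
    refine ⟨b', ⟨q, hq⟩, ?_, (h.str_eq (G := G) (q := ⟨q, hq⟩) hq'.symm).symm⟩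
    rintro heq
    rw [← hq'] at hodd
    have h1 : ptPos st N b' q = ptPos st N b p.val :=
      congrArg (fun z : (Σ b, (boxCol c c₀ b).Pt) => ptPos st N z.1 z.2.val) heq
    omega
  · intro b p b' q hne heq
    have key : ∀ z z' : (Σ b, (boxCol c c₀ b).Pt), (Quot.mk J z = Quot.mk J z') → z ≠ z' →
        (ptPos st N z.1 z.2.val + ptPos st N z'.1 z'.2.val) % 2 = 1 := by
      intro z z' hz hzz
      -- As `σ` is an involution, the equivalence relation generated by `J` relates a point only to
      -- itself and to its partner.
      have hrel : ptPos st N z.1 z.2.val = ptPos st N z'.1 z'.2.val ∨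
          σ (ptPos st N z.1 z.2.val) = ptPos st N z'.1 z'.2.val := by
        have h1 := Quot.eqvGen_exact hz
        clear hz hzz
        induction h1 with
        | rel x y hxy => exact Or.inr (h.joined _ _ _ _ hxy)
        | refl x => exact Or.inl rfl
        | symm x y _ ih =>
          rcases ih with ih | ih
          · exact Or.inl ih.symm
          · right
            rw [← ih, nc.invol _ (h.ptPos_lt _ _ x.2.isLt)]
        | trans x y z _ _ ih ih' =>
          rcases ih with ih | ih <;> rcases ih' with ih' | ih'
          · exact Or.inl (ih.trans ih')
          · right; rw [ih, ih']
          · right; rw [ih, ih']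
          · left; rw [← ih', ← ih, nc.invol _ (h.ptPos_lt _ _ x.2.isLt)]
      rcases hrel with hrel | hrel
      · obtain ⟨b, p⟩ := z
        obtain ⟨b', q⟩ := z'
        obtain ⟨rfl, hv⟩ := h.inj _ _ _ _ p.isLt q.isLt hrel
        exact absurd (by rw [Fin.ext hv]) hzz
      · rw [← hrel]
        exact nc.odd _ (h.ptPos_lt _ _ z.2.isLt)
    have h1 := key ⟨b', q⟩ ⟨b, p⟩ heq hne
    dsimp only at h1
    rw [h.outgoing_ptPos b' q.val q.isLt, h.outgoing_ptPos b p.val p.isLt]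
    intro hcon
    rw [Bool.eq_iff_iff] at hcon
    simp only [beq_iff_eq] at hcon
    omega
  · refine ⟨fun r => f r % 2 == 0, ?_, ?_⟩
    · intro x s
      obtain ⟨b, p, rfl⟩ := (ofJoin_spanned c c₀ J G).1 x
      have hlt := h.ptPos_lt b p.val p.isLt
      beta_reduce
      rw [hf', h.regLabel_parity hΓ _ (by split <;> omega), Bool.eq_iff_iff]
      cases s <;> split <;> rename_i hx <;> rw [Bool.eq_iff_iff] at hx <;> simp at hx ⊢ <;> omega
    · intro b I
      have hle := h.ivlPos_le b I.val (ivl_le b I)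
      beta_reduce
      rw [hf, h.regLabel_parity hΓ _ hle]
      obtain ⟨n, hn⟩ := h.col b
      have hshade : (boxCol c c₀ b).shade I = (I.val % 2 == 0) := by
        have hsh : ∀ (d : Col) (I : d.Ivl), d = .nat n → d.shade I = (I.val % 2 == 0) := by
          rintro d I rfl
          rfl
        exact hsh _ I hn
      rw [hshade, Bool.eq_iff_iff]
      have hI := ivl_le b I
      rcases b with _ | i
      · have h1 := h.even_len
        have h2 := h.le_len
        simp only [ivlPos, boxCol, beq_iff_eq] at *
        omega
      · have h1 := h.even i
        simp only [ivlPos, beq_iff_eq]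
        omega
  · intro r r'
    obtain ⟨b, I, rfl⟩ := (ofJoin_spanned c c₀ J G).2 r
    obtain ⟨b', I', rfl⟩ := (ofJoin_spanned c c₀ J G).2 r'
    rw [reg_eq_regN, reg_eq_regN]
    exact (h.connected_star hstar' b I.val (ivl_le b I)).trans _ _ _
      (h.connected_star hstar' b' I'.val (ivl_le b' I')).symm
  -- With r regions, e arcs, g = `Γ.card` and c = `C.card`, the counts are r + g = e + 2 and r + c -
  -- 1 circles. The Euler formula then reduces to c + g = `Nat.card ι` + 2, which is `hcard`.
  · have h1 := h.card_bdry hG hΓ hR0 hmem hex comp hC hcomp hcirc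
    rw [h.card_arcs, hRcard']
    omega

end IsWord

end Tangle

namespace Tangle

/-! ### Invariance of planarity -/

section Invariance

variable {ι ι' : Type} {c : ι → Col} {c' : ι' → Col} {c₀ : Col}

/-- Tangles obtained by substitution are not counted separately: they inherit planarity from the
explicit tangles to which they are isomorphic. Together with `Planar.of_reindex` this supplies the
planarity that `Z_reindex` asks for. -/
theorem Planar.of_iso {T T' : Tangle c c₀} (h : T.Iso T') (hT : T.Planar) : T'.Planar := by
  obtain ⟨f, g, hf, hg, hs⟩ := h
  have hf' : ∀ b p, f.symm (T'.str b p) = T.str b p := fun b p => by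
    rw [← hf, Equiv.symm_apply_apply]
  have hfr := hT.finite_str
  have hgr := hT.finite_reg
  refine ⟨hT.finite_box, Finite.of_equiv _ f, Finite.of_equiv _ g, ?_, ?_, ?_, ?_, ?_⟩
  · intro b p
    obtain ⟨b', q, hne, heq⟩ := hT.exists_other b p
    exact ⟨b', q, hne, by rw [← hf, ← hf, heq]⟩
  · intro b p b' q hne heq
    exact hT.outgoing_ne b p b' q hne (by rw [← hf', ← hf', heq])
  · obtain ⟨sh, h1, h2⟩ := hT.shading
    refine ⟨fun r => sh (g.symm r), fun x s => ?_, fun b I => ?_⟩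
    · obtain ⟨x, rfl⟩ := f.surjective x
      beta_reduce
      rw [← hs, Equiv.symm_apply_apply, h1]
    · beta_reduce
      rw [← hg, Equiv.symm_apply_apply, h2]
  · intro r r'
    obtain ⟨r, rfl⟩ := g.surjective r
    obtain ⟨r', rfl⟩ := g.surjective r'
    induction hT.connected r r' with
    | rel x y hxy =>
      obtain ⟨z, rfl, rfl⟩ := hxy
      exact Relation.EqvGen.rel _ _ ⟨f z, hs z true, hs z false⟩
    | refl x => exact Relation.EqvGen.refl _
    | symm x y _ ih => exact ih.symm
    | trans x y z _ _ ih ih' => exact ih.trans _ _ _ ih'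
  · have h1 : Nat.card T.arcs = Nat.card T'.arcs := by
      refine Nat.card_congr (f.subtypeEquiv fun x => ?_)
      constructor
      · rintro ⟨b, p, rfl⟩; exact ⟨b, p, (hf b p).symm⟩
      · rintro ⟨b, p, hp⟩; exact ⟨b, p, f.injective (by rw [hf, hp])⟩
    have h2 : Nat.card T.BdryCircle = Nat.card T'.BdryCircle := by
      refine Nat.card_congr (Quot.congr
        (Equiv.sumCongr (Equiv.prodCongr f (Equiv.refl Bool)) (Equiv.refl _)) ?_)
      intro a₁ a₂
      constructor
      · rintro ⟨b, p, s⟩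
        have := Meet.mk (T := T') b p s
        rw [← hf] at this
        exact this
      · intro hm
        generalize h₁ : (Equiv.sumCongr (Equiv.prodCongr f (Equiv.refl Bool)) (Equiv.refl _)) a₁ = y₁
          at hm
        generalize h₂ : (Equiv.sumCongr (Equiv.prodCongr f (Equiv.refl Bool)) (Equiv.refl _)) a₂ = y₂
          at hm
        obtain ⟨b, p, s⟩ := hm
        rw [← Equiv.eq_symm_apply] at h₁ h₂
        subst h₁ h₂
        have := Meet.mk (T := T) b p s
        rw [← hf'] at this
        exact this
    rw [← h1, ← h2, ← Nat.card_congr g]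
    exact hT.euler

/-- The boundaries of the boxes of a tangle with renumbered boxes. -/
noncomputable def boxEquiv (D : Col → Type) (e : ι' ≃ ι) (c : ι → Col) (c₀ : Col) :
    (Σ b, D (boxCol (fun i => c (e i)) c₀ b)) ≃ Σ b, D (boxCol c c₀ b) :=
  Equiv.ofBijective (fun z => match z with
    | ⟨none, p⟩ => ⟨none, p⟩
    | ⟨some i, p⟩ => ⟨some (e i), p⟩) (by
    constructor
    · rintro ⟨_ | i, p⟩ ⟨_ | j, q⟩ h
      · simpa using h
      · simp at h
      · simp at h
      · simp only [Sigma.mk.injEq, Option.some.injEq] at h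
        obtain ⟨h1, h2⟩ := h
        obtain rfl := e.injective h1
        rw [eq_of_heq h2]
    · rintro ⟨_ | i, p⟩
      · exact ⟨⟨none, p⟩, rfl⟩
      · obtain ⟨i, rfl⟩ := e.surjective i
        exact ⟨⟨some i, p⟩, rfl⟩)

theorem Planar.of_reindex {e : ι' ≃ ι} {T : Tangle c c₀} (h : (T.reindex e).Planar) :
    T.Planar := by
  have hbox := h.finite_box
  let Φ := boxEquiv Col.Pt e c c₀
  let Ψ := boxEquiv Col.Ivl e c c₀
  have hstr : ∀ z, (T.reindex e).str z.1 z.2 = T.str (Φ z).1 (Φ z).2 := by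
    rintro ⟨_ | i, p⟩ <;> rfl
  have hout : ∀ z, outgoing (Φ z).1 (Φ z).2.val = outgoing z.1 z.2.val := by
    rintro ⟨_ | i, p⟩ <;> rfl
  have hother : ∀ w : (Σ b, (boxCol c c₀ b).Pt), ∃ w' : (Σ b, (boxCol c c₀ b).Pt), w' ≠ w ∧ T.str w'.1 w'.2 = T.str w.1 w.2 := by
    intro w
    obtain ⟨z, rfl⟩ := Φ.surjective w
    obtain ⟨b', q, hne, heq⟩ := h.exists_other z.1 z.2
    refine ⟨Φ ⟨b', q⟩, Φ.injective.ne hne, ?_⟩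
    rw [← hstr, ← hstr]
    exact heq
  have hne : ∀ w w' : (Σ b, (boxCol c c₀ b).Pt), w' ≠ w → T.str w'.1 w'.2 = T.str w.1 w.2 →
      outgoing w'.1 w'.2.val ≠ outgoing w.1 w.2.val := by
    intro w w' hww heq
    obtain ⟨z, rfl⟩ := Φ.surjective w
    obtain ⟨z', rfl⟩ := Φ.surjective w'
    rw [← hstr, ← hstr] at heq
    rw [hout, hout]
    exact h.outgoing_ne z.1 z.2 z'.1 z'.2 (fun hcon => hww (congrArg Φ hcon)) heq
  refine ⟨Finite.of_equiv _ e, h.finite_str, h.finite_reg, ?_, ?_, ?_, h.connected, ?_⟩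
  · intro b p
    obtain ⟨w', h1, h2⟩ := hother ⟨b, p⟩
    exact ⟨w'.1, w'.2, h1, h2⟩
  · intro b p b' q h1 h2
    exact hne ⟨b, p⟩ ⟨b', q⟩ h1 h2
  · obtain ⟨sh, h1, h2⟩ := h.shading
    refine ⟨sh, h1, ?_⟩
    rintro (_ | i) I
    · exact h2 none I
    · obtain ⟨i, rfl⟩ := e.surjective i
      exact h2 (some i) I
  · have h1 : Nat.card (T.reindex e).arcs = Nat.card T.arcs := by
      have : (T.reindex e).arcs = T.arcs := by
        ext x
        constructor
        · rintro ⟨b, p, rfl⟩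
          exact ⟨_, _, (hstr ⟨b, p⟩).symm⟩
        · rintro ⟨b, p, rfl⟩
          obtain ⟨z, hz⟩ := Φ.surjective ⟨b, p⟩
          refine ⟨z.1, z.2, (hstr z).trans ?_⟩
          rw [hz]
      rw [this]
      rfl
    have h2 : Nat.card (T.reindex e).BdryCircle = Nat.card T.BdryCircle := by
      let Θ : (T.Str × Bool) ⊕ (Σ b, (boxCol (fun i => c (e i)) c₀ b).Ivl) ≃
          (T.Str × Bool) ⊕ (Σ b, (boxCol c c₀ b).Ivl) := Equiv.sumCongr (Equiv.refl _) Ψ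
      have hsymm : ∀ y₁ y₂, T.Meet y₁ y₂ → (T.reindex e).Meet (Θ.symm y₁) (Θ.symm y₂) := by
        rintro _ _ ⟨_ | i, p, s⟩
        · exact cast (congrArg₂ (T.reindex e).Meet ((Equiv.symm_apply_eq Θ).2 rfl).symm
            ((Equiv.symm_apply_eq Θ).2 rfl).symm) (Meet.mk (T := T.reindex e) none p s)
        · obtain ⟨i, rfl⟩ := e.surjective i
          exact cast (congrArg₂ (T.reindex e).Meet ((Equiv.symm_apply_eq Θ).2 rfl).symm
            ((Equiv.symm_apply_eq Θ).2 rfl).symm) (Meet.mk (T := T.reindex e) (some i) p s)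
      refine Nat.card_congr (Quot.congr (ra := (T.reindex e).Meet) (rb := T.Meet) Θ ?_)
      intro a₁ a₂
      constructor
      · rintro ⟨_ | i, p, s⟩
        · have := Meet.mk (T := T) none p s
          exact this
        · have := Meet.mk (T := T) (some (e i)) p s
          exact this
      · intro hm
        exact cast (congrArg₂ (T.reindex e).Meet (Θ.symm_apply_apply a₁) (Θ.symm_apply_apply a₂))
          (hsymm _ _ hm)
    have h3 := h.euler
    rw [h1, h2, Nat.card_congr e] at h3
    exact h3

end Invariance

end Tangle

/-! ### Invariance of the maps under isomorphism and renumbering -/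

namespace PlanarAlgebra

open Tangle

variable {K : Type u} [Field K] (A : PlanarAlgebra.{u, v} K)

/-- The colours of corresponding boxes are only propositionally equal, hence `HEq` for the inputs.
Once the colours are identified, `pull` becomes `reindex` and the two axioms apply. -/
theorem Z_eq_of_iso_pull {ι ι' : Type} {c : ι → Col} {c' : ι' → Col} {c₀ : Col} (e : ι ≃ ι')
    (hc : ∀ i, c i = c' (e i)) (T : Tangle c c₀) (T' : Tangle c' c₀) (hT : T.Planar)
    (h : T.Iso (T'.pull e hc)) (x : ∀ i, A.space (c i)) (x' : ∀ i, A.space (c' i))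
    (hx : ∀ i, HEq (x i) (x' (e i))) : A.Z T x = A.Z T' x' := by
  obtain rfl : c = fun i => c' (e i) := funext hc
  obtain rfl : x = fun i => x' (e i) := funext fun i => eq_of_heq (hx i)
  have h1 : T.Iso (T'.reindex e) := h
  rw [A.Z_iso _ _ hT h1]
  exact A.Z_reindex e T' (Planar.of_reindex (hT.of_iso h1)) x'

end PlanarAlgebra

namespace Tangle

section OfNat

variable {ι : Type} {c : ι → Col} {c₀ : Col}

/-- A form of `IsWord.planar` in which points are natural numbers below `2 * num b`, so that for
explicit tangles most hypotheses become linear arithmetic. The components are given by numbers `comp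
b`, each with a box `rep (comp b)` on whose circle the other `*`-intervals lie. -/
theorem ofJoin_planar
    {J : (Σ b, (boxCol c c₀ b).Pt) → (Σ b, (boxCol c c₀ b).Pt) → Prop}
    {G : (Σ b, (boxCol c c₀ b).Ivl) → (Σ b, (boxCol c c₀ b).Ivl) → Prop}
    (num : Option ι → ℕ) (rel : Option ι → ℕ → Option ι → ℕ → Prop)
    (st : ι → ℕ) (N : ℕ) (σ : ℕ → ℕ) (nc : NonCrossing N σ)
    (hnum : ∀ b, boxCol c c₀ b = .nat (num b))
    (hJ : ∀ b p b' q, J ⟨b, p⟩ ⟨b', q⟩ ↔ rel b p.val b' q.val)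
    (hst : ∀ i, st i % 2 = 0 ∧ st i + 2 * num (some i) ≤ N)
    (hN : N % 2 = 0 ∧ 2 * num none ≤ N)
    (inj : ∀ b v b' v', v < 2 * num b → v' < 2 * num b' →
      ptPos st N b v = ptPos st N b' v' → b = b' ∧ v = v')
    (surj : ∀ x < N, ∃ b v, v < 2 * num b ∧ ptPos st N b v = x)
    (joined : ∀ b p b' q, p < 2 * num b → q < 2 * num b' → rel b p b' q →
      σ (ptPos st N b p) = ptPos st N b' q)
    (join : ∀ b p b' q, p < 2 * num b → q < 2 * num b' →
      σ (ptPos st N b p) = ptPos st N b' q → rel b p b' q ∨ rel b' q b p)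
    (gap : ∀ b v, 0 < v → v < 2 * num b → ∀ b',
      ivlPos st N b v ≠ ivlPos st N b' 0 ∧ ivlPos st N b v ≠ ivlPos st N b' (2 * num b'))
    (hfin : Finite ι)
    (hG : ∀ I I', G I I' → SameStar c c₀ I I')
    (hstar : ∀ i, (ofJoin c c₀ J G).regN (some i) 0 = (ofJoin c c₀ J G).regN none 0)
    (Γ : Finset ℕ) (hΓ : ∀ y, y ∈ Γ ↔ ∃ b, arcLabel σ (ivlPos st N b 0) = y ∨
      arcLabel σ (ivlPos st N b (2 * num b)) = y)
    (comp : Option ι → ℕ) (C : Finset ℕ) (hC : ∀ k, k ∈ C ↔ ∃ b, comp b = k)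
    (hcomp : ∀ b p b' q, p < 2 * num b → q < 2 * num b' → rel b p b' q → comp b = comp b')
    (rep : ℕ → Option ι)
    (hrep : ∀ b, (ofJoin c c₀ J G).bdry.regN b 0 = (ofJoin c c₀ J G).bdry.regN (rep (comp b)) 0)
    (hcard : C.card + Γ.card = Nat.card ι + 2) : (ofJoin c c₀ J G).Planar := by
  have hnum' : ∀ b, (boxCol c c₀ b).num = num b := fun b => by rw [hnum]; rfl
  have hw : IsWord c c₀ J st N σ := by
    refine ⟨nc, fun b => ⟨_, hnum b⟩, fun i => (hst i).1, hN.1, fun i => ?_, ?_, ?_, ?_, ?_, ?_, ?_⟩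
    · have h1 := hnum' (some i)
      have h2 := (hst i).2
      simp only [boxCol] at h1
      omega
    · have h1 := hnum' none
      have h2 := hN.2
      simp only [boxCol] at h1
      omega
    · intro b v b' v'
      rw [hnum', hnum']
      exact inj b v b' v'
    · intro x hx
      obtain ⟨b, v, hv, h⟩ := surj x hx
      exact ⟨b, v, by rwa [hnum'], h⟩
    · intro b p b' q h
      exact joined b p b' q (by rw [← hnum']; exact p.isLt) (by rw [← hnum']; exact q.isLt)
        ((hJ _ _ _ _).1 h)
    · intro b p b' q h
      rw [hJ, hJ]
      exact join b p b' q (by rw [← hnum']; exact p.isLt) (by rw [← hnum']; exact q.isLt) h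
    · intro b v h0 h b'
      rw [hnum'] at h ⊢
      exact gap b v h0 h b'
  refine hw.planar hfin hG hstar Γ ?_ comp C hC ?_ ?_ hcard
  · intro y
    rw [hΓ]
    constructor
    · rintro ⟨b, h | h⟩
      · exact ⟨_, ⟨b, Or.inl rfl⟩, h⟩
      · exact ⟨_, ⟨b, Or.inr rfl⟩, by rwa [hnum']⟩
    · rintro ⟨g, ⟨b, rfl | rfl⟩, h⟩
      · exact ⟨b, Or.inl h⟩
      · exact ⟨b, Or.inr (by rwa [hnum'] at h)⟩
  · intro b p b' q h
    exact hcomp b p b' q (by rw [← hnum']; exact p.isLt) (by rw [← hnum']; exact q.isLt)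
        ((hJ _ _ _ _).1 h)
  · intro b b' h
    rw [hrep b, hrep b', h]

end OfNat

/-! ### Tangles without internal boxes -/

theorem ofJoin_planar_of_isEmpty {n : ℕ} {c : Empty → Col}
    {J : (Σ b, (boxCol c (.nat n) b).Pt) → (Σ b, (boxCol c (.nat n) b).Pt) → Prop}
    (rel : ℕ → ℕ → Prop) (σ : ℕ → ℕ) (nc : NonCrossing (2 * n) σ)
    (hJ : ∀ b p b' q, J ⟨b, p⟩ ⟨b', q⟩ ↔ rel p.val q.val)
    (joined : ∀ p q, p < 2 * n → q < 2 * n → rel p q → σ (2 * n - 1 - p) + q + 1 = 2 * n)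
    (join : ∀ p q, p < 2 * n → q < 2 * n → σ (2 * n - 1 - p) + q + 1 = 2 * n → rel p q ∨ rel q p) :
    (ofJoin c (.nat n) J (fun _ _ => False)).Planar := by
  refine ofJoin_planar (fun _ => n) (fun _ p _ q => rel p q) (fun i => i.elim) (2 * n) σ nc ?_ hJ
    (fun i => i.elim) (by omega) ?_ ?_ ?_ ?_ ?_ inferInstance (fun _ _ h => h.elim)
    (fun i => i.elim) {0} ?_ (fun _ => 0) {0} ?_ (fun _ _ _ _ _ _ _ => rfl) (fun _ => none) ?_
    (by simp)
  · rintro (_ | i)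
    · rfl
    · exact i.elim
  · rintro (_ | i) v (_ | i') v' h h' heq
    · simp only [ptPos] at heq
      exact ⟨rfl, by omega⟩
    · exact i'.elim
    · exact i.elim
    · exact i.elim
  · intro x hx
    refine ⟨none, 2 * n - 1 - x, by omega, ?_⟩
    simp only [ptPos]
    omega
  · rintro (_ | i) p (_ | i') q hp hq h
    · have := joined p q hp hq h
      simp only [ptPos]
      omega
    · exact i'.elim
    · exact i.elim
    · exact i.elim
  · rintro (_ | i) p (_ | i') q hp hq h
    · simp only [ptPos] at h
      exact join p q hp hq (by omega)
    · exact i'.elim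
    · exact i.elim
    · exact i.elim
  · rintro (_ | i) v h0 h (_ | i')
    · simp only [ivlPos]
      omega
    · exact i'.elim
    · exact i.elim
    · exact i.elim
  · intro y
    rw [Finset.mem_singleton]
    constructor
    · rintro rfl
      exact ⟨none, Or.inl nc.arcLabel_last⟩
    · rintro ⟨_ | i, h | h⟩
      · exact h.symm.trans nc.arcLabel_last
      · simp only [ivlPos, Nat.sub_self, arcLabel_zero] at h
        exact h.symm
      · exact i.elim
      · exact i.elim
  · intro k
    rw [Finset.mem_singleton]
    exact ⟨fun hk => ⟨none, hk.symm⟩, fun ⟨_, hk⟩ => hk.symm⟩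
  · rintro (_ | i)
    · rfl
    · exact i.elim

theorem one_planar (n : ℕ) : (one n).Planar := by
  refine ofJoin_planar_of_isEmpty (fun p q => p + q + 1 = 2 * n) (fun x => 2 * n - 1 - x)
    ⟨?_, ?_, ?_, ?_⟩ (fun _ _ _ _ => Iff.rfl) ?_ ?_ <;> intros <;> omega

theorem jones_planar (n : ℕ) (hn : 2 ≤ n) : (jones n).Planar := by
  -- Places run through the external points backward, so that the last two top points are at the
  -- places `n + 1` and `n`, and the last two bottom points at `n - 1` and `n - 2`.
  let σ : ℕ → ℕ := fun x => if x = n then n + 1 else if x = n + 1 then n else if x + 1 = n then n - 2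
    else if x + 2 = n then n - 1 else 2 * n - 1 - x
  -- The cases are restated additively, without truncated subtraction. The definition of `σ` is then
  -- forgotten, so that `omega` sees only this specification; the other matchings are treated in the
  -- same way.
  have hσ : ∀ x < 2 * n, (x = n ∧ σ x = n + 1) ∨ (x = n + 1 ∧ σ x = n) ∨
      (x + 1 = n ∧ σ x + 2 = n) ∨ (x + 2 = n ∧ σ x + 1 = n) ∨
      ((x + 2 < n ∨ n + 1 < x) ∧ σ x + x + 1 = 2 * n) := by
    intro x
    simp only [σ]
    split_ifs <;> omega
  clear_value σ
  refine ofJoin_planar_of_isEmpty (fun p q => (p + 2 < n ∧ p + q + 1 = 2 * n) ∨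
      (p + 2 = n ∧ q + 1 = n) ∨ (p = n ∧ q = n + 1)) σ ⟨?_, ?_, ?_, ?_⟩
    (fun _ _ _ _ => Iff.rfl) ?_ ?_
  · intro x hx; have := hσ x hx; omega
  · intro x hx
    have h := hσ x hx
    have h' := hσ (σ x) (by omega)
    rcases h with h | h | h | h | h <;> omega
  · intro x hx; have := hσ x hx; omega
  · intro x y hx hxy hy
    have h := hσ x hx
    have h' := hσ y (by omega)
    rcases h with h | h | h | h | h <;> rcases h' with h' | h' | h' | h' | h' <;> omega
  · intro p q hp hq h
    have := hσ (2 * n - 1 - p) (by omega)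
    omega
  · intro p q hp hq h
    have := hσ (2 * n - 1 - p) (by omega)
    rcases this with h' | h' | h' | h' | h' <;> omega

/-! ### Insertion of nested cups -/

/-- The tangle that joins an `n`-box to the external `N`-box, with `N - n` nested cups on the
external box placed after its first `a` points. -/
def ins (n a N : ℕ) : Tangle (fun _ : Unit => .nat n) (.nat N) :=
  ofJoin _ _
    (fun p q => match p, q with
      | ⟨some _, i⟩, ⟨none, j⟩ =>
          (i.val < a ∧ j.val = i.val) ∨ (a ≤ i.val ∧ j.val + 2 * n = i.val + 2 * N)
      | ⟨none, i⟩, ⟨none, j⟩ => a ≤ i.val ∧ a ≤ j.val ∧ i.val + j.val + 1 + 2 * n = 2 * a + 2 * N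
      | _, _ => False)
    (SameStar _ _)

theorem ins_str_lt {n a N : ℕ} (i : (Col.nat n).Pt) (j : (Col.nat N).Pt) (hi : i.val < a)
    (h : j.val = i.val) : (ins n a N).str (some ()) i = (ins n a N).str none j :=
  Quot.sound (Or.inl ⟨hi, h⟩)

theorem ins_str_ge {n a N : ℕ} (i : (Col.nat n).Pt) (j : (Col.nat N).Pt) (hi : a ≤ i.val)
    (h : j.val + 2 * n = i.val + 2 * N) :
    (ins n a N).str (some ()) i = (ins n a N).str none j :=
  Quot.sound (Or.inr ⟨hi, h⟩)

theorem ins_str_cup {n a N : ℕ} (i j : (Col.nat N).Pt) (hi : a ≤ i.val) (hj : a ≤ j.val)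
    (h : i.val + j.val + 1 + 2 * n = 2 * a + 2 * N) :
    (ins n a N).str none i = (ins n a N).str none j :=
  Quot.sound ⟨hi, hj, h⟩

theorem incl_eq_ins (n N : ℕ) : incl n N = ins n n N := by
  unfold incl ins
  congr 1
  funext p q
  obtain ⟨_ | _, p⟩ := p <;> obtain ⟨_ | _, q⟩ := q <;> simp only []
  rw [eq_iff_iff]
  omega

/-- With no cups to insert, the place `a` is irrelevant: every point keeps its number. -/
theorem ident_eq_ins (n a : ℕ) : ident (.nat n) = ins n a n := by
  unfold ident ins
  congr 1
  funext p q
  obtain ⟨_ | _, p⟩ := p <;> obtain ⟨_ | _, q⟩ := q <;> simp only [] <;> rw [eq_iff_iff]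
  · constructor
    · exact False.elim
    · intro h
      omega
  · omega

theorem ins_planar (n a N : ℕ) (ha : a ≤ 2 * n) (hN : n ≤ N) : (ins n a N).Planar := by
  -- The blocks of places are: the first `a` points of the box; its other points, followed by their
  -- external partners; the cups; the external partners of the first block.
  let σ : ℕ → ℕ := fun x => if x < a then 2 * n + 2 * N - 1 - x else
    if x < 4 * n - a then 4 * n - 1 - x else
    if x < 2 * n + 2 * N - a then 6 * n + 2 * N - 2 * a - 1 - x else 2 * n + 2 * N - 1 - x
  have hσ : ∀ x < 2 * n + 2 * N, (x < a ∧ σ x + x + 1 = 2 * n + 2 * N) ∨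
      (a ≤ x ∧ x + a < 4 * n ∧ σ x + x + 1 = 4 * n) ∨
      (4 * n ≤ x + a ∧ x + a < 2 * n + 2 * N ∧ σ x + x + 1 + 2 * a = 6 * n + 2 * N) ∨
      (2 * n + 2 * N ≤ x + a ∧ σ x + x + 1 = 2 * n + 2 * N) := by
    intro x
    simp only [σ]
    split_ifs <;> omega
  clear_value σ
  have nc : NonCrossing (2 * n + 2 * N) σ := by
    refine ⟨?_, ?_, ?_, ?_⟩
    · intro x hx; have := hσ x hx; omega
    · intro x hx; have := hσ x hx; have := hσ (σ x) (by omega); omega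
    · intro x hx; have := hσ x hx; omega
    · intro x y hx hxy hy; have := hσ x hx; have := hσ y (by omega); omega
  have hlab : arcLabel σ (2 * n) = 2 * n := by
    rcases Nat.eq_zero_or_pos n with rfl | hn
    · exact arcLabel_zero σ
    · obtain ⟨i, hi⟩ : ∃ i, 2 * n = i + 1 := ⟨2 * n - 1, by omega⟩
      rw [hi]
      apply NonCrossing.arcLabel_open
      have := hσ i (by omega)
      omega
  refine ofJoin_planar (fun b => match b with | none => N | some _ => n)
    (fun b i b' j => match b, b' with
      | some _, none => (i < a ∧ j = i) ∨ (a ≤ i ∧ j + 2 * n = i + 2 * N)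
      | none, none => a ≤ i ∧ a ≤ j ∧ i + j + 1 + 2 * n = 2 * a + 2 * N
      | _, _ => False) (fun _ => 0) (2 * n + 2 * N) σ nc ?_ ?_ ?_ ?_ ?_ ?_ ?_ ?_ ?_ inferInstance
    (fun _ _ h => h) (fun i => ofJoin_sameStar_regN _ _) {0, 2 * n} ?_
    -- A box without points is a component by itself. The gap after it is then in the unbounded
    -- face, so the additional component is offset by a missing label.
    (fun b => match b with | none => 0 | some _ => if n = 0 then 1 else 0)
    (if n = 0 then {0, 1} else {0}) ?_ ?_
    (fun k => if k = 0 then none else some ()) ?_ ?_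
  · rintro (_ | _) <;> rfl
  · rintro (_ | _) p (_ | _) q <;> exact Iff.rfl
  · intro i; dsimp only; omega
  · dsimp only; omega
  · rintro (_ | _) v (_ | _) v' h h' heq <;> dsimp only [ptPos] at *
    · exact ⟨rfl, by omega⟩
    · omega
    · omega
    · exact ⟨rfl, by omega⟩
  · intro x hx
    rcases Nat.lt_or_ge x (2 * n) with h | h
    · refine ⟨some (), x, ?_, ?_⟩ <;> dsimp only [ptPos] <;> omega
    · refine ⟨none, 2 * n + 2 * N - 1 - x, ?_, ?_⟩ <;> dsimp only [ptPos] <;> omega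
  · rintro (_ | _) p (_ | _) q hp hq h <;> dsimp only [ptPos] at *
    · have := hσ (2 * n + 2 * N - 1 - p) (by omega)
      omega
    · have := hσ (0 + p) (by omega)
      omega
  · rintro (_ | _) p (_ | _) q hp hq h <;> dsimp only [ptPos] at *
    · have := hσ (2 * n + 2 * N - 1 - p) (by omega)
      omega
    · have := hσ (2 * n + 2 * N - 1 - p) (by omega)
      omega
    · have := hσ (0 + p) (by omega)
      omega
    · have := hσ (0 + p) (by omega)
      omega
  · rintro (_ | _) v h0 h (_ | _) <;> dsimp only [ivlPos] at * <;> omega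
  · intro y
    rw [Finset.mem_insert, Finset.mem_singleton]
    constructor
    · rintro (rfl | rfl)
      · exact ⟨none, Or.inl nc.arcLabel_last⟩
      · refine ⟨some (), Or.inr ?_⟩
        dsimp only [ivlPos]
        rw [Nat.zero_add, hlab]
    · rintro ⟨_ | _, h | h⟩ <;> dsimp only [ivlPos] at h
      · exact Or.inl (h.symm.trans nc.arcLabel_last)
      · rw [Nat.add_sub_cancel, hlab] at h; exact Or.inr h.symm
      · exact Or.inl (h.symm.trans (arcLabel_zero σ))
      · rw [Nat.zero_add, hlab] at h; exact Or.inr h.symm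
  · intro k
    by_cases h0 : n = 0
    · rw [if_pos h0, Finset.mem_insert, Finset.mem_singleton]
      constructor
      · rintro (rfl | rfl)
        · exact ⟨none, rfl⟩
        · exact ⟨some (), if_pos h0⟩
      · rintro ⟨_ | _, rfl⟩
        · exact Or.inl rfl
        · exact Or.inr (if_pos h0)
    · rw [if_neg h0, Finset.mem_singleton]
      constructor
      · rintro rfl
        exact ⟨none, rfl⟩
      · rintro ⟨_ | _, rfl⟩
        · rfl
        · exact if_neg h0
  · rintro (_ | _) p (_ | _) q hp hq h <;> dsimp only at *
    rw [if_neg (by omega)]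
  · rintro (_ | _)
    · rfl
    · dsimp only
      by_cases h0 : n = 0
      · rw [if_pos h0, if_neg (by omega)]
      · rw [if_neg h0, if_pos rfl]
        change (ins n a N).bdry.regN (some ()) 0 = (ins n a N).bdry.regN none 0
        rcases Nat.eq_zero_or_pos a with rfl | ha0
        · have h2 := (regN_of_str_eq_even (ins n 0 N).bdry (ins_str_ge
            ⟨2 * n - 1, show 2 * n - 1 < 2 * n by omega⟩
            ⟨2 * N - 1, show 2 * N - 1 < 2 * N by omega⟩ (Nat.zero_le _)
            (by dsimp only; omega)) (by dsimp only; omega)).2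
          dsimp only at h2
          rw [show 2 * n - 1 + 1 = 2 * n by omega, show 2 * N - 1 + 1 = 2 * N by omega] at h2
          exact ((regN_end _ (some ())).symm.trans h2).trans (regN_end _ none)
        · exact (regN_of_str_eq_even (ins n a N).bdry (ins_str_lt ⟨0, show 0 < 2 * n by omega⟩
            ⟨0, show 0 < 2 * N by omega⟩ ha0 rfl) rfl).1
  · rcases Nat.eq_zero_or_pos n with rfl | hn
    · simp
    · rw [if_neg (by omega), Finset.card_singleton, Finset.card_pair (by omega)]
      simp

end Tangle

/-! ### Planarity of the multiplication tangles -/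

namespace Tangle

theorem mult_str_left {m n p : ℕ} (i : (Col.nat m).Pt) (j : (Col.nat p).Pt) (h : i.val = j.val)
    (hi : i.val + n < m + p) : (mult m n p).str (some false) i = (mult m n p).str none j :=
  Quot.sound ⟨h, hi⟩

theorem mult_str_mid {m n p : ℕ} (i : (Col.nat m).Pt) (j : (Col.nat n).Pt)
    (h : i.val + j.val + 1 = 2 * m) (hj : j.val + p < m + n) :
    (mult m n p).str (some false) i = (mult m n p).str (some true) j :=
  Quot.sound ⟨h, hj⟩

theorem mult_str_right {m n p : ℕ} (i : (Col.nat n).Pt) (j : (Col.nat p).Pt)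
    (hi : m + n ≤ i.val + p) (h : j.val + 2 * n = i.val + 2 * p) :
    (mult m n p).str (some true) i = (mult m n p).str none j :=
  Quot.sound ⟨hi, h⟩

set_option maxHeartbeats 2000000 in
theorem mult_planar (m n p : ℕ) (h₁ : p ≤ m + n) (h₂ : n ≤ m + p) (h₃ : m ≤ n + p) :
    (mult m n p).Planar := by
  obtain ⟨s, hs⟩ : ∃ s, m + n = p + s := ⟨m + n - p, by omega⟩
  -- Here `s` is the number of strings from D₁ to D₂. The blocks are: points of D₁ joined to the
  -- outside; the strings from D₁ to D₂; the strings from D₂ to the outside; the outer ends of the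
  -- first block.
  let σ : ℕ → ℕ := fun x =>
    if x < 2 * m - s then 2 * m + 2 * n + 2 * p - 1 - x else
    if x < 2 * m + s then 4 * m - 1 - x else
    if x < 2 * m + 4 * n - s then 4 * m + 4 * n - 1 - x else 2 * m + 2 * n + 2 * p - 1 - x
  have hσ : ∀ x < 2 * m + 2 * n + 2 * p,
      (x + s < 2 * m ∧ σ x + x + 1 = 2 * m + 2 * n + 2 * p) ∨
      (2 * m ≤ x + s ∧ x < 2 * m + s ∧ σ x + x + 1 = 4 * m) ∨
      (2 * m + s ≤ x ∧ x + s < 2 * m + 4 * n ∧ σ x + x + 1 = 4 * m + 4 * n) ∨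
      (2 * m + 4 * n ≤ x + s ∧ σ x + x + 1 = 2 * m + 2 * n + 2 * p) := by
    intro x
    simp only [σ]
    split_ifs <;> omega
  clear_value σ
  have nc : NonCrossing (2 * m + 2 * n + 2 * p) σ := by
    refine ⟨?_, ?_, ?_, ?_⟩
    · intro x hx; have := hσ x hx; omega
    · intro x hx
      have h := hσ x hx
      have h' := hσ (σ x) (by omega)
      rcases h with h | h | h | h <;> omega
    · intro x hx; have := hσ x hx; omega
    · intro x y hx hxy hy
      have h := hσ x hx
      have h' := hσ y (by omega)
      rcases h with h | h | h | h <;> rcases h' with h' | h' | h' | h' <;> omega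
  have hlab₁ : arcLabel σ (2 * m) = 2 * m := by
    rcases Nat.eq_zero_or_pos m with rfl | hm
    · exact arcLabel_zero σ
    · obtain ⟨i, hi⟩ : ∃ i, 2 * m = i + 1 := ⟨2 * m - 1, by omega⟩
      rw [hi]
      apply NonCrossing.arcLabel_open
      have := hσ i (by omega)
      omega
  -- If `s = 2 * n`, then all strings of D₂ go up to D₁, and the gap after D₂ is in the face before
  -- the first of these strings.
  have hlab₂ : arcLabel σ (2 * m + 2 * n) = if s < 2 * n then 2 * m + 2 * n else 2 * m - s := by
    split
    · obtain ⟨i, hi⟩ : ∃ i, 2 * m + 2 * n = i + 1 := ⟨2 * m + 2 * n - 1, by omega⟩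
      rw [hi]
      apply NonCrossing.arcLabel_open
      have := hσ i (by omega)
      omega
    · rcases Nat.eq_zero_or_pos n with rfl | hn
      · rw [show 2 * m + 2 * 0 = 2 * m by omega, hlab₁]; omega
      · have h := hσ (2 * m + 2 * n - 1) (by omega)
        have h1 : σ (2 * m + 2 * n - 1) = 2 * m - s := by omega
        rw [show 2 * m + 2 * n = 2 * m + 2 * n - 1 + 1 by omega, NonCrossing.arcLabel_close _ (by omega),
          h1]
        rcases Nat.eq_zero_or_pos (2 * m - s) with h0 | h0
        · rw [h0, arcLabel_zero]
        · obtain ⟨i, hi⟩ : ∃ i, 2 * m - s = i + 1 := ⟨2 * m - s - 1, by omega⟩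
          rw [hi]
          apply NonCrossing.arcLabel_open
          have := hσ i (by omega)
          omega
  -- Names for the components: `0` for that of the external box, and, for boxes not connected to it,
  -- `1` for the component of D₁ and `2` for D₂ alone.
  have hiff : ∃ κ₁ κ₂ : ℕ, (s < 2 * m → κ₁ = 0) ∧ (s < 2 * n → κ₂ = 0) ∧
      (0 < s → κ₁ = κ₂) ∧ (s = 0 → m = 0 → κ₁ = 1) ∧ (s = 0 → n = 0 → κ₂ = 2) ∧
      (2 * m = s → 2 * n = s → 0 < s → κ₁ = 1) ∧ (κ₁ = 0 ∨ κ₁ = 1) ∧ (κ₂ = 0 ∨ κ₂ = 1 ∨ κ₂ = 2) := by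
    by_cases hm : s < 2 * m <;> by_cases hn : s < 2 * n <;> by_cases h0 : s = 0
    · exact ⟨0, 0, by omega⟩
    · exact ⟨0, 0, by omega⟩
    · exact ⟨0, 2, by omega⟩
    · exact ⟨0, 0, by omega⟩
    · exact ⟨1, 0, by omega⟩
    · exact ⟨0, 0, by omega⟩
    · exact ⟨1, 2, by omega⟩
    · exact ⟨1, 1, by omega⟩
  obtain ⟨κ₁, κ₂, hκ⟩ := hiff
  have f₁ : s < 2 * m → (mult m n p).bdry.regN (some false) 0 = (mult m n p).bdry.regN none 0 := by
    intro h
    exact (regN_of_str_eq_even (mult m n p).bdry (mult_str_left ⟨0, show 0 < 2 * m by omega⟩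
      ⟨0, show 0 < 2 * p by omega⟩ rfl (by dsimp only; omega)) rfl).1
  have f₂ : s < 2 * n → (mult m n p).bdry.regN (some true) 0 = (mult m n p).bdry.regN none 0 := by
    intro h
    have h2 := (regN_of_str_eq_even (mult m n p).bdry (mult_str_right
      ⟨2 * n - 1, show 2 * n - 1 < 2 * n by omega⟩ ⟨2 * p - 1, show 2 * p - 1 < 2 * p by omega⟩
      (by dsimp only; omega) (by dsimp only; omega)) (by dsimp only; omega)).2
    dsimp only at h2
    rw [show 2 * n - 1 + 1 = 2 * n by omega, show 2 * p - 1 + 1 = 2 * p by omega] at h2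
    exact ((regN_end _ (some true)).symm.trans h2).trans (regN_end _ none)
  have f₃ : 0 < s → (mult m n p).bdry.regN (some false) 0 =
      (mult m n p).bdry.regN (some true) 0 := by
    intro h
    have h2 := regN_of_str_eq_odd (mult m n p).bdry (mult_str_mid
      ⟨2 * m - 1, show 2 * m - 1 < 2 * m by omega⟩ ⟨0, show 0 < 2 * n by omega⟩
      (by dsimp only; omega) (by dsimp only; omega)).symm (by dsimp only; omega)
    dsimp only at h2
    rw [show 2 * m - 1 + 1 = 2 * m by omega] at h2
    exact (regN_end _ (some false)).symm.trans h2.symm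
  refine ofJoin_planar (fun b => match b with | none => p | some false => m | some true => n)
    (fun b i b' j => match b, b' with
      | some false, none => i = j ∧ i + n < m + p
      | some false, some true => i + j + 1 = 2 * m ∧ j + p < m + n
      | some true, none => m + n ≤ i + p ∧ j + 2 * n = i + 2 * p
      | _, _ => False) (fun b => match b with | false => 0 | true => 2 * m)
    (2 * m + 2 * n + 2 * p) σ nc ?_ ?_ ?_ ?_ ?_ ?_ ?_ ?_ ?_ inferInstance
    (fun _ _ h => h) (fun i => ofJoin_sameStar_regN _ _)
    {0, 2 * m, if s < 2 * n then 2 * m + 2 * n else 2 * m - s} ?_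
    (fun b => match b with | none => 0 | some false => κ₁ | some true => κ₂) {0, κ₁, κ₂} ?_ ?_
    (fun k => if k = 0 then none else if k = 1 then some false else some true) ?_ ?_
  · rintro (_ | _ | _) <;> rfl
  · rintro (_ | _ | _) p (_ | _ | _) q <;> exact Iff.rfl
  · rintro (_ | _) <;> dsimp only <;> omega
  · dsimp only; omega
  · rintro (_ | _ | _) v (_ | _ | _) v' h h' heq <;> dsimp only [ptPos] at * <;>
      first | omega | exact ⟨rfl, by omega⟩
  · intro x hx
    rcases Nat.lt_or_ge x (2 * m) with h | h
    · refine ⟨some false, x, ?_, ?_⟩ <;> dsimp only [ptPos] <;> omega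
    rcases Nat.lt_or_ge x (2 * m + 2 * n) with h' | h'
    · refine ⟨some true, x - 2 * m, ?_, ?_⟩ <;> dsimp only [ptPos] <;> omega
    · refine ⟨none, 2 * m + 2 * n + 2 * p - 1 - x, ?_, ?_⟩ <;> dsimp only [ptPos] <;> omega
  · rintro (_ | _ | _) x (_ | _ | _) y hx hy h <;> dsimp only [ptPos] at * <;> first
      | (have := hσ (0 + x) (by omega); omega)
      | (have := hσ (2 * m + x) (by omega); omega)
  · rintro (_ | _ | _) x (_ | _ | _) y hx hy h <;> dsimp only [ptPos] at * <;> first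
      | (have := hσ (2 * m + 2 * n + 2 * p - 1 - x) (by omega); omega)
      | (have := hσ (0 + x) (by omega); omega)
      | (have := hσ (2 * m + x) (by omega); omega)
  · rintro (_ | _ | _) v h0 h (_ | _ | _) <;> dsimp only [ivlPos] at * <;> omega
  · have e1 := nc.arcLabel_last
    intro y
    simp only [Finset.mem_insert, Finset.mem_singleton]
    constructor
    · rintro (rfl | rfl | rfl)
      · exact ⟨none, Or.inl e1⟩
      · refine ⟨some false, Or.inr ?_⟩
        dsimp only [ivlPos]
        rw [Nat.zero_add, hlab₁]
      · refine ⟨some true, Or.inr ?_⟩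
        dsimp only [ivlPos]
        exact hlab₂
    · rintro ⟨_ | _ | _, h | h⟩ <;> dsimp only [ivlPos] at h
      · exact Or.inl (h.symm.trans e1)
      · rw [Nat.add_sub_cancel, hlab₂] at h; exact Or.inr (Or.inr h.symm)
      · exact Or.inl (h.symm.trans (arcLabel_zero σ))
      · rw [Nat.zero_add, hlab₁] at h; exact Or.inr (Or.inl h.symm)
      · rw [Nat.add_zero, hlab₁] at h; exact Or.inr (Or.inl h.symm)
      · rw [hlab₂] at h; exact Or.inr (Or.inr h.symm)
  · intro k
    simp only [Finset.mem_insert, Finset.mem_singleton]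
    constructor
    · rintro (rfl | rfl | rfl)
      · exact ⟨none, rfl⟩
      · exact ⟨some false, rfl⟩
      · exact ⟨some true, rfl⟩
    · rintro ⟨_ | _ | _, rfl⟩
      · exact Or.inl rfl
      · exact Or.inr (Or.inl rfl)
      · exact Or.inr (Or.inr rfl)
  · rintro (_ | _ | _) x (_ | _ | _) y hx hy h <;> dsimp only at * <;> omega
  · rintro (_ | _ | _)
    · rfl
    · change (mult m n p).bdry.regN (some false) 0 = (mult m n p).bdry.regN _ 0
      dsimp only
      split_ifs with h0 h1
      · by_cases hm : s < 2 * m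
        · exact f₁ hm
        · exact (f₃ (by omega)).trans (f₂ (by omega))
      · rfl
      · omega
    · change (mult m n p).bdry.regN (some true) 0 = (mult m n p).bdry.regN _ 0
      dsimp only
      split_ifs with h0 h1
      · by_cases hn : s < 2 * n
        · exact f₂ hn
        · exact (f₃ (by omega)).symm.trans (f₁ (by omega))
      · exact (f₃ (by omega)).symm
      · rfl
  · simp only [Finset.card_insert_eq_ite, Finset.mem_insert, Finset.mem_singleton,
      Finset.card_singleton, Nat.card_eq_fintype_card, Fintype.card_bool]
    split_ifs <;> omega

end Tangle

/-! ### Three boxes on top of each other -/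

namespace Tangle

/-- The colours of three internal boxes. -/
def tripleCol (m n l : ℕ) : Bool ⊕ Unit → Col
  | .inl false => .nat m
  | .inl true => .nat n
  | .inr _ => .nat l

/-- The strings of the tangle with three internal boxes on top of each other, `s` strings from the
first to the second box and `t` strings from the second to the third. -/
def tripleRel (m n l p s t : ℕ) : Option (Bool ⊕ Unit) → ℕ → Option (Bool ⊕ Unit) → ℕ → Prop
  | some (.inl false), i, none, j => i = j ∧ i + s < 2 * m
  | some (.inl false), i, some (.inl true), j => i + j + 1 = 2 * m ∧ j < s
  | some (.inl true), i, none, j => s ≤ i ∧ i + t < 2 * n ∧ j + 2 * s = i + 2 * m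
  | some (.inl true), i, some (.inr _), j => i + j + 1 = 2 * n ∧ j < t
  | some (.inr _), i, none, j => t ≤ i ∧ j + 2 * l = i + 2 * p
  | _, _, _, _ => False

/-- Three boxes on top of each other, with `s` strings from the first to the second box and `t`
strings from the second to the third. -/
def triple (m n l p s t : ℕ) : Tangle (tripleCol m n l) (.nat p) :=
  ofJoin _ _ (fun x y => tripleRel m n l p s t x.1 x.2.val y.1 y.2.val) (SameStar _ _)

section

variable {m n l p s t : ℕ}

theorem triple_str {b b' : Option (Bool ⊕ Unit)} (i : (boxCol (tripleCol m n l) (.nat p) b).Pt)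
    (j : (boxCol (tripleCol m n l) (.nat p) b').Pt)
    (h : tripleRel m n l p s t b i.val b' j.val) :
    (triple m n l p s t).str b i = (triple m n l p s t).str b' j :=
  Quot.sound h

theorem triple_regN_even {b b' : Option (Bool ⊕ Unit)} (i j : ℕ)
    (hi : i < 2 * (boxCol (tripleCol m n l) (.nat p) b).num)
    (hj : j < 2 * (boxCol (tripleCol m n l) (.nat p) b').num)
    (h : tripleRel m n l p s t b i b' j) (hij : (i + j) % 2 = 0) :
    (triple m n l p s t).bdry.regN b i = (triple m n l p s t).bdry.regN b' j ∧
    (triple m n l p s t).bdry.regN b (i + 1) = (triple m n l p s t).bdry.regN b' (j + 1) :=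
  regN_of_str_eq_even (triple m n l p s t).bdry (triple_str ⟨i, hi⟩ ⟨j, hj⟩ h) hij

theorem triple_regN_odd {b b' : Option (Bool ⊕ Unit)} (i j : ℕ)
    (hi : i < 2 * (boxCol (tripleCol m n l) (.nat p) b).num)
    (hj : j < 2 * (boxCol (tripleCol m n l) (.nat p) b').num)
    (h : tripleRel m n l p s t b i b' j) (hij : (i + j) % 2 = 1) :
    (triple m n l p s t).bdry.regN b i = (triple m n l p s t).bdry.regN b' (j + 1) ∧
    (triple m n l p s t).bdry.regN b (i + 1) = (triple m n l p s t).bdry.regN b' j :=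
  ⟨regN_of_str_eq_odd (triple m n l p s t).bdry (triple_str ⟨i, hi⟩ ⟨j, hj⟩ h) hij,
    (regN_of_str_eq_odd (triple m n l p s t).bdry (triple_str ⟨i, hi⟩ ⟨j, hj⟩ h).symm
      (by rw [Nat.add_comm]; exact hij)).symm⟩

/-- Two `*`-intervals are on the same boundary circle if an extreme string of one box leads to the
other. The middle box needs more: the first box lies between it and the external `*`-interval, so
the path goes by way of the `*`-interval of the first box, unless that box has no points. -/
theorem triple_star (hp : m + n + l = p + s + t) (hs : s ≤ 2 * m) (hst : s + t ≤ 2 * n)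
    (ht : t ≤ 2 * l) :
    (s < 2 * m → (triple m n l p s t).bdry.regN (some (.inl false)) 0 =
      (triple m n l p s t).bdry.regN none 0) ∧
    (s + t < 2 * n → (triple m n l p s t).bdry.regN (some (.inl true)) 0 =
      (triple m n l p s t).bdry.regN none 0) ∧
    (t < 2 * l → (triple m n l p s t).bdry.regN (some (.inr ())) 0 =
      (triple m n l p s t).bdry.regN none 0) ∧
    (0 < s → (triple m n l p s t).bdry.regN (some (.inl false)) 0 =
      (triple m n l p s t).bdry.regN (some (.inl true)) 0) ∧
    (0 < t → (triple m n l p s t).bdry.regN (some (.inl true)) 0 =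
      (triple m n l p s t).bdry.regN (some (.inr ())) 0) := by
  have e₁ : (triple m n l p s t).bdry.regN (some (.inl false)) (2 * m) = _ :=
    regN_end (triple m n l p s t).bdry (some (.inl false))
  have e₂ : (triple m n l p s t).bdry.regN (some (.inl true)) (2 * n) = _ :=
    regN_end (triple m n l p s t).bdry (some (.inl true))
  have e₃ : (triple m n l p s t).bdry.regN (some (.inr ())) (2 * l) = _ :=
    regN_end (triple m n l p s t).bdry (some (.inr ()))
  have e₀ : (triple m n l p s t).bdry.regN none (2 * p) = _ := regN_end (triple m n l p s t).bdry none
  have hA : s < 2 * m → (triple m n l p s t).bdry.regN (some (.inl false)) 0 =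
      (triple m n l p s t).bdry.regN none 0 := fun h =>
    (triple_regN_even (b := some (.inl false)) (b' := none) 0 0 (show 0 < 2 * m by omega)
      (show 0 < 2 * p by omega) ⟨rfl, by omega⟩ rfl).1
  have hS : 0 < s → (triple m n l p s t).bdry.regN (some (.inl false)) 0 =
      (triple m n l p s t).bdry.regN (some (.inl true)) 0 := by
    intro h
    have h1 := (triple_regN_odd (p := p) (l := l) (t := t) (b := some (.inl false))
      (b' := some (.inl true)) (2 * m - 1) 0
      (show 2 * m - 1 < 2 * m by omega) (show 0 < 2 * n by omega) ⟨by omega, h⟩ (by omega)).2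
    rw [show 2 * m - 1 + 1 = 2 * m by omega] at h1
    exact e₁.symm.trans h1
  have hT : 0 < t → (triple m n l p s t).bdry.regN (some (.inl true)) 0 =
      (triple m n l p s t).bdry.regN (some (.inr ())) 0 := by
    intro h
    have h1 := (triple_regN_odd (p := p) (m := m) (s := s) (b := some (.inl true))
      (b' := some (.inr ())) (2 * n - 1) 0
      (show 2 * n - 1 < 2 * n by omega) (show 0 < 2 * l by omega) ⟨by omega, h⟩ (by omega)).2
    rw [show 2 * n - 1 + 1 = 2 * n by omega] at h1
    exact e₂.symm.trans h1
  refine ⟨hA, ?_, ?_, hS, hT⟩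
  · intro h
    have h1 := (triple_regN_even (m := m) (n := n) (l := l) (p := p) (s := s) (t := t)
      (b := some (.inl true)) (b' := none) s (2 * m - s) (show s < 2 * n by omega)
      (show 2 * m - s < 2 * p by omega) ⟨by omega, by omega, by omega⟩ (by omega)).1
    rcases Nat.eq_zero_or_pos s with rfl | h0
    · rcases Nat.eq_zero_or_pos m with rfl | hm
      · exact h1
      · have h2 := (triple_regN_even (m := m) (n := n) (l := l) (p := p) (s := 0) (t := t)
          (b := some (.inl false)) (b' := none) (2 * m - 1) (2 * m - 1)
          (show 2 * m - 1 < 2 * m by omega)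
          (show 2 * m - 1 < 2 * p by omega) ⟨by omega, by omega⟩ (by omega)).2
        rw [show 2 * m - 1 + 1 = 2 * m by omega] at h2
        exact h1.trans (h2.symm.trans (e₁.trans (hA (by omega))))
    · rcases Nat.lt_or_ge s (2 * m) with hm | hm
      · exact (hS h0).symm.trans (hA hm)
      · have h2 := (triple_regN_odd (m := m) (n := n) (l := l) (p := p) (s := s) (t := t)
          (b := some (.inl false)) (b' := some (.inl true)) (2 * m - s) (s - 1)
          (show 2 * m - s < 2 * m by omega)
          (show s - 1 < 2 * n by omega) ⟨by omega, by omega⟩ (by omega)).1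
        rw [show s - 1 + 1 = s by omega, h1, show 2 * m - s = 0 by omega] at h2
        exact (hS h0).symm.trans h2
  · intro h
    have h1 := (triple_regN_even (m := m) (n := n) (l := l) (p := p) (s := s) (t := t)
      (b := some (.inr ())) (b' := none) (2 * l - 1) (2 * p - 1) (show 2 * l - 1 < 2 * l by omega)
      (show 2 * p - 1 < 2 * p by omega) ⟨by omega, by omega⟩ (by omega)).2
    rw [show 2 * l - 1 + 1 = 2 * l by omega, show 2 * p - 1 + 1 = 2 * p by omega] at h1
    exact e₃.symm.trans (h1.trans e₀)

end

/-- The matching of the points of `triple m n l p s t` along a line. -/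
def tripleMatch (m n l p s t x : ℕ) : ℕ :=
  if x + s < 2 * m then 2 * m + 2 * n + 2 * l + 2 * p - 1 - x else
  if x < 2 * m + s then 4 * m - 1 - x else
  if x + t < 2 * m + 2 * n then 2 * m + 2 * n + 2 * l + 2 * p + 2 * s - 1 - x else
  if x < 2 * m + 2 * n + t then 4 * m + 4 * n - 1 - x else
  if x + t < 2 * m + 2 * n + 4 * l then 4 * m + 4 * n + 4 * l - 1 - x else
  if x + s + 2 * t < 2 * m + 4 * n + 4 * l then 2 * m + 2 * n + 2 * l + 2 * p + 2 * s - 1 - x else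
  2 * m + 2 * n + 2 * l + 2 * p - 1 - x

section

variable {m n l p s t : ℕ}

theorem tripleMatch_spec (hp : m + n + l = p + s + t) (hs : s ≤ 2 * m) (hst : s + t ≤ 2 * n)
    (ht : t ≤ 2 * l) (x : ℕ) (hx : x < 2 * m + 2 * n + 2 * l + 2 * p) :
    (x + s < 2 * m ∧ tripleMatch m n l p s t x + x + 1 = 2 * m + 2 * n + 2 * l + 2 * p) ∨
    (2 * m ≤ x + s ∧ x < 2 * m + s ∧ tripleMatch m n l p s t x + x + 1 = 4 * m) ∨
    (2 * m + s ≤ x ∧ x + t < 2 * m + 2 * n ∧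
      tripleMatch m n l p s t x + x + 1 = 2 * m + 2 * n + 2 * l + 2 * p + 2 * s) ∨
    (2 * m + 2 * n ≤ x + t ∧ x < 2 * m + 2 * n + t ∧
      tripleMatch m n l p s t x + x + 1 = 4 * m + 4 * n) ∨
    (2 * m + 2 * n + t ≤ x ∧ x + t < 2 * m + 2 * n + 4 * l ∧
      tripleMatch m n l p s t x + x + 1 = 4 * m + 4 * n + 4 * l) ∨
    (2 * m + 2 * n + 4 * l ≤ x + t ∧ x + s + 2 * t < 2 * m + 4 * n + 4 * l ∧
      tripleMatch m n l p s t x + x + 1 = 2 * m + 2 * n + 2 * l + 2 * p + 2 * s) ∨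
    (2 * m + 4 * n + 4 * l ≤ x + s + 2 * t ∧
      tripleMatch m n l p s t x + x + 1 = 2 * m + 2 * n + 2 * l + 2 * p) := by
  unfold tripleMatch
  split_ifs <;> omega

theorem tripleMatch_nonCrossing (hp : m + n + l = p + s + t) (hs : s ≤ 2 * m)
    (hst : s + t ≤ 2 * n) (ht : t ≤ 2 * l) :
    NonCrossing (2 * m + 2 * n + 2 * l + 2 * p) (tripleMatch m n l p s t) := by
  have hσ := tripleMatch_spec hp hs hst ht
  generalize tripleMatch m n l p s t = σ at hσ ⊢
  refine ⟨?_, ?_, ?_, ?_⟩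
  · intro x hx; have := hσ x hx; omega
  · intro x hx
    have h := hσ x hx
    have h' := hσ (σ x) (by omega)
    rcases h with h | h | h | h | h | h | h <;> omega
  · intro x hx; have := hσ x hx; omega
  · intro x y hx hxy hy
    have h := hσ x hx
    have h' := hσ y (by omega)
    rcases h with h | h | h | h | h | h | h <;>
      rcases h' with h' | h' | h' | h' | h' | h' | h' <;> omega

/-- If the last point of a box opens an arc, the gap after the box is in the face below this arc.
Otherwise all strings of the box go to earlier boxes, and the label is found by following the last
string back, repeatedly if necessary. -/
theorem arcLabel_tripleMatch (hp : m + n + l = p + s + t) (hs : s ≤ 2 * m)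
    (hst : s + t ≤ 2 * n) (ht : t ≤ 2 * l) :
    arcLabel (tripleMatch m n l p s t) (2 * m) = 2 * m ∧
    arcLabel (tripleMatch m n l p s t) (2 * m + 2 * n) =
      (if s < 2 * n then 2 * m + 2 * n else 2 * m - s) ∧
    arcLabel (tripleMatch m n l p s t) (2 * m + 2 * n + 2 * l) =
      (if t < 2 * l then 2 * m + 2 * n + 2 * l else
        if s + t < 2 * n then 2 * m + 2 * n - t else 2 * m - s) := by
  have hσ := tripleMatch_spec hp hs hst ht
  generalize tripleMatch m n l p s t = σ at hσ ⊢
  have opn : ∀ x, x ≤ 2 * m + 2 * n + 2 * l + 2 * p → (0 < x → x - 1 < σ (x - 1)) →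
      arcLabel σ x = x := by
    intro x hx h
    rcases x with _ | x
    · exact arcLabel_zero σ
    · exact NonCrossing.arcLabel_open x (h (by omega))
  have cls : ∀ x y, x ≤ 2 * m + 2 * n + 2 * l + 2 * p → 0 < x → σ (x - 1) = y → y < x - 1 →
      arcLabel σ x = arcLabel σ y := by
    intro x y hx h h' h''
    rcases x with _ | x
    · omega
    · subst h'
      exact NonCrossing.arcLabel_close x h''
  have l₁ : arcLabel σ (2 * m) = 2 * m := by
    refine opn _ (by omega) fun h => ?_
    have := hσ (2 * m - 1) (by omega)
    omega
  have lA : arcLabel σ (2 * m - s) = 2 * m - s := by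
    refine opn _ (by omega) fun h => ?_
    have := hσ (2 * m - s - 1) (by omega)
    omega
  have l₂ : arcLabel σ (2 * m + 2 * n) = if s < 2 * n then 2 * m + 2 * n else 2 * m - s := by
    split
    · refine opn _ (by omega) fun h => ?_
      have := hσ (2 * m + 2 * n - 1) (by omega)
      omega
    · rcases Nat.eq_zero_or_pos n with rfl | hn
      · rw [Nat.mul_zero, Nat.add_zero, l₁]; omega
      · rw [← lA]
        have := hσ (2 * m + 2 * n - 1) (by omega)
        exact cls _ _ (by omega) (by omega) (by omega) (by omega)
  refine ⟨l₁, l₂, ?_⟩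
  split
  · refine opn _ (by omega) fun h => ?_
    have := hσ (2 * m + 2 * n + 2 * l - 1) (by omega)
    omega
  · rcases Nat.eq_zero_or_pos l with rfl | hl
    · rw [Nat.mul_zero, Nat.add_zero, l₂]
      split_ifs <;> omega
    · have h1 := hσ (2 * m + 2 * n + 2 * l - 1) (by omega)
      rw [cls _ (2 * m + 2 * n - t) (by omega) (by omega) (by omega) (by omega)]
      split
      · refine opn _ (by omega) fun h => ?_
        have := hσ (2 * m + 2 * n - t - 1) (by omega)
        omega
      · rcases Nat.eq_zero_or_pos s with rfl | h0
        · rw [show 2 * m + 2 * n - t = 2 * m by omega, l₁]; omega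
        · have := hσ (2 * m + 2 * n - t - 1) (by omega)
          rw [cls _ (2 * m - s) (by omega) (by omega) (by omega) (by omega), lA]

end

/-- Representatives of the boxes of `triple` up to connectedness. -/
theorem exists_triple_comp (m n l s t : ℕ) (hs : s ≤ 2 * m) (hst : s + t ≤ 2 * n)
    (ht : t ≤ 2 * l) : ∃ κ₁ κ₂ κ₃ : ℕ,
      (s < 2 * m → κ₁ = 0) ∧ (s + t < 2 * n → κ₂ = 0) ∧ (t < 2 * l → κ₃ = 0) ∧
      (0 < s → κ₁ = κ₂) ∧ (0 < t → κ₂ = κ₃) ∧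
      (κ₁ = 0 → s < 2 * m ∨ (0 < s ∧ (s + t < 2 * n ∨ (0 < t ∧ t < 2 * l)))) ∧
      (κ₂ = 0 → s + t < 2 * n ∨ (0 < s ∧ s < 2 * m) ∨ (0 < t ∧ t < 2 * l)) ∧
      (κ₃ = 0 → t < 2 * l ∨ (0 < t ∧ (s + t < 2 * n ∨ (0 < s ∧ s < 2 * m)))) ∧
      (κ₁ = 0 ∨ (κ₁ = 1 ∧ s = 0) ∨ (κ₁ = 2 ∧ 0 < s)) ∧ (κ₂ = 0 ∨ κ₂ = 2) ∧
      (κ₃ = 0 ∨ (κ₃ = 3 ∧ t = 0) ∨ (κ₃ = 2 ∧ 0 < t)) := by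
  by_cases hc : s + t < 2 * n ∨ (0 < s ∧ s < 2 * m) ∨ (0 < t ∧ t < 2 * l)
  · refine ⟨if s < 2 * m then 0 else if s = 0 then 1 else 0, 0,
      if t < 2 * l then 0 else if t = 0 then 3 else 0, ?_⟩
    split_ifs <;> refine ⟨?_, ?_, ?_, ?_, ?_, ?_, ?_, ?_, ?_, ?_, ?_⟩ <;>
      first | omega | exact False.elim
  · refine ⟨if s < 2 * m then 0 else if s = 0 then 1 else 2, 2,
      if t < 2 * l then 0 else if t = 0 then 3 else 2, ?_⟩
    split_ifs <;> refine ⟨?_, ?_, ?_, ?_, ?_, ?_, ?_, ?_, ?_, ?_, ?_⟩ <;>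
      first | omega | exact False.elim

end Tangle

namespace Tangle

-- A gap shares its face with an earlier one only if boxes have used up all their points on their
-- neighbours, or have none, and then the picture falls apart accordingly: each coincidence of
-- labels is offset by one more component. The proof is an exhaustive check of the cases; the total
-- is the number of internal boxes plus 2.
set_option maxHeartbeats 4000000 in
theorem triple_card {m n l s t κ₁ κ₂ κ₃ L₂ L₃ : ℕ} (hs : s ≤ 2 * m) (hst : s + t ≤ 2 * n)
    (ht : t ≤ 2 * l)
    (hL₂ : L₂ = if s < 2 * n then 2 * m + 2 * n else 2 * m - s)
    (hL₃ : L₃ = if t < 2 * l then 2 * m + 2 * n + 2 * l else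
      if s + t < 2 * n then 2 * m + 2 * n - t else 2 * m - s)
    (g₁ : s < 2 * m → κ₁ = 0) (g₂ : s + t < 2 * n → κ₂ = 0) (g₃ : t < 2 * l → κ₃ = 0)
    (g₁₂ : 0 < s → κ₁ = κ₂) (g₂₃ : 0 < t → κ₂ = κ₃)
    (z₁ : κ₁ = 0 → s < 2 * m ∨ (0 < s ∧ (s + t < 2 * n ∨ (0 < t ∧ t < 2 * l))))
    (z₂ : κ₂ = 0 → s + t < 2 * n ∨ (0 < s ∧ s < 2 * m) ∨ (0 < t ∧ t < 2 * l))
    (z₃ : κ₃ = 0 → t < 2 * l ∨ (0 < t ∧ (s + t < 2 * n ∨ (0 < s ∧ s < 2 * m))))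
    (v₁ : κ₁ = 0 ∨ (κ₁ = 1 ∧ s = 0) ∨ (κ₁ = 2 ∧ 0 < s)) (v₂ : κ₂ = 0 ∨ κ₂ = 2)
    (v₃ : κ₃ = 0 ∨ (κ₃ = 3 ∧ t = 0) ∨ (κ₃ = 2 ∧ 0 < t)) :
    ({0, κ₁, κ₂, κ₃} : Finset ℕ).card + ({0, 2 * m, L₂, L₃} : Finset ℕ).card = 5 := by
  have hL₂' : (s < 2 * n ∧ L₂ = 2 * m + 2 * n) ∨ (2 * n = s ∧ L₂ + s = 2 * m) := by
    rw [hL₂]; split_ifs <;> omega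
  have hL₃' : (t < 2 * l ∧ L₃ = 2 * m + 2 * n + 2 * l) ∨
      (t = 2 * l ∧ s + t < 2 * n ∧ L₃ + t = 2 * m + 2 * n) ∨
      (t = 2 * l ∧ s + t = 2 * n ∧ L₃ + s = 2 * m) := by
    rw [hL₃]; split_ifs <;> omega
  clear hL₂ hL₃
  simp only [Finset.card_insert_eq_ite, Finset.mem_insert, Finset.mem_singleton,
      Finset.card_singleton]
  rcases v₁ with rfl | ⟨rfl, rfl⟩ | ⟨rfl, v₁⟩ <;> rcases v₂ with rfl | rfl <;>
    rcases v₃ with rfl | ⟨rfl, rfl⟩ | ⟨rfl, v₃⟩ <;> try (exfalso; omega)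
  all_goals norm_num only [true_or, or_true, if_true, or_self, if_false]
  all_goals rcases hL₂' with h | h <;> rcases hL₃' with h' | h' | h' <;>
    try (exfalso; omega)
  all_goals split_ifs <;> omega

-- This is the tangle with which both bracketings of a triple product are compared, so one planarity
-- proof serves for both.
set_option maxHeartbeats 4000000 in
theorem triple_planar (m n l p s t : ℕ) (hp : m + n + l = p + s + t) (hs : s ≤ 2 * m)
    (hst : s + t ≤ 2 * n) (ht : t ≤ 2 * l) : (triple m n l p s t).Planar := by
  have hσ := tripleMatch_spec hp hs hst ht
  have nc := tripleMatch_nonCrossing hp hs hst ht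
  obtain ⟨hlab₁, hlab₂, hlab₃⟩ := arcLabel_tripleMatch hp hs hst ht
  obtain ⟨f₁, f₂, f₃, f₁₂, f₂₃⟩ := triple_star hp hs hst ht
  obtain ⟨κ₁, κ₂, κ₃, g₁, g₂, g₃, g₁₂, g₂₃, z₁, z₂, z₃, v₁, v₂, v₃⟩ :=
    exists_triple_comp m n l s t hs hst ht
  generalize tripleMatch m n l p s t = σ at *
  obtain ⟨L₂, hL₂⟩ : ∃ L₂, L₂ = if s < 2 * n then 2 * m + 2 * n else 2 * m - s := ⟨_, rfl⟩
  obtain ⟨L₃, hL₃⟩ : ∃ L₃, L₃ = if t < 2 * l then 2 * m + 2 * n + 2 * l else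
    if s + t < 2 * n then 2 * m + 2 * n - t else 2 * m - s := ⟨_, rfl⟩
  rw [← hL₂] at hlab₂
  rw [← hL₃] at hlab₃
  refine ofJoin_planar (fun b => match b with
      | none => p | some (.inl false) => m | some (.inl true) => n | some (.inr _) => l)
    (tripleRel m n l p s t) (fun b => match b with
      | .inl false => 0 | .inl true => 2 * m | .inr _ => 2 * m + 2 * n)
    (2 * m + 2 * n + 2 * l + 2 * p) σ nc ?_ ?_ ?_ ?_ ?_ ?_ ?_ ?_ ?_ inferInstance
    (fun _ _ h => h) (fun i => ofJoin_sameStar_regN _ _)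
    {0, 2 * m, L₂, L₃} ?_
    (fun b => match b with
      | none => 0 | some (.inl false) => κ₁ | some (.inl true) => κ₂ | some (.inr _) => κ₃)
    {0, κ₁, κ₂, κ₃} ?_ ?_
    (fun k => if k = 0 then none else if k = 1 then some (.inl false) else
      if k = 2 then some (.inl true) else some (.inr ())) ?_ ?_
  · rintro (_ | (_ | _) | _) <;> rfl
  · rintro b p b' q; exact Iff.rfl
  · rintro ((_ | _) | _) <;> dsimp only <;> omega
  · dsimp only; omega
  · rintro (_ | (_ | _) | _) v (_ | (_ | _) | _) v' h h' heq <;> dsimp only [ptPos] at * <;>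
      first | omega | exact ⟨rfl, by omega⟩
  · intro x hx
    rcases Nat.lt_or_ge x (2 * m) with h | h
    · refine ⟨some (.inl false), x, ?_, ?_⟩ <;> dsimp only [ptPos] <;> omega
    rcases Nat.lt_or_ge x (2 * m + 2 * n) with h' | h'
    · refine ⟨some (.inl true), x - 2 * m, ?_, ?_⟩ <;> dsimp only [ptPos] <;> omega
    rcases Nat.lt_or_ge x (2 * m + 2 * n + 2 * l) with h' | h'
    · refine ⟨some (.inr ()), x - 2 * m - 2 * n, ?_, ?_⟩ <;> dsimp only [ptPos] <;> omega
    · refine ⟨none, 2 * m + 2 * n + 2 * l + 2 * p - 1 - x, ?_, ?_⟩ <;> dsimp only [ptPos] <;> omega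
  · rintro (_ | (_ | _) | _) x b' y hx hy h
    · exact False.elim h
    all_goals
      obtain _ | (_ | _) | _ := b' <;> dsimp only [ptPos, tripleRel] at *
    · rcases hσ (0 + x) (by omega) with h' | h' | h' | h' | h' | h' | h' <;> omega
    · rcases hσ (0 + x) (by omega) with h' | h' | h' | h' | h' | h' | h' <;> omega
    · rcases hσ (2 * m + x) (by omega) with h' | h' | h' | h' | h' | h' | h' <;> omega
    · rcases hσ (2 * m + x) (by omega) with h' | h' | h' | h' | h' | h' | h' <;> omega
    · rcases hσ (2 * m + 2 * n + x) (by omega) with h' | h' | h' | h' | h' | h' | h' <;> omega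
  · rintro (_ | (_ | _) | _) x b' y hx hy h
    · obtain _ | (_ | _) | _ := b' <;> dsimp only [ptPos, tripleRel] at * <;>
        rcases hσ (2 * m + 2 * n + 2 * l + 2 * p - 1 - x) (by omega) with
          h' | h' | h' | h' | h' | h' | h' <;> omega
    · obtain _ | (_ | _) | _ := b' <;> dsimp only [ptPos, tripleRel] at * <;>
        rcases hσ (0 + x) (by omega) with h' | h' | h' | h' | h' | h' | h' <;> omega
    · obtain _ | (_ | _) | _ := b' <;> dsimp only [ptPos, tripleRel] at * <;>
        rcases hσ (2 * m + x) (by omega) with h' | h' | h' | h' | h' | h' | h' <;> omega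
    · obtain _ | (_ | _) | _ := b' <;> dsimp only [ptPos, tripleRel] at * <;>
        rcases hσ (2 * m + 2 * n + x) (by omega) with
          h' | h' | h' | h' | h' | h' | h' <;> omega
  · rintro (_ | (_ | _) | _) v h0 h (_ | (_ | _) | _) <;> dsimp only [ivlPos] at * <;> omega
  · have e1 := nc.arcLabel_last
    intro y
    simp only [Finset.mem_insert, Finset.mem_singleton]
    constructor
    · rintro (rfl | rfl | rfl | rfl)
      · exact ⟨none, Or.inl e1⟩
      · refine ⟨some (.inl false), Or.inr ?_⟩
        dsimp only [ivlPos]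
        rw [Nat.zero_add, hlab₁]
      · refine ⟨some (.inl true), Or.inr ?_⟩
        dsimp only [ivlPos]
        exact hlab₂
      · refine ⟨some (.inr ()), Or.inr ?_⟩
        dsimp only [ivlPos]
        exact hlab₃
    · rintro ⟨_ | (_ | _) | _, h | h⟩ <;> dsimp only [ivlPos] at h
      · exact Or.inl (h.symm.trans e1)
      · rw [Nat.add_sub_cancel, hlab₃] at h; exact Or.inr (Or.inr (Or.inr h.symm))
      · exact Or.inl (h.symm.trans (arcLabel_zero σ))
      · rw [Nat.zero_add, hlab₁] at h; exact Or.inr (Or.inl h.symm)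
      · rw [Nat.add_zero, hlab₁] at h; exact Or.inr (Or.inl h.symm)
      · rw [hlab₂] at h; exact Or.inr (Or.inr (Or.inl h.symm))
      · rw [Nat.add_zero, hlab₂] at h; exact Or.inr (Or.inr (Or.inl h.symm))
      · rw [hlab₃] at h; exact Or.inr (Or.inr (Or.inr h.symm))
  · intro k
    simp only [Finset.mem_insert, Finset.mem_singleton]
    constructor
    · rintro (rfl | rfl | rfl | rfl)
      · exact ⟨none, rfl⟩
      · exact ⟨some (.inl false), rfl⟩
      · exact ⟨some (.inl true), rfl⟩
      · exact ⟨some (.inr ()), rfl⟩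
    · rintro ⟨_ | (_ | _) | _, rfl⟩
      · exact Or.inl rfl
      · exact Or.inr (Or.inl rfl)
      · exact Or.inr (Or.inr (Or.inl rfl))
      · exact Or.inr (Or.inr (Or.inr rfl))
  · rintro (_ | (_ | _) | _) x (_ | (_ | _) | _) y hx hy h <;> dsimp only [tripleRel] at * <;> omega
  · have q₂ : κ₂ = 0 → (triple m n l p s t).bdry.regN (some (.inl true)) 0 =
        (triple m n l p s t).bdry.regN none 0 := by
      intro h
      rcases z₂ h with h | h | h
      · exact f₂ h
      · exact (f₁₂ h.1).symm.trans (f₁ h.2)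
      · exact (f₂₃ h.1).trans (f₃ h.2)
    rintro (_ | (_ | _) | _)
    · rfl
    · change (triple m n l p s t).bdry.regN (some (.inl false)) 0 =
        (triple m n l p s t).bdry.regN _ 0
      dsimp only
      rcases v₁ with h | ⟨h, -⟩ | ⟨h, h'⟩
      · rw [h, if_pos rfl]
        rcases Nat.lt_or_ge s (2 * m) with hm | hm
        · exact f₁ hm
        · exact (f₁₂ (by omega)).trans (q₂ (by omega))
      · rw [h, if_neg one_ne_zero, if_pos rfl]
      · rw [h, if_neg two_ne_zero, if_neg (by omega), if_pos rfl]
        exact f₁₂ h'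
    · change (triple m n l p s t).bdry.regN (some (.inl true)) 0 =
        (triple m n l p s t).bdry.regN _ 0
      dsimp only
      rcases v₂ with h | h
      · rw [h, if_pos rfl]
        exact q₂ h
      · rw [h, if_neg two_ne_zero, if_neg (by omega), if_pos rfl]
    · change (triple m n l p s t).bdry.regN (some (.inr ())) 0 =
        (triple m n l p s t).bdry.regN _ 0
      dsimp only
      rcases v₃ with h | ⟨h, -⟩ | ⟨h, h'⟩
      · rw [h, if_pos rfl]
        rcases Nat.lt_or_ge t (2 * l) with hm | hm
        · exact f₃ hm
        · exact (f₂₃ (by omega)).symm.trans (q₂ (by omega))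
      · rw [h, if_neg three_ne_zero, if_neg (by omega), if_neg (by omega)]
      · rw [h, if_neg two_ne_zero, if_neg (by omega), if_pos rfl]
        exact (f₂₃ h').symm
  · rw [triple_card hs hst ht hL₂ hL₃ g₁ g₂ g₃ g₁₂ g₂₃ z₁ z₂ z₃ v₁ v₂ v₃,
      Nat.card_eq_fintype_card]
    rfl

end Tangle

namespace Tangle

/-! ### Substitution into the multiplication tangles -/

theorem side_eq_of_even {ι : Type} {c : ι → Col} {c₀ : Col} (U : Tangle c c₀) {b : Option ι}
    (q : (boxCol c c₀ b).Pt) (w : ℕ → U.Reg) {v : ℕ} (s : Bool) (h : v % 2 = q.val % 2)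
    (h₀ : w v = U.regN b q.val) (h₁ : w (v + 1) = U.regN b (q.val + 1)) :
    U.side (U.str b q) s = w (if (v % 2 == 0) = s then v else v + 1) := by
  rw [side_str_regN, h]
  split_ifs
  · exact h₀.symm
  · exact h₁.symm

theorem side_eq_of_odd {ι : Type} {c : ι → Col} {c₀ : Col} (U : Tangle c c₀) {b : Option ι}
    (q : (boxCol c c₀ b).Pt) (w : ℕ → U.Reg) {v : ℕ} (s : Bool) (h : (v + q.val) % 2 = 1)
    (h₀ : w v = U.regN b (q.val + 1)) (h₁ : w (v + 1) = U.regN b q.val) :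
    U.side (U.str b q) s = w (if (v % 2 == 0) = s then v else v + 1) := by
  rw [side_str_regN]
  have hb : (v % 2 == 0) = !(q.val % 2 == 0) := by
    rw [Bool.eq_iff_iff]; simp; omega
  rw [hb]
  cases hq : (q.val % 2 == 0) <;> cases s <;> simp [h₀, h₁]

theorem ident_str {n : ℕ} (i j : (Col.nat n).Pt) (h : i.val = j.val) :
    (ident (.nat n)).str (some ()) i = (ident (.nat n)).str none j :=
  Quot.sound h

theorem pull_regN {ι ι' : Type} {c : ι → Col} {c' : ι' → Col} {c₀ : Col} (e : ι → ι')
    (hc : ∀ i, c i = c' (e i)) (T : Tangle c' c₀) (i : ι) (v : ℕ) :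
    (T.pull e hc).regN (some i) v = T.regN (some (e i)) v := by
  unfold regN
  refine T.reg_congr rfl _ _ ?_
  change (if v < 2 * (c i).num then v else 0) = if v < 2 * (c' (e i)).num then v else 0
  rw [hc]

/-- The strings and regions at the boundary of a circle around two boxes that are joined by `s`
strings. -/
theorem exists_group {ι : Type} {c : ι → Col} {c₀ : Col} (U : Tangle c c₀) (b₁ b₂ : Option ι)
    {m n q s : ℕ} (hm : (boxCol c c₀ b₁).num = m) (hn : (boxCol c c₀ b₂).num = n)
    (hq : m + n = q + s) (hs : s ≤ 2 * m) (hs' : s ≤ 2 * n)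
    (star : U.regN b₁ 0 = U.regN b₂ 0)
    (J : ∀ (i : (boxCol c c₀ b₁).Pt) (j : (boxCol c c₀ b₂).Pt),
      i.val + j.val + 1 = 2 * m → j.val < s → U.str b₁ i = U.str b₂ j) :
    ∃ (v : (Col.nat q).Pt → U.Str) (w : ℕ → U.Reg),
      (∀ i (j : (boxCol c c₀ b₁).Pt), j.val = i.val → j.val + s < 2 * m →
        v i = U.str b₁ j) ∧
      (∀ i (j : (boxCol c c₀ b₂).Pt), s ≤ j.val →
        i.val + 2 * s = j.val + 2 * m → v i = U.str b₂ j) ∧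
      w 0 = U.regN b₁ 0 ∧ w (2 * q) = w 0 ∧
      ∀ (i : (Col.nat q).Pt) x,
        U.side (v i) x = w (if (i.val % 2 == 0) = x then i.val else i.val + 1) := by
  have e₁ := regN_end U b₁
  have e₂ := regN_end U b₂
  rw [hm] at e₁
  rw [hn] at e₂
  -- In this region the circle passes from `b₁` to `b₂`, so `w` can be computed there from either
  -- box.
  have hA : U.regN b₂ s = U.regN b₁ (2 * m - s) := by
    rcases Nat.eq_zero_or_pos s with h0 | h0
    · rw [h0, Nat.sub_zero, e₁, star]
    · have h1 := regN_of_str_eq_odd U (J ⟨2 * m - s, by rw [hm]; omega⟩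
        ⟨s - 1, by rw [hn]; omega⟩ (by dsimp only; omega) (by dsimp only; omega))
        (by dsimp only; omega)
      rw [h1]
      exact congrArg _ (show s = s - 1 + 1 by omega)
  obtain ⟨v, hv, hv'⟩ : ∃ v : (Col.nat q).Pt → U.Str,
      (∀ i (j : (boxCol c c₀ b₁).Pt), j.val = i.val → j.val + s < 2 * m → v i = U.str b₁ j) ∧
      (∀ i (j : (boxCol c c₀ b₂).Pt), s ≤ j.val → i.val + 2 * s = j.val + 2 * m →
        v i = U.str b₂ j) := by
    refine ⟨fun i => if h : i.val + s < 2 * m then U.str b₁ ⟨i.val, by rw [hm]; omega⟩ else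
      U.str b₂ ⟨i.val + 2 * s - 2 * m, by
        have hi : i.val < 2 * q := i.isLt
        rw [hn]
        omega⟩, ?_, ?_⟩
    · intro i j h h'
      beta_reduce
      rw [dif_pos (by omega)]
      exact U.str_congr rfl _ _ h.symm
    · intro i j h h'
      beta_reduce
      rw [dif_neg (by omega)]
      refine U.str_congr rfl _ _ ?_
      dsimp only
      omega
  obtain ⟨w, hw, hw'⟩ : ∃ w : ℕ → U.Reg, (∀ i, i + s ≤ 2 * m → w i = U.regN b₁ i) ∧
      (∀ i j, s ≤ j → i + 2 * s = j + 2 * m → w i = U.regN b₂ j) := by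
    refine ⟨fun i => if i + s < 2 * m then U.regN b₁ i else U.regN b₂ (i + 2 * s - 2 * m), ?_, ?_⟩
    · intro i h
      beta_reduce
      split
      · rfl
      · rw [show i + 2 * s - 2 * m = s by omega, hA]
        exact congrArg _ (by omega)
    · intro i j h h'
      beta_reduce
      rw [if_neg (by omega)]
      exact congrArg _ (by omega)
  refine ⟨v, w, hv, hv', hw 0 (by omega), ?_, ?_⟩
  · rw [hw' (2 * q) (2 * n) (by omega) (by omega), hw 0 (by omega), e₂, star]
  · intro i x
    have hi : i.val < 2 * q := i.isLt
    rcases Nat.lt_or_ge (i.val + s) (2 * m) with h | h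
    · rw [hv i ⟨i.val, by rw [hm]; omega⟩ rfl h]
      exact side_eq_of_even U _ w x rfl (hw _ (by omega)) (hw _ (by omega))
    · rw [hv' i ⟨i.val + 2 * s - 2 * m, by rw [hn]; omega⟩ (by dsimp only; omega)
        (by dsimp only; omega)]
      exact side_eq_of_even U _ w x (by dsimp only; omega)
        (hw' _ _ (by dsimp only; omega) (by dsimp only; omega))
        (hw' _ _ (by dsimp only; omega) (by dsimp only; omega))

/-- A family of types over the two boxes of a multiplication tangle. -/
def pairIdx (κ₁ κ₂ : Type) : Bool → Type
  | false => κ₁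
  | true => κ₂

section

variable {κ₁ κ₂ : Type} {d₁ : κ₁ → Col} {d₂ : κ₂ → Col} {m n p : ℕ}

/-- The colours of the boxes of two tangles that are substituted into a multiplication tangle. -/
def pairFam (d₁ : κ₁ → Col) (d₂ : κ₂ → Col) : ∀ b, pairIdx κ₁ κ₂ b → Col
  | false => d₁
  | true => d₂

/-- Two tangles to be substituted into a multiplication tangle. -/
def pairTangle (S₁ : Tangle d₁ (.nat m)) (S₂ : Tangle d₂ (.nat n)) :
    ∀ b, Tangle (pairFam d₁ d₂ b) (pairCol m n b)
  | false => S₁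
  | true => S₂

variable (S₁ : Tangle d₁ (.nat m)) (S₂ : Tangle d₂ (.nat n))

/-- The multiplication tangle with two tangles substituted into its boxes. -/
abbrev multSubst (p : ℕ) :
    Tangle (fun q : (Σ b, pairIdx κ₁ κ₂ b) => pairFam d₁ d₂ q.1 q.2) (.nat p) :=
  (mult m n p).subst (pairTangle S₁ S₂)

theorem mult_star (b b' : Option Bool) : (mult m n p).regN b 0 = (mult m n p).regN b' 0 :=
  ofJoin_sameStar_regN _ _

/-- A string of the first tangle, after substitution. -/
abbrev fstStr (p : ℕ) (x : S₁.Str) : (multSubst S₁ S₂ p).Str := Quot.mk _ (.inr ⟨false, x⟩)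

/-- A string of the second tangle, after substitution. -/
abbrev sndStr (p : ℕ) (x : S₂.Str) : (multSubst S₁ S₂ p).Str := Quot.mk _ (.inr ⟨true, x⟩)

theorem fstStr_left (i : (Col.nat m).Pt) (j : (Col.nat p).Pt) (h : i.val = j.val)
    (hi : i.val + n < m + p) :
    fstStr S₁ S₂ p (S₁.str none i) = (multSubst S₁ S₂ p).str none j :=
  (subst_glue (mult m n p) (pairTangle S₁ S₂) false i).symm.trans
    (subst_str_eq_outer (mult_str_left i j h hi))

theorem fstStr_mid (i : (Col.nat m).Pt) (j : (Col.nat n).Pt)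
    (h : i.val + j.val + 1 = 2 * m) (hj : j.val + p < m + n) :
    fstStr S₁ S₂ p (S₁.str none i) = sndStr S₁ S₂ p (S₂.str none j) :=
  (subst_glue (mult m n p) (pairTangle S₁ S₂) false i).symm.trans
    ((subst_str_eq_outer (mult_str_mid i j h hj)).trans
      (subst_glue (mult m n p) (pairTangle S₁ S₂) true j))

theorem sndStr_right (i : (Col.nat n).Pt) (j : (Col.nat p).Pt)
    (hi : m + n ≤ i.val + p) (h : j.val + 2 * n = i.val + 2 * p) :
    sndStr S₁ S₂ p (S₂.str none i) = (multSubst S₁ S₂ p).str none j :=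
  (subst_glue (mult m n p) (pairTangle S₁ S₂) true i).symm.trans
    (subst_str_eq_outer (mult_str_right i j hi h))

theorem multSubst_regN_star (h₁ : ∀ j, S₁.regN (some j) 0 = S₁.regN none 0)
    (h₂ : ∀ j, S₂.regN (some j) 0 = S₂.regN none 0) (q : Σ b, pairIdx κ₁ κ₂ b) :
    (multSubst S₁ S₂ p).regN (some q) 0 = (multSubst S₁ S₂ p).regN none 0 :=
  subst_regN_star _ _ (fun _ => mult_star _ _) (fun i => match i with | false => h₁ | true => h₂) q

theorem multSubst_spanned (h₁ : S₁.Spanned) (h₂ : S₂.Spanned)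
    (g₁ : ∀ i, ∃ b q, (multSubst S₁ S₂ p).str b q = fstStr S₁ S₂ p (S₁.str none i))
    (g₂ : ∀ i, ∃ b q, (multSubst S₁ S₂ p).str b q = sndStr S₁ S₂ p (S₂.str none i)) :
    (multSubst S₁ S₂ p).Spanned := by
  refine subst_spanned _ _ (fun _ => mult_star _ _) (ofJoin_spanned _ _ _ _)
    (fun i => match i with | false => h₁ | true => h₂) ?_
  rintro (_ | _) i
  · obtain ⟨b, q, h⟩ := g₁ i
    exact ⟨b, q, h.trans (subst_glue (mult m n p) (pairTangle S₁ S₂) false i).symm⟩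
  · obtain ⟨b, q, h⟩ := g₂ i
    exact ⟨b, q, h.trans (subst_glue (mult m n p) (pairTangle S₁ S₂) true i).symm⟩

end

section

variable {m n l p q r s t : ℕ}

theorem triple_regN_star (b b' : Option (Bool ⊕ Unit)) :
    (triple m n l p s t).regN b 0 = (triple m n l p s t).regN b' 0 :=
  ofJoin_sameStar_regN _ _

/-- The boxes of `triple`, with the first two grouped. -/
def groupLeft : Bool ⊕ Unit ≃ Σ b, pairIdx Bool Unit b where
  toFun
    | .inl b => ⟨false, b⟩
    | .inr _ => ⟨true, ()⟩
  invFun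
    | ⟨false, b⟩ => .inl b
    | ⟨true, _⟩ => .inr ()
  left_inv := by rintro (_ | _) <;> rfl
  right_inv := by rintro ⟨_ | _, _⟩ <;> rfl

/-- The boxes of `triple`, with the last two grouped. -/
def groupRight : Bool ⊕ Unit ≃ Σ b, pairIdx Unit Bool b where
  toFun
    | .inl false => ⟨false, ()⟩
    | .inl true => ⟨true, false⟩
    | .inr _ => ⟨true, true⟩
  invFun
    | ⟨false, _⟩ => .inl false
    | ⟨true, false⟩ => .inl true
    | ⟨true, true⟩ => .inr ()
  left_inv := by rintro ((_ | _) | _) <;> rfl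
  right_inv := by rintro ⟨_ | _, _ | _⟩ <;> rfl

/-- The identity tangle occurs because a substitution fills every box at once. In one direction,
each string of `triple` is traced through the removed circles; in the other, `exists_group` supplies
the circle around the first two boxes. -/
theorem triple_iso_left (hq : m + n = q + s) (hp : q + l = p + t) (hs : s ≤ 2 * m)
    (hst : s + t ≤ 2 * n) (hc) :
    (triple m n l p s t).Iso
      ((multSubst (mult m n q) (ident (.nat l)) p).pull groupLeft hc) := by
  have hc' : ∀ i, pairFam (pairCol m n) (fun _ : Unit => .nat l) i.1 i.2 =
    tripleCol m n l (groupLeft.symm i) := by rintro ⟨_ | _, _ | _⟩ <;> rfl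
  refine iso_pull hc' ?_ ?_ (ofJoin_spanned _ _ _ _) ?_
  · refine ofJoin_sameStar_homTo _ ?_ fun i =>
      (pull_regN _ _ _ _ _).trans <|
      multSubst_regN_star (mult m n q) (ident (.nat l)) (fun _ => mult_star _ _)
        (fun _ => ofJoin_sameStar_regN _ _) (groupLeft i)
    rintro (_ | (_ | _) | _) i b j h
    · exact False.elim h
    all_goals
      obtain _ | (_ | _) | _ := b <;> first | exact False.elim h | skip
    · have hi : i.val < 2 * m := i.isLt
      obtain ⟨h1, h2⟩ : i.val = j.val ∧ i.val + s < 2 * m := h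
      obtain ⟨v, hv⟩ : ∃ v : (Col.nat q).Pt, v.val = i.val := ⟨⟨i.val, show _ < 2 * q by omega⟩, rfl⟩
      exact (congrArg (fstStr (mult m n q) (ident (.nat l)) p) (mult_str_left (n := n) (p := q) i v hv.symm (by omega))).trans
        (fstStr_left (mult m n q) (ident (.nat l)) v j (by omega) (by omega))
    · obtain ⟨h1, h2⟩ : i.val + j.val + 1 = 2 * m ∧ j.val < s := h
      exact congrArg (fstStr (mult m n q) (ident (.nat l)) p) (mult_str_mid (p := q) i j h1 (by omega))
    · have hi : i.val < 2 * n := i.isLt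
      obtain ⟨h1, h2, h3⟩ : s ≤ i.val ∧ i.val + t < 2 * n ∧ j.val + 2 * s = i.val + 2 * m := h
      obtain ⟨v, hv⟩ : ∃ v : (Col.nat q).Pt, v.val = j.val := ⟨⟨j.val, show _ < 2 * q by omega⟩, rfl⟩
      exact (congrArg (fstStr (mult m n q) (ident (.nat l)) p) (mult_str_right (m := m) (p := q) i v (by omega) (by omega))).trans
        (fstStr_left (mult m n q) (ident (.nat l)) v j hv (by omega))
    · have hi : i.val < 2 * n := i.isLt
      obtain ⟨h1, h2⟩ : i.val + j.val + 1 = 2 * n ∧ j.val < t := h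
      obtain ⟨v, hv⟩ : ∃ v : (Col.nat q).Pt, v.val + j.val + 1 = 2 * q :=
        ⟨⟨2 * q - 1 - j.val, show _ < 2 * q by omega⟩, by dsimp only; omega⟩
      exact (congrArg (fstStr (mult m n q) (ident (.nat l)) p) (mult_str_right (m := m) (p := q) i v (by omega) (by omega))).trans
        ((fstStr_mid (mult m n q) (ident (.nat l)) v j hv (by omega)).trans
        (congrArg (sndStr (mult m n q) (ident (.nat l)) p) (ident_str j j rfl)).symm)
    · have hi : i.val < 2 * l := i.isLt
      obtain ⟨h1, h2⟩ : t ≤ i.val ∧ j.val + 2 * l = i.val + 2 * p := h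
      exact (congrArg (sndStr (mult m n q) (ident (.nat l)) p) (ident_str i i rfl)).trans
        (sndStr_right (mult m n q) (ident (.nat l)) i j (by omega) h2)
  · set U := (triple m n l p s t).pull groupLeft.symm hc' with hU
    have star : ∀ b, U.regN b 0 = U.regN none 0 := by
      rintro (_ | i)
      · rfl
      · exact (pull_regN _ _ _ _ _).trans (triple_regN_star _ _)
    have J₁ : ∀ (i : (Col.nat m).Pt) (j : (Col.nat p).Pt), i.val = j.val → i.val + s < 2 * m →
        U.str (some ⟨false, false⟩) i = U.str none j := fun i j h h' =>
      triple_str (b := some (.inl false)) (b' := none) i j ⟨h, h'⟩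
    have J₁₂ : ∀ (i : (Col.nat m).Pt) (j : (Col.nat n).Pt), i.val + j.val + 1 = 2 * m →
        j.val < s → U.str (some ⟨false, false⟩) i = U.str (some ⟨false, true⟩) j :=
      fun i j h h' => triple_str (b := some (.inl false)) (b' := some (.inl true)) i j ⟨h, h'⟩
    have J₂ : ∀ (i : (Col.nat n).Pt) (j : (Col.nat p).Pt), s ≤ i.val → i.val + t < 2 * n →
        j.val + 2 * s = i.val + 2 * m → U.str (some ⟨false, true⟩) i = U.str none j :=
      fun i j h h' h'' => triple_str (b := some (.inl true)) (b' := none) i j ⟨h, h', h''⟩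
    have J₂₃ : ∀ (i : (Col.nat n).Pt) (j : (Col.nat l).Pt), i.val + j.val + 1 = 2 * n →
        j.val < t → U.str (some ⟨false, true⟩) i = U.str (some ⟨true, ()⟩) j :=
      fun i j h h' => triple_str (b := some (.inl true)) (b' := some (.inr ())) i j ⟨h, h'⟩
    have J₃ : ∀ (i : (Col.nat l).Pt) (j : (Col.nat p).Pt), t ≤ i.val →
        j.val + 2 * l = i.val + 2 * p → U.str (some ⟨true, ()⟩) i = U.str none j :=
      fun i j h h' => triple_str (b := some (.inr ())) (b' := none) i j ⟨h, h'⟩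
    clear_value U
    obtain ⟨v₁, w₁, hv₁, hv₁', hw₁, hw₁', hside⟩ := exists_group (q := q) (s := s) U
      (some ⟨false, false⟩) (some ⟨false, true⟩) (m := m) (n := n) rfl rfl hq hs (show s ≤ 2 * n by omega)
      ((star _).trans (star _).symm) J₁₂
    have hw : ∀ b, (match b with | false => w₁ | true => U.regN (some ⟨true, ()⟩) : ℕ → U.Reg)
        (2 * (pairCol q l b).num) =
        (match b with | false => w₁ | true => U.regN (some ⟨true, ()⟩) : ℕ → U.Reg) 0 := by
      rintro (_ | _)
      · exact hw₁'
      · exact regN_end U (some ⟨true, ()⟩)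
    refine subst_homTo U (fun b => match b with
      | false => v₁
      | true => U.str (some ⟨true, ()⟩)) (fun b => match b with
      | false => w₁
      | true => U.regN (some ⟨true, ()⟩)) hw ?_ ?_ ?_
    · rintro (_ | _) i x
      · exact hside i x
      · exact side_eq_of_even U _ _ x rfl rfl rfl
    · refine ofJoin_sameStar_homTo _ ?_ ?_
      · rintro (_ | _ | _) i b j h
        · exact False.elim h
        all_goals
          obtain _ | _ | _ := b <;> first | exact False.elim h | skip
        · obtain ⟨h1, h2⟩ : i.val = j.val ∧ i.val + l < q + p := h
          have hj : j.val < 2 * p := j.isLt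
          change v₁ i = U.str none j
          rcases Nat.lt_or_ge (i.val + s) (2 * m) with h | h
          · obtain ⟨v, hv⟩ : ∃ v : (Col.nat m).Pt, v.val = i.val :=
              ⟨⟨i.val, show _ < 2 * m by omega⟩, rfl⟩
            rw [hv₁ i v hv (by omega), J₁ v j (by omega) (by omega)]
          · obtain ⟨v, hv⟩ : ∃ v : (Col.nat n).Pt, i.val + 2 * s = v.val + 2 * m :=
              ⟨⟨i.val + 2 * s - 2 * m, show _ < 2 * n by omega⟩, by dsimp only; omega⟩
            rw [hv₁' i v (by omega) hv, J₂ v j (by omega) (by omega) (by omega)]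
        · obtain ⟨h1, h2⟩ : i.val + j.val + 1 = 2 * q ∧ j.val + p < q + l := h
          obtain ⟨v, hv⟩ : ∃ v : (Col.nat n).Pt, i.val + 2 * s = v.val + 2 * m :=
            ⟨⟨i.val + 2 * s - 2 * m, show _ < 2 * n by omega⟩, by dsimp only; omega⟩
          change v₁ i = U.str (some ⟨true, ()⟩) j
          rw [hv₁' i v (by omega) hv, J₂₃ v j (by omega) (by omega)]
        · obtain ⟨h1, h2⟩ : q + l ≤ i.val + p ∧ j.val + 2 * l = i.val + 2 * p := h
          exact J₃ i j (by omega) h2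
      · rintro (_ | _)
        · rw [regN_zero, regN_zero]
          change w₁ 0 = U.reg none (Col.nat p).star
          rw [hw₁, star]
          exact regN_zero U none
        · rw [regN_zero, regN_zero]
          change U.regN (some ⟨true, ()⟩) 0 = U.reg none (Col.nat p).star
          rw [star]
          exact regN_zero U none
    · rintro (_ | _)
      · refine ofJoin_sameStar_homTo _ ?_ ?_
        · rintro (_ | _ | _) i b j h
          · exact False.elim h
          all_goals
            obtain _ | _ | _ := b <;> first | exact False.elim h | skip
          · obtain ⟨h1, h2⟩ : i.val = j.val ∧ i.val + n < m + q := h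
            exact (hv₁ j i h1 (by omega)).symm
          · obtain ⟨h1, h2⟩ : i.val + j.val + 1 = 2 * m ∧ j.val + q < m + n := h
            exact J₁₂ i j h1 (by omega)
          · obtain ⟨h1, h2⟩ : m + n ≤ i.val + q ∧ j.val + 2 * n = i.val + 2 * q := h
            exact (hv₁' j i (by omega) (by omega)).symm
        · intro b
          rw [regN_zero, regN_zero]
          change U.reg (some ⟨false, b⟩) _ = w₁ 0
          rw [hw₁, star, ← star (some ⟨false, b⟩)]
          exact (regN_zero U (some ⟨false, b⟩)).symm
      · refine ofJoin_sameStar_homTo _ ?_ ?_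
        · rintro (_ | _) i (_ | _) j h
          · exact False.elim h
          · exact False.elim h
          · exact U.str_congr rfl _ _ h
          · exact False.elim h
        · intro b
          rw [regN_zero, regN_zero]
          exact (regN_zero U (some ⟨true, ()⟩)).symm
  · refine multSubst_spanned _ _ (ofJoin_spanned _ _ _ _) (ofJoin_spanned _ _ _ _) ?_ ?_
    · intro i
      have hi : i.val < 2 * q := i.isLt
      rcases Nat.lt_or_ge (i.val + s) (2 * m) with h | h
      · exact ⟨some ⟨false, false⟩, ⟨i.val, show i.val < 2 * m by omega⟩,
          congrArg (fstStr (mult m n q) (ident (.nat l)) p) (mult_str_left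
            ⟨i.val, show i.val < 2 * m by omega⟩ i rfl (by dsimp only; omega))⟩
      · exact ⟨some ⟨false, true⟩, ⟨i.val + 2 * s - 2 * m, show _ < 2 * n by omega⟩,
          congrArg (fstStr (mult m n q) (ident (.nat l)) p) (mult_str_right
            ⟨i.val + 2 * s - 2 * m, show _ < 2 * n by omega⟩ i (by dsimp only; omega) (by dsimp only; omega))⟩
    · intro i
      exact ⟨some ⟨true, ()⟩, i,
        congrArg (sndStr (mult m n q) (ident (.nat l)) p) (ident_str i i rfl)⟩

/-- As for `triple_iso_left`, with the circle drawn around the last two boxes. -/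
theorem triple_iso_right (hr : n + l = r + t) (hp : m + r = p + s)
    (hst : s + t ≤ 2 * n) (ht : t ≤ 2 * l) (hc) :
    (triple m n l p s t).Iso
      ((multSubst (ident (.nat m)) (mult n l r) p).pull groupRight hc) := by
  have hc' : ∀ i, pairFam (fun _ : Unit => .nat m) (pairCol n l) i.1 i.2 =
    tripleCol m n l (groupRight.symm i) := by rintro ⟨_ | _, _ | _⟩ <;> rfl
  refine iso_pull hc' ?_ ?_ (ofJoin_spanned _ _ _ _) ?_
  · refine ofJoin_sameStar_homTo _ ?_ fun i =>
      (pull_regN _ _ _ _ _).trans <|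
      multSubst_regN_star (ident (.nat m)) (mult n l r)
        (fun _ => ofJoin_sameStar_regN _ _) (fun _ => mult_star _ _) (groupRight i)
    rintro (_ | (_ | _) | _) i b j h
    · exact False.elim h
    all_goals
      obtain _ | (_ | _) | _ := b <;> first | exact False.elim h | skip
    · have hi : i.val < 2 * m := i.isLt
      obtain ⟨h1, h2⟩ : i.val = j.val ∧ i.val + s < 2 * m := h
      exact (congrArg (fstStr (ident (.nat m)) (mult n l r) p) (ident_str i i rfl)).trans
        (fstStr_left (ident (.nat m)) (mult n l r) i j h1 (by omega))
    · have hj : j.val < 2 * n := j.isLt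
      obtain ⟨h1, h2⟩ : i.val + j.val + 1 = 2 * m ∧ j.val < s := h
      obtain ⟨v, hv⟩ : ∃ v : (Col.nat r).Pt, v.val = j.val := ⟨⟨j.val, show _ < 2 * r by omega⟩, rfl⟩
      exact (congrArg (fstStr (ident (.nat m)) (mult n l r) p) (ident_str i i rfl)).trans
        ((fstStr_mid (ident (.nat m)) (mult n l r) i v (by omega) (by omega)).trans
        (congrArg (sndStr (ident (.nat m)) (mult n l r) p)
          (mult_str_left (n := l) (p := r) j v hv.symm (by omega))).symm)
    · have hi : i.val < 2 * n := i.isLt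
      obtain ⟨h1, h2, h3⟩ : s ≤ i.val ∧ i.val + t < 2 * n ∧ j.val + 2 * s = i.val + 2 * m := h
      obtain ⟨v, hv⟩ : ∃ v : (Col.nat r).Pt, v.val = i.val := ⟨⟨i.val, show _ < 2 * r by omega⟩, rfl⟩
      exact (congrArg (sndStr (ident (.nat m)) (mult n l r) p)
          (mult_str_left (n := l) (p := r) i v hv.symm (by omega))).trans
        (sndStr_right (ident (.nat m)) (mult n l r) v j (by omega) (by omega))
    · obtain ⟨h1, h2⟩ : i.val + j.val + 1 = 2 * n ∧ j.val < t := h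
      exact congrArg (sndStr (ident (.nat m)) (mult n l r) p)
        (mult_str_mid (p := r) i j h1 (by omega))
    · have hi : i.val < 2 * l := i.isLt
      obtain ⟨h1, h2⟩ : t ≤ i.val ∧ j.val + 2 * l = i.val + 2 * p := h
      obtain ⟨v, hv⟩ : ∃ v : (Col.nat r).Pt, v.val + 2 * l = i.val + 2 * r :=
        ⟨⟨i.val + 2 * r - 2 * l, show _ < 2 * r by omega⟩, by dsimp only; omega⟩
      exact (congrArg (sndStr (ident (.nat m)) (mult n l r) p)
          (mult_str_right (m := n) (p := r) i v (by omega) hv)).trans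
        (sndStr_right (ident (.nat m)) (mult n l r) v j (by omega) (by omega))
  · set U := (triple m n l p s t).pull groupRight.symm hc' with hU
    have star : ∀ b, U.regN b 0 = U.regN none 0 := by
      rintro (_ | i)
      · rfl
      · exact (pull_regN _ _ _ _ _).trans (triple_regN_star _ _)
    have J₁ : ∀ (i : (Col.nat m).Pt) (j : (Col.nat p).Pt), i.val = j.val → i.val + s < 2 * m →
        U.str (some ⟨false, ()⟩) i = U.str none j := fun i j h h' =>
      triple_str (b := some (.inl false)) (b' := none) i j ⟨h, h'⟩
    have J₁₂ : ∀ (i : (Col.nat m).Pt) (j : (Col.nat n).Pt), i.val + j.val + 1 = 2 * m →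
        j.val < s → U.str (some ⟨false, ()⟩) i = U.str (some ⟨true, false⟩) j :=
      fun i j h h' => triple_str (b := some (.inl false)) (b' := some (.inl true)) i j ⟨h, h'⟩
    have J₂ : ∀ (i : (Col.nat n).Pt) (j : (Col.nat p).Pt), s ≤ i.val → i.val + t < 2 * n →
        j.val + 2 * s = i.val + 2 * m → U.str (some ⟨true, false⟩) i = U.str none j :=
      fun i j h h' h'' => triple_str (b := some (.inl true)) (b' := none) i j ⟨h, h', h''⟩
    have J₂₃ : ∀ (i : (Col.nat n).Pt) (j : (Col.nat l).Pt), i.val + j.val + 1 = 2 * n →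
        j.val < t → U.str (some ⟨true, false⟩) i = U.str (some ⟨true, true⟩) j :=
      fun i j h h' => triple_str (b := some (.inl true)) (b' := some (.inr ())) i j ⟨h, h'⟩
    have J₃ : ∀ (i : (Col.nat l).Pt) (j : (Col.nat p).Pt), t ≤ i.val →
        j.val + 2 * l = i.val + 2 * p → U.str (some ⟨true, true⟩) i = U.str none j :=
      fun i j h h' => triple_str (b := some (.inr ())) (b' := none) i j ⟨h, h'⟩
    clear_value U
    obtain ⟨v₂, w₂, hv₂, hv₂', hw₂, hw₂', hside⟩ := exists_group (q := r) (s := t) U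
      (some ⟨true, false⟩) (some ⟨true, true⟩) (m := n) (n := l) rfl rfl hr
      (show t ≤ 2 * n by omega) ht ((star _).trans (star _).symm) J₂₃
    have hw : ∀ b, (match b with | false => U.regN (some ⟨false, ()⟩) | true => w₂ : ℕ → U.Reg)
        (2 * (pairCol m r b).num) =
        (match b with | false => U.regN (some ⟨false, ()⟩) | true => w₂ : ℕ → U.Reg) 0 := by
      rintro (_ | _)
      · exact regN_end U (some ⟨false, ()⟩)
      · exact hw₂'
    refine subst_homTo U (fun b => match b with
      | false => U.str (some ⟨false, ()⟩)
      | true => v₂) (fun b => match b with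
      | false => U.regN (some ⟨false, ()⟩)
      | true => w₂) hw ?_ ?_ ?_
    · rintro (_ | _) i x
      · exact side_eq_of_even U _ _ x rfl rfl rfl
      · exact hside i x
    · refine ofJoin_sameStar_homTo _ ?_ ?_
      · rintro (_ | _ | _) i b j h
        · exact False.elim h
        all_goals
          obtain _ | _ | _ := b <;> first | exact False.elim h | skip
        · obtain ⟨h1, h2⟩ : i.val = j.val ∧ i.val + r < m + p := h
          exact J₁ i j h1 (by omega)
        · have hi : i.val < 2 * m := i.isLt
          obtain ⟨h1, h2⟩ : i.val + j.val + 1 = 2 * m ∧ j.val + p < m + r := h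
          obtain ⟨v, hv⟩ : ∃ v : (Col.nat n).Pt, v.val = j.val :=
            ⟨⟨j.val, show _ < 2 * n by omega⟩, rfl⟩
          change U.str (some ⟨false, ()⟩) i = v₂ j
          rw [hv₂ j v hv (by omega), J₁₂ i v (by omega) (by omega)]
        · have hi : i.val < 2 * r := i.isLt
          obtain ⟨h1, h2⟩ : m + r ≤ i.val + p ∧ j.val + 2 * r = i.val + 2 * p := h
          change v₂ i = U.str none j
          rcases Nat.lt_or_ge (i.val + t) (2 * n) with h | h
          · obtain ⟨v, hv⟩ : ∃ v : (Col.nat n).Pt, v.val = i.val :=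
              ⟨⟨i.val, show _ < 2 * n by omega⟩, rfl⟩
            rw [hv₂ i v hv (by omega), J₂ v j (by omega) (by omega) (by omega)]
          · obtain ⟨v, hv⟩ : ∃ v : (Col.nat l).Pt, i.val + 2 * t = v.val + 2 * n :=
              ⟨⟨i.val + 2 * t - 2 * n, show _ < 2 * l by omega⟩, by dsimp only; omega⟩
            rw [hv₂' i v (by omega) hv, J₃ v j (by omega) (by omega)]
      · rintro (_ | _)
        · rw [regN_zero, regN_zero]
          change U.regN (some ⟨false, ()⟩) 0 = U.reg none (Col.nat p).star
          rw [star]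
          exact regN_zero U none
        · rw [regN_zero, regN_zero]
          change w₂ 0 = U.reg none (Col.nat p).star
          rw [hw₂, star]
          exact regN_zero U none
    · rintro (_ | _)
      · refine ofJoin_sameStar_homTo _ ?_ ?_
        · rintro (_ | _) i (_ | _) j h
          · exact False.elim h
          · exact False.elim h
          · exact U.str_congr rfl _ _ h
          · exact False.elim h
        · intro b
          rw [regN_zero, regN_zero]
          exact (regN_zero U (some ⟨false, ()⟩)).symm
      · refine ofJoin_sameStar_homTo _ ?_ ?_
        · rintro (_ | _ | _) i b j h
          · exact False.elim h
          all_goals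
            obtain _ | _ | _ := b <;> first | exact False.elim h | skip
          · obtain ⟨h1, h2⟩ : i.val = j.val ∧ i.val + l < n + r := h
            exact (hv₂ j i h1 (by omega)).symm
          · obtain ⟨h1, h2⟩ : i.val + j.val + 1 = 2 * n ∧ j.val + r < n + l := h
            exact J₂₃ i j h1 (by omega)
          · obtain ⟨h1, h2⟩ : n + l ≤ i.val + r ∧ j.val + 2 * l = i.val + 2 * r := h
            exact (hv₂' j i (by omega) (by omega)).symm
        · intro b
          rw [regN_zero, regN_zero]
          change U.reg (some ⟨true, b⟩) _ = w₂ 0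
          rw [hw₂, star, ← star (some ⟨true, b⟩)]
          exact (regN_zero U (some ⟨true, b⟩)).symm
  · refine multSubst_spanned _ _ (ofJoin_spanned _ _ _ _) (ofJoin_spanned _ _ _ _) ?_ ?_
    · intro i
      exact ⟨some ⟨false, ()⟩, i,
        congrArg (fstStr (ident (.nat m)) (mult n l r) p) (ident_str i i rfl)⟩
    · intro i
      have hi : i.val < 2 * r := i.isLt
      rcases Nat.lt_or_ge (i.val + t) (2 * n) with h | h
      · exact ⟨some ⟨true, false⟩, ⟨i.val, show i.val < 2 * n by omega⟩,
          congrArg (sndStr (ident (.nat m)) (mult n l r) p) (mult_str_left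
            ⟨i.val, show i.val < 2 * n by omega⟩ i rfl (by dsimp only; omega))⟩
      · exact ⟨some ⟨true, true⟩, ⟨i.val + 2 * t - 2 * n, show _ < 2 * l by omega⟩,
          congrArg (sndStr (ident (.nat m)) (mult n l r) p) (mult_str_right
            ⟨i.val + 2 * t - 2 * n, show _ < 2 * l by omega⟩ i (by dsimp only; omega)
            (by dsimp only; omega))⟩

end

end Tangle

namespace Tangle

/-! ### Multiplication by the identity -/

theorem one_str {n : ℕ} (i j : (Col.nat n).Pt) (h : i.val + j.val + 1 = 2 * n) :
    (one n).str none i = (one n).str none j :=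
  Quot.sound h

theorem one_homTo {n : ℕ} (T : Tangle (fun i : Empty => nomatch i) (.nat n))
    (h : ∀ i j : (Col.nat n).Pt, i.val + j.val + 1 = 2 * n → i.val ≤ j.val →
      T.str none i = T.str none j) : (one n).HomTo T := by
  refine ofJoin_homTo _ ?_ fun _ _ => False.elim
  rintro (_ | i) p (_ | j) q hpq
  · have hpq : p.val + q.val + 1 = 2 * n := hpq
    rcases Nat.le_total p.val q.val with hle | hle
    · exact h p q hpq hle
    · exact (h q p (by omega) hle).symm
  · exact j.elim
  · exact i.elim
  · exact j.elim

/-- The boxes of a multiplication tangle of which the second one is filled with a tangle without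
boxes. -/
def fstOnly : Unit ≃ Σ b, pairIdx Unit Empty b where
  toFun _ := ⟨false, ()⟩
  invFun _ := ()
  left_inv _ := rfl
  right_inv := by rintro ⟨_ | _, i⟩; exacts [rfl, i.elim]

/-- The boxes of a multiplication tangle of which the first one is filled with a tangle without
boxes. -/
def sndOnly : Unit ≃ Σ b, pairIdx Empty Unit b where
  toFun _ := ⟨true, ()⟩
  invFun _ := ()
  left_inv _ := rfl
  right_inv := by rintro ⟨_ | _, i⟩; exacts [i.elim, rfl]

section

variable {n N P c : ℕ}

/-- The last `c` points of the box continue through vertical strings of 1_N to the external box, and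
the other strings of 1_N become nested cups in front of them. The condition `c ≤ N` keeps the
strings of 1_N from returning to the box. -/
theorem ins_iso_fst (h : n + N = P + c) (hn : c ≤ 2 * n) (hN : c ≤ N) (hc) :
    (ins n (2 * n - c) P).Iso ((multSubst (ident (.nat n)) (one N) P).pull fstOnly hc) := by
  have hc' : ∀ i, pairFam (fun _ : Unit => .nat n) (fun i : Empty => nomatch i) i.1 i.2 =
    (fun _ : Unit => Col.nat n) (fstOnly.symm i) := by rintro ⟨_ | _, i⟩; exacts [rfl, i.elim]
  refine iso_pull hc' ?_ ?_ (ofJoin_spanned _ _ _ _) ?_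
  · refine ofJoin_sameStar_homTo _ ?_ fun i =>
      (pull_regN _ _ _ _ _).trans <|
      multSubst_regN_star (ident (.nat n)) (one N)
        (fun _ => ofJoin_sameStar_regN _ _) (fun i => nomatch i) (fstOnly i)
    rintro (_ | _) i (_ | _) j h'
    · obtain ⟨h1, h2, h3⟩ : 2 * n - c ≤ i.val ∧ 2 * n - c ≤ j.val ∧
        i.val + j.val + 1 + 2 * n = 2 * (2 * n - c) + 2 * P := h'
      obtain ⟨v, hv⟩ : ∃ v : (Col.nat N).Pt, i.val + 2 * N = v.val + 2 * P :=
        ⟨⟨i.val + 2 * N - 2 * P, show _ < 2 * N by omega⟩, by dsimp only; omega⟩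
      obtain ⟨v', hv'⟩ : ∃ v' : (Col.nat N).Pt, j.val + 2 * N = v'.val + 2 * P :=
        ⟨⟨j.val + 2 * N - 2 * P, show _ < 2 * N by omega⟩, by dsimp only; omega⟩
      exact (sndStr_right (ident (.nat n)) (one N) v i (by omega) hv).symm.trans
        ((congrArg (sndStr (ident (.nat n)) (one N) P) (one_str v v' (by omega))).trans
          (sndStr_right (ident (.nat n)) (one N) v' j (by omega) hv'))
    · exact False.elim h'
    · have hi : i.val < 2 * n := i.isLt
      refine (congrArg (fstStr (ident (.nat n)) (one N) P) (ident_str i i rfl)).trans ?_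
      obtain ⟨h1, h2⟩ | ⟨h1, h2⟩ : (i.val < 2 * n - c ∧ j.val = i.val) ∨
        (2 * n - c ≤ i.val ∧ j.val + 2 * n = i.val + 2 * P) := h'
      · exact fstStr_left (ident (.nat n)) (one N) i j h2.symm (by omega)
      · obtain ⟨v, hv⟩ : ∃ v : (Col.nat N).Pt, i.val + v.val + 1 = 2 * n :=
          ⟨⟨2 * n - 1 - i.val, show _ < 2 * N by omega⟩, by dsimp only; omega⟩
        obtain ⟨v', hv'⟩ : ∃ v' : (Col.nat N).Pt, v.val + v'.val + 1 = 2 * N :=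
          ⟨⟨2 * N - 1 - v.val, show _ < 2 * N by omega⟩, by dsimp only; omega⟩
        exact (fstStr_mid (ident (.nat n)) (one N) i v hv (by omega)).trans
          ((congrArg (sndStr (ident (.nat n)) (one N) P) (one_str v v' hv')).trans
            (sndStr_right (ident (.nat n)) (one N) v' j (by omega) (by omega)))
    · exact False.elim h'
  · set U := (ins n (2 * n - c) P).pull fstOnly.symm hc' with hU
    have star : U.regN (some ⟨false, ()⟩) 0 = U.regN none 0 :=
      (pull_regN _ _ _ _ _).trans (ofJoin_sameStar_regN _ _)
    have J₁ : ∀ (i : (Col.nat n).Pt) (j : (Col.nat P).Pt), j.val = i.val → i.val < 2 * n - c →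
        U.str (some ⟨false, ()⟩) i = U.str none j := fun i j h h' => ins_str_lt i j h' h
    have J₂ : ∀ (i : (Col.nat n).Pt) (j : (Col.nat P).Pt), 2 * n - c ≤ i.val →
        j.val + 2 * n = i.val + 2 * P → U.str (some ⟨false, ()⟩) i = U.str none j :=
      fun i j h h' => ins_str_ge i j h h'
    have J₃ : ∀ i j : (Col.nat P).Pt, 2 * n - c ≤ i.val → 2 * n - c ≤ j.val →
        i.val + j.val + 1 + 2 * n = 2 * (2 * n - c) + 2 * P → U.str none i = U.str none j :=
      fun i j h h' h'' => ins_str_cup i j h h' h''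
    clear_value U
    have e₁ : U.regN (some ⟨false, ()⟩) (2 * n) = _ := regN_end U (some ⟨false, ()⟩)
    have e₀ : U.regN none (2 * P) = _ := regN_end U none
    have hA : U.regN (some ⟨false, ()⟩) (2 * n - c) = U.regN none (2 * n - c) := by
      rcases Nat.eq_zero_or_pos (2 * n - c) with h0 | h0
      · rw [h0, star]
      · have h1 := (regN_of_str_eq_even U (J₁ ⟨2 * n - c - 1, show _ < 2 * n by omega⟩
          ⟨2 * n - c - 1, show _ < 2 * P by omega⟩ rfl (by dsimp only; omega))
          (by dsimp only; omega)).2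
        dsimp only at h1
        rwa [show 2 * n - c - 1 + 1 = 2 * n - c by omega] at h1
    -- The circle around 1_N meets first the last `c` strings of the box, in reverse order, and then
    -- strings of the external box.
    obtain ⟨v, hv, hv'⟩ : ∃ v : (Col.nat N).Pt → U.Str,
        (∀ i (j : (Col.nat n).Pt), i.val + j.val + 1 = 2 * n → i.val < c →
          v i = U.str (some ⟨false, ()⟩) j) ∧
        (∀ i (j : (Col.nat P).Pt), c ≤ i.val → j.val + 2 * N = i.val + 2 * P →
          v i = U.str none j) := by
      refine ⟨fun i => if h : i.val < c then
        U.str (some ⟨false, ()⟩) ⟨2 * n - 1 - i.val, show _ < 2 * n by omega⟩ else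
        U.str none ⟨i.val + 2 * P - 2 * N, by
          have hi : i.val < 2 * N := i.isLt
          change _ < 2 * P
          omega⟩, ?_, ?_⟩
      · intro i j h h'
        beta_reduce
        rw [dif_pos h']
        refine U.str_congr rfl _ _ ?_
        dsimp only
        omega
      · intro i j h h'
        beta_reduce
        rw [dif_neg (by omega)]
        refine U.str_congr rfl _ _ ?_
        dsimp only
        omega
    obtain ⟨w, hw, hw'⟩ : ∃ w : ℕ → U.Reg,
        (∀ i j, i ≤ c → i + j = 2 * n → w i = U.regN (some ⟨false, ()⟩) j) ∧
        (∀ i j, c ≤ i → j + 2 * N = i + 2 * P → w i = U.regN none j) := by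
      refine ⟨fun i => if i ≤ c then U.regN (some ⟨false, ()⟩) (2 * n - i) else
        U.regN none (i + 2 * P - 2 * N), ?_, ?_⟩
      · intro i j h h'
        beta_reduce
        rw [if_pos h]
        exact congrArg _ (by omega)
      · intro i j h h'
        beta_reduce
        split
        · rw [show i = c by omega, hA]
          exact congrArg _ (by omega)
        · exact congrArg _ (by omega)
    have hw₀ : w 0 = U.regN none 0 := by rw [hw 0 (2 * n) (by omega) (by omega), e₁, star]
    have hw₁ : ∀ b, (match b with | false => U.regN (some ⟨false, ()⟩) | true => w : ℕ → U.Reg)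
        (2 * (pairCol n N b).num) =
        (match b with | false => U.regN (some ⟨false, ()⟩) | true => w : ℕ → U.Reg) 0 := by
      rintro (_ | _)
      · exact e₁
      · change w (2 * N) = w 0
        rw [hw' (2 * N) (2 * P) (by omega) (by omega), hw₀, e₀]
    refine subst_homTo U (fun b => match b with
      | false => U.str (some ⟨false, ()⟩)
      | true => v) (fun b => match b with
      | false => U.regN (some ⟨false, ()⟩)
      | true => w) hw₁ ?_ ?_ ?_
    · rintro (_ | _) i x
      · exact side_eq_of_even U _ _ x rfl rfl rfl
      · have hi : i.val < 2 * N := i.isLt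
        change U.side (v i) x = w _
        rcases Nat.lt_or_ge i.val c with h0 | h0
        · rw [hv i ⟨2 * n - 1 - i.val, show _ < 2 * n by omega⟩ (by dsimp only; omega) h0]
          exact side_eq_of_odd U _ w x (by dsimp only; omega)
            (hw _ _ (by omega) (by dsimp only; omega)) (hw _ _ (by omega) (by dsimp only; omega))
        · rw [hv' i ⟨i.val + 2 * P - 2 * N, show _ < 2 * P by omega⟩ h0 (by dsimp only; omega)]
          exact side_eq_of_even U _ w x (by dsimp only; omega)
            (hw' _ _ (by omega) (by dsimp only; omega)) (hw' _ _ (by omega) (by dsimp only; omega))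
    · refine ofJoin_sameStar_homTo _ ?_ ?_
      · rintro (_ | _ | _) i b j h'
        · exact False.elim h'
        all_goals
          obtain _ | _ | _ := b <;> first | exact False.elim h' | skip
        · obtain ⟨h1, h2⟩ : i.val = j.val ∧ i.val + N < n + P := h'
          exact J₁ i j h1.symm (by omega)
        · obtain ⟨h1, h2⟩ : i.val + j.val + 1 = 2 * n ∧ j.val + P < n + N := h'
          exact (hv j i (by omega) (by omega)).symm
        · obtain ⟨h1, h2⟩ : n + N ≤ i.val + P ∧ j.val + 2 * N = i.val + 2 * P := h'
          exact hv' i j (by omega) h2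
      · rintro (_ | _)
        · rw [regN_zero, regN_zero]
          exact star.trans (regN_zero U none)
        · rw [regN_zero, regN_zero]
          exact hw₀.trans (regN_zero U none)
    · rintro (_ | _)
      · refine ofJoin_sameStar_homTo _ ?_ ?_
        · rintro (_ | _) i (_ | _) j h
          · exact False.elim h
          · exact False.elim h
          · exact U.str_congr rfl _ _ h
          · exact False.elim h
        · intro b
          rw [regN_zero, regN_zero]
          exact (regN_zero U (some ⟨false, ()⟩)).symm
      · refine one_homTo _ ?_
        intro i j h1 h2
        change v i = v j
        obtain ⟨j', hj'⟩ : ∃ j' : (Col.nat P).Pt, j'.val + 2 * N = j.val + 2 * P := by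
          have hj : j.val < 2 * N := j.isLt
          exact ⟨⟨j.val + 2 * P - 2 * N, show _ < 2 * P by omega⟩, by dsimp only; omega⟩
        rw [hv' j j' (by omega) hj']
        rcases Nat.lt_or_ge i.val c with h0 | h0
        · obtain ⟨i', hi'⟩ : ∃ i' : (Col.nat n).Pt, i.val + i'.val + 1 = 2 * n :=
            ⟨⟨2 * n - 1 - i.val, show _ < 2 * n by omega⟩, by dsimp only; omega⟩
          rw [hv i i' hi' h0]
          exact J₂ i' j' (by omega) (by omega)
        · obtain ⟨i', hi'⟩ : ∃ i' : (Col.nat P).Pt, i'.val + 2 * N = i.val + 2 * P := by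
            have hi : i.val < 2 * N := i.isLt
            exact ⟨⟨i.val + 2 * P - 2 * N, show _ < 2 * P by omega⟩, by dsimp only; omega⟩
          rw [hv' i i' h0 hi']
          exact J₃ i' j' (by omega) (by omega) (by omega)
  · refine multSubst_spanned _ _ (ofJoin_spanned _ _ _ _) (ofJoin_spanned _ _ _ _) ?_ ?_
    · intro i
      exact ⟨some ⟨false, ()⟩, i,
        congrArg (fstStr (ident (.nat n)) (one N) P) (ident_str i i rfl)⟩
    · intro i
      have hi : i.val < 2 * N := i.isLt
      rcases Nat.lt_or_ge i.val c with h0 | h0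
      · obtain ⟨v, hv⟩ : ∃ v : (Col.nat n).Pt, v.val + i.val + 1 = 2 * n :=
          ⟨⟨2 * n - 1 - i.val, show _ < 2 * n by omega⟩, by dsimp only; omega⟩
        exact ⟨some ⟨false, ()⟩, v,
          (congrArg (fstStr (ident (.nat n)) (one N) P) (ident_str v v rfl)).trans
            (fstStr_mid (ident (.nat n)) (one N) v i hv (by omega))⟩
      · obtain ⟨v, hv⟩ : ∃ v : (Col.nat P).Pt, v.val + 2 * N = i.val + 2 * P :=
          ⟨⟨i.val + 2 * P - 2 * N, show _ < 2 * P by omega⟩, by dsimp only; omega⟩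
        exact ⟨none, v, (sndStr_right (ident (.nat n)) (one N) i v (by omega) hv).symm⟩

/-- The mirror image of `ins_iso_fst`: 1_N is on top, the first `c` points of the box pass through
it, and its unused strings become cups after them. -/
theorem ins_iso_snd (h : n + N = P + c) (hn : c ≤ 2 * n) (hN : c ≤ N) (hc) :
    (ins n c P).Iso ((multSubst (one N) (ident (.nat n)) P).pull sndOnly hc) := by
  have hc' : ∀ i, pairFam (fun i : Empty => nomatch i) (fun _ : Unit => .nat n) i.1 i.2 =
    (fun _ : Unit => Col.nat n) (sndOnly.symm i) := by rintro ⟨_ | _, i⟩; exacts [i.elim, rfl]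
  refine iso_pull hc' ?_ ?_ (ofJoin_spanned _ _ _ _) ?_
  · refine ofJoin_sameStar_homTo _ ?_ fun i =>
      (pull_regN _ _ _ _ _).trans <|
      multSubst_regN_star (one N) (ident (.nat n))
        (fun i => nomatch i) (fun _ => ofJoin_sameStar_regN _ _) (sndOnly i)
    rintro (_ | _) i (_ | _) j h'
    · obtain ⟨h1, h2, h3⟩ : c ≤ i.val ∧ c ≤ j.val ∧
        i.val + j.val + 1 + 2 * n = 2 * c + 2 * P := h'
      obtain ⟨v, hv⟩ : ∃ v : (Col.nat N).Pt, v.val = i.val :=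
        ⟨⟨i.val, show _ < 2 * N by omega⟩, rfl⟩
      obtain ⟨v', hv'⟩ : ∃ v' : (Col.nat N).Pt, v'.val = j.val :=
        ⟨⟨j.val, show _ < 2 * N by omega⟩, rfl⟩
      exact (fstStr_left (one N) (ident (.nat n)) v i hv (by omega)).symm.trans
        ((congrArg (fstStr (one N) (ident (.nat n)) P) (one_str v v' (by omega))).trans
          (fstStr_left (one N) (ident (.nat n)) v' j hv' (by omega)))
    · exact False.elim h'
    · have hi : i.val < 2 * n := i.isLt
      refine (congrArg (sndStr (one N) (ident (.nat n)) P) (ident_str i i rfl)).trans ?_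
      obtain ⟨h1, h2⟩ | ⟨h1, h2⟩ : (i.val < c ∧ j.val = i.val) ∨
        (c ≤ i.val ∧ j.val + 2 * n = i.val + 2 * P) := h'
      · obtain ⟨v, hv⟩ : ∃ v : (Col.nat N).Pt, v.val + i.val + 1 = 2 * N :=
          ⟨⟨2 * N - 1 - i.val, show _ < 2 * N by omega⟩, by dsimp only; omega⟩
        obtain ⟨v', hv'⟩ : ∃ v' : (Col.nat N).Pt, v'.val = i.val :=
          ⟨⟨i.val, show _ < 2 * N by omega⟩, rfl⟩
        exact (fstStr_mid (one N) (ident (.nat n)) v i hv (by omega)).symm.trans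
          ((congrArg (fstStr (one N) (ident (.nat n)) P) (one_str v v' (by omega))).trans
            (fstStr_left (one N) (ident (.nat n)) v' j (by omega) (by omega)))
      · exact sndStr_right (one N) (ident (.nat n)) i j (by omega) h2
    · exact False.elim h'
  · set U := (ins n c P).pull sndOnly.symm hc' with hU
    have star : U.regN (some ⟨true, ()⟩) 0 = U.regN none 0 :=
      (pull_regN _ _ _ _ _).trans (ofJoin_sameStar_regN _ _)
    have J₁ : ∀ (i : (Col.nat n).Pt) (j : (Col.nat P).Pt), j.val = i.val → i.val < c →
        U.str (some ⟨true, ()⟩) i = U.str none j := fun i j h h' => ins_str_lt i j h' h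
    have J₂ : ∀ (i : (Col.nat n).Pt) (j : (Col.nat P).Pt), c ≤ i.val →
        j.val + 2 * n = i.val + 2 * P → U.str (some ⟨true, ()⟩) i = U.str none j :=
      fun i j h h' => ins_str_ge i j h h'
    have J₃ : ∀ i j : (Col.nat P).Pt, c ≤ i.val → c ≤ j.val →
        i.val + j.val + 1 + 2 * n = 2 * c + 2 * P → U.str none i = U.str none j :=
      fun i j h h' h'' => ins_str_cup i j h h' h''
    clear_value U
    have e₁ : U.regN (some ⟨true, ()⟩) (2 * n) = _ := regN_end U (some ⟨true, ()⟩)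
    have e₀ : U.regN none (2 * P) = _ := regN_end U none
    have hA : U.regN (some ⟨true, ()⟩) c = U.regN none (2 * N - c) := by
      rcases Nat.lt_or_ge c (2 * n) with h0 | h0
      · exact (regN_of_str_eq_even U (J₂ ⟨c, h0⟩ ⟨2 * N - c, show _ < 2 * P by omega⟩ le_rfl
          (by dsimp only; omega)) (by dsimp only; omega)).1
      · rw [show c = 2 * n by omega, show 2 * N - 2 * n = 2 * P by omega, e₁, e₀, star]
    obtain ⟨v, hv, hv'⟩ : ∃ v : (Col.nat N).Pt → U.Str,
        (∀ i (j : (Col.nat P).Pt), j.val = i.val → i.val + c < 2 * N → v i = U.str none j) ∧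
        (∀ i (j : (Col.nat n).Pt), 2 * N ≤ i.val + c → i.val + j.val + 1 = 2 * N →
          v i = U.str (some ⟨true, ()⟩) j) := by
      refine ⟨fun i => if h : i.val + c < 2 * N then
        U.str none ⟨i.val, show _ < 2 * P by omega⟩ else
        U.str (some ⟨true, ()⟩) ⟨2 * N - 1 - i.val, by
          have hi : i.val < 2 * N := i.isLt
          change _ < 2 * n
          omega⟩, ?_, ?_⟩
      · intro i j h h'
        beta_reduce
        rw [dif_pos h']
        exact U.str_congr rfl _ _ h.symm
      · intro i j h h'
        beta_reduce
        rw [dif_neg (by omega)]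
        refine U.str_congr rfl _ _ ?_
        dsimp only
        omega
    obtain ⟨w, hw, hw'⟩ : ∃ w : ℕ → U.Reg, (∀ i, i + c ≤ 2 * N → w i = U.regN none i) ∧
        (∀ i j, 2 * N ≤ i + c → i + j = 2 * N → w i = U.regN (some ⟨true, ()⟩) j) := by
      refine ⟨fun i => if i + c ≤ 2 * N then U.regN none i else
        U.regN (some ⟨true, ()⟩) (2 * N - i), ?_, ?_⟩
      · intro i h
        beta_reduce
        rw [if_pos h]
      · intro i j h h'
        beta_reduce
        split
        · rw [show j = c by omega, hA]
          exact congrArg _ (by omega)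
        · exact congrArg _ (by omega)
    have hw₀ : w 0 = U.regN none 0 := hw 0 (by omega)
    have hw₁ : ∀ b, (match b with | false => w | true => U.regN (some ⟨true, ()⟩) : ℕ → U.Reg)
        (2 * (pairCol N n b).num) =
        (match b with | false => w | true => U.regN (some ⟨true, ()⟩) : ℕ → U.Reg) 0 := by
      rintro (_ | _)
      · change w (2 * N) = w 0
        rw [hw' (2 * N) 0 (by omega) (by omega), hw₀, star]
      · exact e₁
    refine subst_homTo U (fun b => match b with
      | false => v
      | true => U.str (some ⟨true, ()⟩)) (fun b => match b with
      | false => w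
      | true => U.regN (some ⟨true, ()⟩)) hw₁ ?_ ?_ ?_
    · rintro (_ | _) i x
      · have hi : i.val < 2 * N := i.isLt
        change U.side (v i) x = w _
        rcases Nat.lt_or_ge (i.val + c) (2 * N) with h0 | h0
        · rw [hv i ⟨i.val, show _ < 2 * P by omega⟩ rfl h0]
          exact side_eq_of_even U _ w x rfl (hw _ (by omega)) (hw _ (by omega))
        · rw [hv' i ⟨2 * N - 1 - i.val, show _ < 2 * n by omega⟩ h0 (by dsimp only; omega)]
          exact side_eq_of_odd U _ w x (by dsimp only; omega)
            (hw' _ _ (by omega) (by dsimp only; omega)) (hw' _ _ (by omega) (by dsimp only; omega))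
      · exact side_eq_of_even U _ _ x rfl rfl rfl
    · refine ofJoin_sameStar_homTo _ ?_ ?_
      · rintro (_ | _ | _) i b j h'
        · exact False.elim h'
        all_goals
          obtain _ | _ | _ := b <;> first | exact False.elim h' | skip
        · obtain ⟨h1, h2⟩ : i.val = j.val ∧ i.val + n < N + P := h'
          exact hv i j h1.symm (by omega)
        · obtain ⟨h1, h2⟩ : i.val + j.val + 1 = 2 * N ∧ j.val + P < N + n := h'
          exact hv' i j (by omega) h1
        · obtain ⟨h1, h2⟩ : N + n ≤ i.val + P ∧ j.val + 2 * n = i.val + 2 * P := h'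
          exact J₂ i j (by omega) h2
      · rintro (_ | _)
        · rw [regN_zero, regN_zero]
          exact hw₀.trans (regN_zero U none)
        · rw [regN_zero, regN_zero]
          exact star.trans (regN_zero U none)
    · rintro (_ | _)
      · refine one_homTo _ ?_
        intro i j h1 h2
        have hj : j.val < 2 * N := j.isLt
        change v i = v j
        obtain ⟨i', hi'⟩ : ∃ i' : (Col.nat P).Pt, i'.val = i.val :=
          ⟨⟨i.val, show _ < 2 * P by omega⟩, rfl⟩
        rw [hv i i' hi' (by omega)]
        rcases Nat.lt_or_ge (j.val + c) (2 * N) with h0 | h0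
        · obtain ⟨j', hj'⟩ : ∃ j' : (Col.nat P).Pt, j'.val = j.val :=
            ⟨⟨j.val, show _ < 2 * P by omega⟩, rfl⟩
          rw [hv j j' hj' h0]
          exact J₃ i' j' (by omega) (by omega) (by omega)
        · obtain ⟨j', hj'⟩ : ∃ j' : (Col.nat n).Pt, j.val + j'.val + 1 = 2 * N :=
            ⟨⟨2 * N - 1 - j.val, show _ < 2 * n by omega⟩, by dsimp only; omega⟩
          rw [hv' j j' h0 hj']
          exact (J₁ j' i' (by omega) (by omega)).symm
      · refine ofJoin_sameStar_homTo _ ?_ ?_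
        · rintro (_ | _) i (_ | _) j h
          · exact False.elim h
          · exact False.elim h
          · exact U.str_congr rfl _ _ h
          · exact False.elim h
        · intro b
          rw [regN_zero, regN_zero]
          exact (regN_zero U (some ⟨true, ()⟩)).symm
  · refine multSubst_spanned _ _ (ofJoin_spanned _ _ _ _) (ofJoin_spanned _ _ _ _) ?_ ?_
    · intro i
      have hi : i.val < 2 * N := i.isLt
      rcases Nat.lt_or_ge (i.val + c) (2 * N) with h0 | h0
      · obtain ⟨v, hv⟩ : ∃ v : (Col.nat P).Pt, i.val = v.val :=
          ⟨⟨i.val, show _ < 2 * P by omega⟩, rfl⟩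
        exact ⟨none, v, (fstStr_left (one N) (ident (.nat n)) i v hv (by omega)).symm⟩
      · obtain ⟨v, hv⟩ : ∃ v : (Col.nat n).Pt, i.val + v.val + 1 = 2 * N :=
          ⟨⟨2 * N - 1 - i.val, show _ < 2 * n by omega⟩, by dsimp only; omega⟩
        exact ⟨some ⟨true, ()⟩, v,
          (congrArg (sndStr (one N) (ident (.nat n)) P) (ident_str v v rfl)).trans
            (fstStr_mid (one N) (ident (.nat n)) i v hv (by omega)).symm⟩
    · intro i
      exact ⟨some ⟨true, ()⟩, i,
        congrArg (sndStr (one N) (ident (.nat n)) P) (ident_str i i rfl)⟩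

/-- The boxes of a tangle with one internal box that is filled with a tangle without boxes. -/
def noBox : Empty ≃ Σ _ : Unit, Empty where
  toFun i := i.elim
  invFun i := i.2
  left_inv i := i.elim
  right_inv i := i.2.elim

/-- One cup is inserted into 1_n after its first `n + 1` points. The cup is the arc at the bottom of
the Jones projection, and the last string of 1_n, which joins the points `n - 1` and `n`, becomes
the arc at the top. -/
theorem jones_iso (hn : 0 < n) (hc) :
    (jones (n + 1)).Iso (((ins n (n + 1) (n + 1)).subst fun _ => one n).pull noBox hc) := by
  have hc' : ∀ i : Σ _ : Unit, Empty, (fun i : Empty => (nomatch i : Col)) i.2 =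
    (fun i : Empty => (nomatch i : Col)) (noBox.symm i) := fun i => i.2.elim
  have glue : ∀ i : (Col.nat n).Pt,
      (Quot.mk _ (.inl ((ins n (n + 1) (n + 1)).str (some ()) i)) :
        ((ins n (n + 1) (n + 1)).subst fun _ => one n).Str) =
        Quot.mk _ (.inr ⟨(), (one n).str none i⟩) := fun i => subst_glue _ (fun _ => one n) () i
  have lt : ∀ (i : (Col.nat n).Pt) (j : (Col.nat (n + 1)).Pt), i.val < n + 1 → j.val = i.val →
      ((ins n (n + 1) (n + 1)).subst fun _ => one n).str none j =
        Quot.mk _ (.inr ⟨(), (one n).str none i⟩) := fun i j h h' =>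
    (subst_str_eq_outer (ins_str_lt i j h h')).symm.trans (glue i)
  have ge : ∀ (i : (Col.nat n).Pt) (j : (Col.nat (n + 1)).Pt), n + 1 ≤ i.val → j.val = i.val + 2 →
      ((ins n (n + 1) (n + 1)).subst fun _ => one n).str none j =
        Quot.mk _ (.inr ⟨(), (one n).str none i⟩) := fun i j h h' =>
    (subst_str_eq_outer (ins_str_ge i j h (by omega))).symm.trans (glue i)
  refine iso_pull hc' ?_ ?_ (ofJoin_spanned _ _ _ _) ?_
  · refine ofJoin_homTo _ ?_ fun _ _ => False.elim
    rintro (_ | b) i (_ | b') j h'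
    rotate_left
    · exact b'.elim
    · exact b.elim
    · exact b.elim
    have hi : i.val < 2 * (n + 1) := i.isLt
    have hj : j.val < 2 * (n + 1) := j.isLt
    obtain ⟨h1, h2⟩ | ⟨h1, h2⟩ | ⟨h1, h2⟩ : (i.val + 2 < n + 1 ∧ i.val + j.val + 1 = 2 * (n + 1)) ∨
      (i.val + 2 = n + 1 ∧ j.val + 1 = n + 1) ∨ (i.val = n + 1 ∧ j.val = n + 1 + 1) := h'
    · obtain ⟨v, hv⟩ : ∃ v : (Col.nat n).Pt, i.val = v.val :=
        ⟨⟨i.val, show _ < 2 * n by omega⟩, rfl⟩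
      obtain ⟨v', hv'⟩ : ∃ v' : (Col.nat n).Pt, j.val = v'.val + 2 :=
        ⟨⟨j.val - 2, show _ < 2 * n by omega⟩, by dsimp only; omega⟩
      exact (lt v i (by omega) hv).trans (.trans (subst_str_eq_inner (one_str v v' (by omega)))
        (ge v' j (by omega) hv').symm)
    · obtain ⟨v, hv⟩ : ∃ v : (Col.nat n).Pt, i.val = v.val :=
        ⟨⟨i.val, show _ < 2 * n by omega⟩, rfl⟩
      obtain ⟨v', hv'⟩ : ∃ v' : (Col.nat n).Pt, j.val = v'.val :=
        ⟨⟨j.val, show _ < 2 * n by omega⟩, rfl⟩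
      exact (lt v i (by omega) hv).trans (.trans (subst_str_eq_inner (one_str v v' (by omega)))
        (lt v' j (by omega) hv').symm)
    · exact subst_str_eq_outer (ins_str_cup i j (by omega) (by omega) (by omega))
  · set U := (jones (n + 1)).pull noBox.symm hc' with hU
    have J₁ : ∀ i j : (Col.nat (n + 1)).Pt, i.val + 2 < n + 1 → i.val + j.val + 1 = 2 * (n + 1) →
        U.str none i = U.str none j := fun i j h h' => Quot.sound (Or.inl ⟨h, h'⟩)
    have J₂ : ∀ i j : (Col.nat (n + 1)).Pt, i.val + 2 = n + 1 → j.val + 1 = n + 1 →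
        U.str none i = U.str none j := fun i j h h' => Quot.sound (Or.inr (Or.inl ⟨h, h'⟩))
    have J₃ : ∀ i j : (Col.nat (n + 1)).Pt, i.val = n + 1 → j.val = n + 1 + 1 →
        U.str none i = U.str none j := fun i j h h' => Quot.sound (Or.inr (Or.inr ⟨h, h'⟩))
    clear_value U
    -- The region outside of the cup, where the two formulas for `w` have to agree.
    have hA : U.regN none (n + 1) = U.regN none (n + 3) :=
      regN_of_str_eq_odd U (J₃ ⟨n + 1, show _ < 2 * (n + 1) by omega⟩
        ⟨n + 1 + 1, show _ < 2 * (n + 1) by omega⟩ rfl rfl) (by dsimp only; omega)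
    obtain ⟨v, hv, hv'⟩ : ∃ v : (Col.nat n).Pt → U.Str,
        (∀ i (j : (Col.nat (n + 1)).Pt), i.val < n + 1 → j.val = i.val → v i = U.str none j) ∧
        (∀ i (j : (Col.nat (n + 1)).Pt), n + 1 ≤ i.val → j.val = i.val + 2 →
          v i = U.str none j) := by
      refine ⟨fun i => U.str none ⟨if i.val < n + 1 then i.val else i.val + 2, by
          have hi : i.val < 2 * n := i.isLt
          change _ < 2 * (n + 1)
          split <;> omega⟩, ?_, ?_⟩
      · intro i j h h'
        refine U.str_congr rfl _ _ ?_
        dsimp only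
        rw [if_pos h, h']
      · intro i j h h'
        refine U.str_congr rfl _ _ ?_
        dsimp only
        rw [if_neg (by omega), h']
    obtain ⟨w, hw, hw'⟩ : ∃ w : ℕ → U.Reg, (∀ i, i ≤ n + 1 → w i = U.regN none i) ∧
        (∀ i, n + 1 ≤ i → w i = U.regN none (i + 2)) := by
      refine ⟨fun i => U.regN none (if i ≤ n + 1 then i else i + 2), ?_, ?_⟩
      · intro i h
        beta_reduce
        rw [if_pos h]
      · intro i h
        beta_reduce
        split
        · rw [show i = n + 1 by omega, hA]
        · rfl
    have hw₁ : w (2 * n) = w 0 := by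
      rw [hw 0 (by omega)]
      rcases Nat.lt_or_ge n 2 with h | h
      · rw [hw _ (by omega), show 2 * n = n + 1 by omega, hA, show n + 3 = 2 * (n + 1) by omega]
        exact regN_end U none
      · rw [hw' _ (by omega)]
        exact regN_end U none
    have hw₂ : ∀ i : Unit, (fun _ : Unit => w) i (2 * (Col.nat n).num) = (fun _ : Unit => w) i 0 :=
      fun _ => hw₁
    refine subst_homTo (ι := Unit) (κ := fun _ => Empty) (c := fun _ => .nat n)
      (d := fun _ i => nomatch i) U (fun _ => v) _ hw₂ ?_ ?_ ?_
    · intro _ i x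
      have hi : i.val < 2 * n := i.isLt
      change U.side (v i) x = w _
      rcases Nat.lt_or_ge i.val (n + 1) with h0 | h0
      · rw [hv i ⟨i.val, show _ < 2 * (n + 1) by omega⟩ h0 rfl]
        exact side_eq_of_even U _ w x rfl (hw _ (by omega)) (hw _ (by omega))
      · rw [hv' i ⟨i.val + 2, show _ < 2 * (n + 1) by omega⟩ h0 rfl]
        exact side_eq_of_even U _ w x (by dsimp only; omega) (hw' _ (by omega)) (hw' _ (by omega))
    · refine ofJoin_sameStar_homTo _ ?_ ?_
      · rintro (_ | _) i (_ | _) j h'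
        · obtain ⟨h1, h2, h3⟩ : n + 1 ≤ i.val ∧ n + 1 ≤ j.val ∧
            i.val + j.val + 1 + 2 * n = 2 * (n + 1) + 2 * (n + 1) := h'
          rcases Nat.lt_or_ge i.val j.val with h0 | h0
          · exact J₃ i j (by omega) (by omega)
          · exact (J₃ j i (by omega) (by omega)).symm
        · exact False.elim h'
        · obtain ⟨h1, h2⟩ | ⟨h1, h2⟩ : (i.val < n + 1 ∧ j.val = i.val) ∨
            (n + 1 ≤ i.val ∧ j.val + 2 * n = i.val + 2 * (n + 1)) := h'
          · exact hv i j h1 h2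
          · exact hv' i j h1 (by omega)
        · exact False.elim h'
      · intro i
        rw [regN_zero, regN_zero]
        exact (hw 0 (by omega)).trans (regN_zero U none)
    · intro _
      refine one_homTo _ ?_
      intro i j h1 h2
      change v i = v j
      have hj : j.val < 2 * n := j.isLt
      obtain ⟨i', hi'⟩ : ∃ i' : (Col.nat (n + 1)).Pt, i'.val = i.val :=
        ⟨⟨i.val, show _ < 2 * (n + 1) by omega⟩, rfl⟩
      rw [hv i i' (by omega) hi']
      rcases Nat.lt_or_ge j.val (n + 1) with h0 | h0
      · obtain ⟨j', hj'⟩ : ∃ j' : (Col.nat (n + 1)).Pt, j'.val = j.val :=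
          ⟨⟨j.val, show _ < 2 * (n + 1) by omega⟩, rfl⟩
        rw [hv j j' h0 hj']
        exact J₂ i' j' (by omega) (by omega)
      · obtain ⟨j', hj'⟩ : ∃ j' : (Col.nat (n + 1)).Pt, j'.val = j.val + 2 :=
          ⟨⟨j.val + 2, show _ < 2 * (n + 1) by omega⟩, rfl⟩
        rw [hv' j j' h0 hj']
        exact J₁ i' j' (by omega) (by omega)
  · refine subst_spanned _ _ (fun _ => ofJoin_sameStar_regN _ _) (ofJoin_spanned _ _ _ _)
      (fun _ => ofJoin_spanned _ _ _ _) ?_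
    intro b i
    have hi : i.val < 2 * n := i.isLt
    rcases Nat.lt_or_ge i.val (n + 1) with h0 | h0
    · exact ⟨none, ⟨i.val, show _ < 2 * (n + 1) by omega⟩, (lt i _ h0 rfl).trans (glue i).symm⟩
    · exact ⟨none, ⟨i.val + 2, show _ < 2 * (n + 1) by omega⟩, (ge i _ h0 rfl).trans (glue i).symm⟩

end

end Tangle

theorem Tangle.ident_planar (n : ℕ) : (Tangle.ident (.nat n)).Planar := by
  rw [Tangle.ident_eq_ins n 0]
  exact Tangle.ins_planar n 0 n (by omega) le_rfl

/-! ### Associativity, units and the Jones projection in terms of multiplication maps -/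

namespace PlanarAlgebra

open Tangle

variable {K : Type u} [Field K] {A : PlanarAlgebra.{u, v} K}

/-- The inputs of a multiplication tangle with two tangles substituted into its boxes. -/
def pairArgs {κ₁ κ₂ : Type} {d₁ : κ₁ → Col} {d₂ : κ₂ → Col} (x₁ : ∀ j, A.space (d₁ j))
    (x₂ : ∀ j, A.space (d₂ j)) : ∀ q : Σ b, pairIdx κ₁ κ₂ b, A.space (pairFam d₁ d₂ q.1 q.2)
  | ⟨false, j⟩ => x₁ j
  | ⟨true, j⟩ => x₂ j

/-- The substitution axiom for a multiplication tangle. A plain input is brought into this form by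
means of the identity tangle. -/
theorem mulTo_Z_Z {κ₁ κ₂ : Type} {d₁ : κ₁ → Col} {d₂ : κ₂ → Col} {m n p : ℕ}
    {S₁ : Tangle d₁ (.nat m)} {S₂ : Tangle d₂ (.nat n)} (h₁ : p ≤ m + n) (h₂ : n ≤ m + p)
    (h₃ : m ≤ n + p) (hS₁ : S₁.Planar) (hS₂ : S₂.Planar) (x₁ : ∀ j, A.space (d₁ j))
    (x₂ : ∀ j, A.space (d₂ j)) :
    mulTo p (A.Z S₁ x₁) (A.Z S₂ x₂) = A.Z (multSubst S₁ S₂ p) (pairArgs x₁ x₂) := by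
  rw [multSubst, A.Z_subst _ _ (mult_planar m n p h₁ h₂ h₃)
    (fun b => match b with | false => hS₁ | true => hS₂)]
  unfold mulTo
  congr 1
  funext b
  cases b <;> rfl

/-- Three inputs. -/
def tripleArgs {m n l : ℕ} (x : A.P m) (y : A.P n) (z : A.P l) :
    ∀ i, A.space (tripleCol m n l i)
  | .inl false => x
  | .inl true => y
  | .inr _ => z

theorem mulTo_mulTo_left {m n l p q s t : ℕ} (hq : m + n = q + s) (hp : q + l = p + t)
    (hs : s ≤ 2 * m) (hst : s + t ≤ 2 * n) (ht : t ≤ 2 * l) (x : A.P m) (y : A.P n)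
    (z : A.P l) :
    mulTo p (mulTo q x y) z = A.Z (triple m n l p s t) (tripleArgs x y z) := by
  have hc : ∀ i, tripleCol m n l i =
      pairFam (pairCol m n) (fun _ : Unit => .nat l) (groupLeft i).1 (groupLeft i).2 := by
    rintro ((_ | _) | _) <;> rfl
  calc mulTo p (mulTo q x y) z
      = mulTo p (A.Z (mult m n q) (pair x y)) (A.Z (ident (.nat l)) (fun _ => z)) := by
        rw [A.Z_ident]; rfl
    _ = A.Z (multSubst (mult m n q) (ident (.nat l)) p) (pairArgs (pair x y) (fun _ => z)) :=
        mulTo_Z_Z (by omega) (by omega) (by omega)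
          (mult_planar m n q (by omega) (by omega) (by omega)) (ident_planar l) _ _
    _ = A.Z (triple m n l p s t) (tripleArgs x y z) := by
        refine (Z_eq_of_iso_pull A groupLeft hc _ _
          (triple_planar m n l p s t (by omega) hs hst ht)
          (triple_iso_left hq hp hs hst hc) _ _ ?_).symm
        rintro ((_ | _) | _) <;> rfl

theorem mulTo_mulTo_right {m n l p r s t : ℕ} (hr : n + l = r + t) (hp : m + r = p + s)
    (hs : s ≤ 2 * m) (hst : s + t ≤ 2 * n) (ht : t ≤ 2 * l) (x : A.P m) (y : A.P n)
    (z : A.P l) :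
    mulTo p x (mulTo r y z) = A.Z (triple m n l p s t) (tripleArgs x y z) := by
  have hc : ∀ i, tripleCol m n l i =
      pairFam (fun _ : Unit => .nat m) (pairCol n l) (groupRight i).1 (groupRight i).2 := by
    rintro ((_ | _) | _) <;> rfl
  calc mulTo p x (mulTo r y z)
      = mulTo p (A.Z (ident (.nat m)) (fun _ => x)) (A.Z (mult n l r) (pair y z)) := by
        rw [A.Z_ident]; rfl
    _ = A.Z (multSubst (ident (.nat m)) (mult n l r) p) (pairArgs (fun _ => x) (pair y z)) :=
        mulTo_Z_Z (by omega) (by omega) (by omega) (ident_planar m)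
          (mult_planar n l r (by omega) (by omega) (by omega)) _ _
    _ = A.Z (triple m n l p s t) (tripleArgs x y z) := by
        refine (Z_eq_of_iso_pull A groupRight hc _ _
          (triple_planar m n l p s t (by omega) hs hst ht)
          (triple_iso_right hr hp hst ht hc) _ _ ?_).symm
        rintro ((_ | _) | _) <;> rfl

/-- Associativity of the multiplication maps, with `s` strings between the first two boxes and
`t` strings between the last two. -/
theorem mulTo_assoc {m n l p q r : ℕ} (s t : ℕ) (hq : m + n = q + s) (hr : n + l = r + t)
    (hp : q + l = p + t) (hs : s ≤ 2 * m) (hst : s + t ≤ 2 * n) (ht : t ≤ 2 * l) (x : A.P m)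
    (y : A.P n) (z : A.P l) : mulTo p (mulTo q x y) z = mulTo p x (mulTo r y z) :=
  (mulTo_mulTo_left hq hp hs hst ht x y z).trans
    (mulTo_mulTo_right hr (by omega) hs hst ht x y z).symm

theorem mulTo_one_eq_ins {n N P c : ℕ} (h : n + N = P + c) (hn : c ≤ 2 * n) (hN : c ≤ N)
    (x : A.P n) : mulTo P x (A.one N) = A.Z (ins n (2 * n - c) P) (fun _ => x) := by
  have hc : ∀ i, Col.nat n =
      pairFam (fun _ : Unit => .nat n) (fun i : Empty => nomatch i) (fstOnly i).1 (fstOnly i).2 :=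
    fun _ => rfl
  calc mulTo P x (A.one N)
      = mulTo P (A.Z (ident (.nat n)) (fun _ => x)) (A.Z (Tangle.one N) (fun i => nomatch i)) := by
        rw [A.Z_ident]; rfl
    _ = A.Z (multSubst (ident (.nat n)) (Tangle.one N) P)
          (pairArgs (fun _ => x) (fun i => nomatch i)) :=
        mulTo_Z_Z (by omega) (by omega) (by omega) (ident_planar n) (one_planar N) _ _
    _ = A.Z (ins n (2 * n - c) P) (fun _ => x) :=
        (Z_eq_of_iso_pull A fstOnly hc _ _ (ins_planar n (2 * n - c) P (by omega) (by omega))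
          (ins_iso_fst h hn hN hc) _ _ fun _ => HEq.rfl).symm

theorem one_mulTo_eq_ins {n N P c : ℕ} (h : n + N = P + c) (hn : c ≤ 2 * n) (hN : c ≤ N)
    (x : A.P n) : mulTo P (A.one N) x = A.Z (ins n c P) (fun _ => x) := by
  have hc : ∀ i, Col.nat n =
      pairFam (fun i : Empty => nomatch i) (fun _ : Unit => .nat n) (sndOnly i).1 (sndOnly i).2 :=
    fun _ => rfl
  calc mulTo P (A.one N) x
      = mulTo P (A.Z (Tangle.one N) (fun i => nomatch i)) (A.Z (ident (.nat n)) (fun _ => x)) := by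
        rw [A.Z_ident]; rfl
    _ = A.Z (multSubst (Tangle.one N) (ident (.nat n)) P)
          (pairArgs (fun i => nomatch i) (fun _ => x)) :=
        mulTo_Z_Z (by omega) (by omega) (by omega) (one_planar N) (ident_planar n) _ _
    _ = A.Z (ins n c P) (fun _ => x) :=
        (Z_eq_of_iso_pull A sndOnly hc _ _ (ins_planar n c P hn (by omega))
          (ins_iso_snd h hn hN hc) _ _ fun _ => HEq.rfl).symm

/-- Since 1_N is attached by `N` strings, each of its strings continues one string of `x` and no cup
is left. It matters that `N` may exceed `n`: in its mirror image `one_mulTo`, the identity 1_a will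
act on P_m with a > m. -/
theorem mulTo_one {n N : ℕ} (h : N ≤ 2 * n) (x : A.P n) : mulTo n x (A.one N) = x := by
  rw [mulTo_one_eq_ins rfl h le_rfl, ← ident_eq_ins]
  exact A.Z_ident _ x

theorem one_mulTo {n N : ℕ} (h : N ≤ 2 * n) (x : A.P n) : mulTo n (A.one N) x = x := by
  rw [one_mulTo_eq_ins rfl h le_rfl, ← ident_eq_ins]
  exact A.Z_ident _ x

theorem incl_eq_mulTo_one {n N : ℕ} (h : n ≤ N) (x : A.P n) : incl N x = mulTo N x (A.one N) := by
  rw [mulTo_one_eq_ins (Nat.add_comm n N) (by omega) h, show 2 * n - n = n by omega,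
    ← incl_eq_ins]
  rfl

theorem incl_eq_one_mulTo {n N : ℕ} (h : n ≤ N) (x : A.P n) : incl N x = mulTo N (A.one N) x := by
  rw [one_mulTo_eq_ins (Nat.add_comm n N) (by omega) h, ← incl_eq_ins]
  rfl

theorem E_eq_mulTo {n : ℕ} (hn : 0 < n) : A.E (n + 1) = mulTo (n + 1) (A.one n) (A.one n) := by
  have hc : ∀ i : Empty, (fun i : Empty => (nomatch i : Col)) i =
      (fun q : Σ _ : Unit, Empty => (nomatch q.2 : Col)) (noBox i) := fun i => i.elim
  rw [mulTo_one_eq_ins (c := n - 1) (by omega) (by omega) (by omega),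
    show 2 * n - (n - 1) = n + 1 by omega]
  have h1 := A.Z_subst (ins n (n + 1) (n + 1)) (fun _ : Unit => Tangle.one n)
    (ins_planar n (n + 1) (n + 1) (by omega) (by omega)) (fun _ => one_planar n)
    (fun q => nomatch q.2)
  have h2 := Z_eq_of_iso_pull A noBox hc _ _ (jones_planar (n + 1) (by omega))
    (jones_iso hn hc) (fun i => nomatch i) (fun q => nomatch q.2) (fun i => i.elim)
  refine (h2.trans h1).trans ?_
  unfold PlanarAlgebra.one
  congr 1

/-- The identity that is used to include `a` in P_m is absorbed by `x`. -/
theorem lact_eq_mulTo {j m : ℕ} (h : j ≤ m) (a : A.P j) (x : A.P m) :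
    lact a x = mulTo m a x := by
  unfold lact mul
  rw [incl_eq_mulTo_one h, mulTo_assoc (r := m) j m (by omega) rfl rfl (by omega) (by omega)
    (by omega), one_mulTo (by omega)]

theorem ract_eq_mulTo {j m : ℕ} (h : j ≤ m) (x : A.P m) (a : A.P j) :
    ract x a = mulTo m x a := by
  unfold ract mul
  rw [incl_eq_one_mulTo h, ← mulTo_assoc (q := m) m j rfl (by omega) (by omega) (by omega)
    (by omega) (by omega), mulTo_one (by omega)]

/-- E_{k+1} consists of two copies of 1_k joined by `k - 1` strings, and each copy is absorbed by
its neighbour. -/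
theorem mul_E_mul {k : ℕ} (hk : 0 < k) (x y : A.P k) :
    mul (mul (incl (k + 1) x) (A.E (k + 1))) (incl (k + 1) y) = mulTo (k + 1) x y := by
  have h1 : mul (incl (k + 1) x) (A.E (k + 1)) = mulTo (k + 1) x (A.E (k + 1)) :=
    lact_eq_mulTo (by omega) _ _
  have h2 : ∀ z : A.P (k + 1), mul z (incl (k + 1) y) = mulTo (k + 1) z y := fun z =>
    ract_eq_mulTo (by omega) _ _
  rw [h1, h2, E_eq_mulTo hk, ← mulTo_assoc (q := k) (p := k + 1) k (k - 1) rfl (by omega) (by omega)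
    (by omega) (by omega) (by omega), mulTo_one (by omega),
    mulTo_assoc (r := k) (k - 1) k (by omega) rfl (by omega) (by omega) (by omega) (by omega),
    one_mulTo (by omega)]

end PlanarAlgebra

namespace PlanarAlgebra

open Tangle

variable {K : Type u} [Field K] {A : PlanarAlgebra.{u, v} K}

/-! ### The bimodule structure -/

/-- The map of the tangle `M_{m,n}^p`, as a bilinear map. -/
def mulToₗ {m n : ℕ} (p : ℕ) : A.P m →ₗ[K] A.P n →ₗ[K] A.P p := by
  have h₁ : ∀ (x x' : A.P m) (y : A.P n), pair x' y = Function.update (pair x y) false x' := by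
    intro x x' y
    funext b
    cases b <;> rfl
  have h₂ : ∀ (x : A.P m) (y y' : A.P n), pair x y' = Function.update (pair x y) true y' := by
    intro x x' y
    funext b
    cases b <;> rfl
  refine LinearMap.mk₂ K (mulTo p) ?_ ?_ ?_ ?_
  · intro x x' y
    unfold mulTo
    rw [h₁ x (x + x') y, h₁ x x' y]
    refine (MultilinearMap.map_update_add _ _ _ _ _).trans ?_
    rw [← h₁]
  · intro c x y
    unfold mulTo
    rw [h₁ x (c • x) y]
    refine (MultilinearMap.map_update_smul _ _ _ _ _).trans ?_
    rw [← h₁]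
  · intro x y y'
    unfold mulTo
    rw [h₂ x y (y + y'), h₂ x y y']
    refine (MultilinearMap.map_update_add _ _ _ _ _).trans ?_
    rw [← h₂]
  · intro c x y
    unfold mulTo
    rw [h₂ x y (c • y)]
    refine (MultilinearMap.map_update_smul _ _ _ _ _).trans ?_
    rw [← h₂]

theorem mulToₗ_apply {m n : ℕ} (p : ℕ) (x : A.P m) (y : A.P n) : mulToₗ p x y = mulTo p x y := rfl

section

variable {j m n p : ℕ}

theorem mulTo_ract_lact (hm : j ≤ m) (hn : j ≤ n) (hp : m + n = p + j) (x : A.P m) (a : A.P j)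
    (y : A.P n) : mulTo p (ract x a) y = mulTo p x (lact a y) := by
  rw [ract_eq_mulTo hm, lact_eq_mulTo hn,
    mulTo_assoc (r := n) j j rfl (by omega) hp (by omega) (by omega) (by omega)]

theorem mulTo_lact (hm : j ≤ m) (hn : j ≤ n) (hp : m + n = p + j) (a : A.P j) (x : A.P m)
    (y : A.P n) : mulTo p (lact a x) y = lact a (mulTo p x y) := by
  rw [lact_eq_mulTo hm, lact_eq_mulTo (by omega),
    mulTo_assoc j j (by omega) hp hp (by omega) (by omega) (by omega)]

theorem mulTo_ract (hm : j ≤ m) (hn : j ≤ n) (hp : m + n = p + j) (x : A.P m) (y : A.P n)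
    (b : A.P j) : mulTo p x (ract y b) = ract (mulTo p x y) b := by
  rw [ract_eq_mulTo hn, ract_eq_mulTo (by omega),
    mulTo_assoc j j hp rfl rfl (by omega) (by omega) (by omega)]

end

/-! ### Factorization of the identity -/

/-- If `1_{k+1}` lies in `P_k E_{k+1} P_k`, then `1_a` is a sum of products `U V` with
`U`, `V` in `P_m` that are joined by `k - 1` strings. -/
theorem one_mem_span {k : ℕ} (hk : 0 < k) (h : A.one (k + 1) ∈ A.PEP k) (d : ℕ) :
    A.one (k + 1 + 2 * d) ∈
      Submodule.span K {z | ∃ U V : A.P (k + d), z = mulTo (k + 1 + 2 * d) U V} := by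
  have h' : A.one (k + 1) ∈ Submodule.span K {z | ∃ x y : A.P k, z = mulTo (k + 1) x y} := by
    unfold PEP at h
    simpa only [mul_E_mul hk] using h
  induction d with
  | zero => exact h'
  | succ d ih =>
    obtain ⟨m, hm⟩ : ∃ m, m = k + d := ⟨_, rfl⟩
    obtain ⟨a, ha⟩ : ∃ a, a = k + 1 + 2 * d := ⟨_, rfl⟩
    rw [show k + 1 + 2 * (d + 1) = a + 2 by omega, show k + (d + 1) = m + 1 by omega]
    rw [← ha, ← hm] at ih
    set M := Submodule.span K {z | ∃ U V : A.P (m + 1), z = mulTo (a + 2) U V}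
    -- Writing 1_a as a sum of products U·V gives x·W = x·(1_a·W) = Σ (x·U)·(V·W), where both
    -- factors have colour `m + 1`.
    have key : ∀ (x : A.P k) (W : A.P (a + 1)), mulTo (a + 2) x W ∈ M := by
      intro x W
      have hle : Submodule.span K {z | ∃ U V : A.P m, z = mulTo a U V} ≤
          M.comap ((mulToₗ (a + 2) x).comp ((mulToₗ (a + 1)).flip W)) := by
        rw [Submodule.span_le]
        rintro _ ⟨U, V, rfl⟩
        change mulTo (a + 2) x (mulTo (a + 1) (mulTo a U V) W) ∈ M
        refine Submodule.subset_span ⟨mulTo (m + 1) x U, mulTo (m + 1) V W, ?_⟩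
        have e₁ : mulTo (a + 1) (mulTo a U V) W = mulTo (a + 1) U (mulTo (m + 1) V W) :=
          mulTo_assoc (k - 1) a (by omega) (by omega) (by omega) (by omega) (by omega) (by omega) _ _ _
        rw [e₁]
        have e₂ : mulTo (a + 2) (mulTo (m + 1) x U) (mulTo (m + 1) V W) =
            mulTo (a + 2) x (mulTo (a + 1) U (mulTo (m + 1) V W)) :=
          mulTo_assoc (k - 1) (k - 1) (by omega) (by omega) (by omega) (by omega) (by omega)
            (by omega) _ _ _
        exact e₂.symm
      have := hle ih
      change mulTo (a + 2) x (mulTo (a + 1) (A.one a) W) ∈ M at this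
      rwa [one_mulTo (by omega)] at this
    -- Now 1_{a+2} = 1_{k+1}·1_{a+2} is a sum of terms x·(y·1_{a+2}), to which `key` applies.
    have hle : Submodule.span K {z | ∃ x y : A.P k, z = mulTo (k + 1) x y} ≤
        M.comap ((mulToₗ (a + 2)).flip (A.one (a + 2))) := by
      rw [Submodule.span_le]
      rintro _ ⟨x, y, rfl⟩
      change mulTo (a + 2) (mulTo (k + 1) x y) (A.one (a + 2)) ∈ M
      rw [mulTo_assoc (r := a + 1) (k - 1) (k + 1) (by omega) (by omega) (by omega) (by omega)
        (by omega) (by omega)]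
      exact key _ _
    have := hle h'
    change mulTo (a + 2) (A.one (k + 1)) (A.one (a + 2)) ∈ M at this
    rwa [one_mulTo (by omega)] at this

/-! ### The tensor product of two factors -/

section

variable {j m n p : ℕ}

/-- The map of the tangle `M_{m,n}^p` on the tensor product over `P_j`. -/
def balMul (hm : j ≤ m) (hn : j ≤ n) (hp : m + n = p + j) : A.BalTensor j m n →ₗ[K] A.P p :=
  (A.balanced j m n).liftQ (TensorProduct.lift (mulToₗ p)) <| by
    unfold balanced
    rw [Submodule.span_le]
    rintro _ ⟨x, a, y, rfl⟩
    rw [SetLike.mem_coe, LinearMap.mem_ker, map_sub, TensorProduct.lift.tmul,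
      TensorProduct.lift.tmul, mulToₗ_apply, mulToₗ_apply, mulTo_ract_lact hm hn hp, sub_self]

theorem balMul_mk (hm : j ≤ m) (hn : j ≤ n) (hp : m + n = p + j) (x : A.P m) (y : A.P n) :
    balMul hm hn hp (Submodule.Quotient.mk (x ⊗ₜ[K] y)) = mulTo p x y := rfl

theorem balTensor_ext {M : Type*} [AddCommGroup M] [Module K M] {f g : A.BalTensor j m n →ₗ[K] M}
    (h : ∀ x y, f (Submodule.Quotient.mk (x ⊗ₜ[K] y)) = g (Submodule.Quotient.mk (x ⊗ₜ[K] y))) :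
    f = g := by
  refine Submodule.linearMap_qext _ (TensorProduct.ext' fun x y => ?_)
  exact h x y

theorem ract_tmul (x : A.P m) (a : A.P j) (y : A.P n) :
    (Submodule.Quotient.mk (ract x a ⊗ₜ[K] y) : A.BalTensor j m n) =
      Submodule.Quotient.mk (x ⊗ₜ[K] lact a y) :=
  (Submodule.Quotient.eq _).2 (Submodule.subset_span ⟨x, a, y, rfl⟩)

/-- A factorization of the identity gives a left inverse of `balMul`. -/
theorem exists_leftInverse {a : ℕ} (hm : j ≤ m) (hn : j ≤ n) (hp : m + n = p + j)
    (ha : m + m = a + j) (u : A.P a)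
    (hu : u ∈ Submodule.span K {z | ∃ U V : A.P m, z = mulTo a U V}) :
    ∃ ψ : A.P p →ₗ[K] A.BalTensor j m n, ∀ (x : A.P m) (y : A.P n),
      ψ (mulTo p x y) = Submodule.Quotient.mk (mulTo m u x ⊗ₜ[K] y) := by
  induction hu using Submodule.span_induction with
  | mem u hu =>
    obtain ⟨U, V, rfl⟩ := hu
    -- For u = U·V the map is z ↦ U ⊗ V·z, with V and z joined by 2m - j strings.
    refine ⟨(A.balanced j m n).mkQ.comp ((TensorProduct.mk K _ _ U).comp (mulToₗ n V)), ?_⟩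
    intro x y
    change Submodule.Quotient.mk (U ⊗ₜ[K] mulTo n V (mulTo p x y)) = _
    -- V·(x·y) = (V·x)·y, where V·x has colour `j` and therefore crosses the tensor sign; then
    -- U·(V·x) = (U·V)·x.
    rw [← mulTo_assoc (q := j) (2 * m - j) j (by omega) hp (by omega) (by omega) (by omega)
      (by omega), ← lact_eq_mulTo hn, ← ract_tmul, ract_eq_mulTo hm,
      mulTo_assoc (r := j) j (2 * m - j) (by omega) (by omega) (by omega) (by omega) (by omega)
      (by omega)]
  | zero =>
    refine ⟨0, fun x y => ?_⟩
    rw [← mulToₗ_apply m, map_zero, LinearMap.zero_apply, LinearMap.zero_apply, TensorProduct.zero_tmul]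
    rfl
  | add u u' _ _ h h' =>
    obtain ⟨ψ, hψ⟩ := h
    obtain ⟨ψ', hψ'⟩ := h'
    refine ⟨ψ + ψ', fun x y => ?_⟩
    rw [← mulToₗ_apply m, map_add, LinearMap.add_apply, LinearMap.add_apply, TensorProduct.add_tmul,
      hψ, hψ']
    rfl
  | smul c u _ h =>
    obtain ⟨ψ, hψ⟩ := h
    refine ⟨c • ψ, fun x y => ?_⟩
    rw [← mulToₗ_apply m, map_smul, LinearMap.smul_apply, LinearMap.smul_apply,
      ← TensorProduct.smul_tmul', hψ]
    rfl

/-- With 1_a in place of `u`, the map of `exists_leftInverse` sends x·y to 1_a·x ⊗ y = x ⊗ y. The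
same factorization gives z = 1_a·z = Σ U·(V·z) for every z. -/
theorem balMul_bijective {k : ℕ} (hk : 0 < k) (h : A.one (k + 1) ∈ A.PEP k) (hj : j + 1 = k)
    (hkm : k ≤ m) (hkn : k ≤ n) (hp : m + n = p + j) :
    Function.Bijective (balMul (A := A) (show j ≤ m by omega) (show j ≤ n by omega) hp) := by
  obtain ⟨d, rfl⟩ := Nat.exists_eq_add_of_le hkm
  have h1 := one_mem_span hk h d
  generalize ha : k + 1 + 2 * d = a at h1
  constructor
  · obtain ⟨ψ, hψ⟩ := exists_leftInverse (p := p) (n := n) (j := j) (by omega) (by omega) hp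
      (by omega) _ h1
    have : ψ.comp (balMul (by omega) (by omega) hp) = LinearMap.id := by
      refine balTensor_ext fun x y => ?_
      rw [LinearMap.comp_apply, balMul_mk, hψ, one_mulTo (by omega)]
      rfl
    exact Function.LeftInverse.injective (g := ψ) fun t => LinearMap.congr_fun this t
  · intro z
    rw [← LinearMap.mem_range]
    have hle : Submodule.span K {z | ∃ U V : A.P (k + d), z = mulTo a U V} ≤
        (LinearMap.range (balMul (A := A) (show j ≤ k + d by omega) (show j ≤ n by omega) hp)).comap
          ((mulToₗ p).flip z) := by
      rw [Submodule.span_le]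
      rintro _ ⟨U, V, rfl⟩
      refine ⟨Submodule.Quotient.mk (U ⊗ₜ[K] mulTo n V z), ?_⟩
      rw [balMul_mk]
      exact (mulTo_assoc j a (by omega) (by omega) (by omega) (by omega) (by omega)
        (by omega) _ _ _).symm
    have := hle h1
    rwa [Submodule.mem_comap, LinearMap.flip_apply, mulToₗ_apply, one_mulTo (by omega)] at this

end

end PlanarAlgebra

namespace PlanarAlgebra

variable {K : Type u} [Field K] {A : PlanarAlgebra.{u, v} K}

/-! ### The tensor power -/

section

variable {j k : ℕ}

theorem iterMul_succ (s : ℕ) (x : Fin (s + 2) → A.P k) :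
    iterMul (s + 1) x = mulTo (k + s + 1) (iterMul s (Fin.init x)) (x (Fin.last (s + 1))) := rfl

theorem iterMul_update_castSucc (s : ℕ) (x : Fin (s + 2) → A.P k) (i : Fin (s + 1)) (v : A.P k) :
    iterMul (s + 1) (Function.update x i.castSucc v) =
      mulTo (k + s + 1) (iterMul s (Function.update (Fin.init x) i v))
        (x (Fin.last (s + 1))) := by
  rw [iterMul_succ, Fin.init_update_castSucc, Function.update_of_ne (Fin.castSucc_lt_last i).ne']

theorem iterMul_update_last (s : ℕ) (x : Fin (s + 2) → A.P k) (v : A.P k) :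
    iterMul (s + 1) (Function.update x (Fin.last (s + 1)) v) =
      mulTo (k + s + 1) (iterMul s (Fin.init x)) v := by
  rw [iterMul_succ, Fin.init_update_last, Function.update_self]

theorem iterMul_update_add (s : ℕ) (x : Fin (s + 1) → A.P k) (i : Fin (s + 1)) (v w : A.P k) :
    iterMul s (Function.update x i (v + w)) =
      iterMul s (Function.update x i v) + iterMul s (Function.update x i w) := by
  induction s with
  | zero =>
    obtain rfl : i = 0 := Subsingleton.elim (α := Fin 1) _ _
    simp only [iterMul, Function.update_self]
  | succ s ih =>
    induction i using Fin.lastCases with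
    | last =>
      rw [iterMul_update_last, iterMul_update_last, iterMul_update_last, ← mulToₗ_apply, map_add]
      rfl
    | cast i =>
      rw [iterMul_update_castSucc, iterMul_update_castSucc, iterMul_update_castSucc, ih,
        ← mulToₗ_apply, map_add]
      rfl

theorem iterMul_update_smul (s : ℕ) (x : Fin (s + 1) → A.P k) (i : Fin (s + 1)) (c : K)
    (v : A.P k) :
    iterMul s (Function.update x i (c • v)) = c • iterMul s (Function.update x i v) := by
  induction s with
  | zero =>
    obtain rfl : i = 0 := Subsingleton.elim (α := Fin 1) _ _
    simp only [iterMul, Function.update_self]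
  | succ s ih =>
    induction i using Fin.lastCases with
    | last =>
      rw [iterMul_update_last, iterMul_update_last, ← mulToₗ_apply, map_smul]
      rfl
    | cast i =>
      rw [iterMul_update_castSucc, iterMul_update_castSucc, ih, ← mulToₗ_apply, map_smul]
      rfl

/-- The iterated multiplication as a multilinear map. -/
def iterMulₗ (s : ℕ) : MultilinearMap K (fun _ : Fin (s + 1) => A.P k) (A.P (k + s)) where
  toFun := iterMul s
  map_update_add' x i v w := by
    convert iterMul_update_add s x i v w
  map_update_smul' x i c v := by
    convert iterMul_update_smul s x i c v

theorem iterMul_lact (hj : j + 1 = k) (s : ℕ) (x : Fin (s + 1) → A.P k) (a : A.P j) :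
    iterMul s (Function.update x 0 (lact a (x 0))) = lact a (iterMul s x) := by
  induction s with
  | zero => simp only [iterMul, Function.update_self]
  | succ s ih =>
    have h := iterMul_update_castSucc s x 0 (lact a (x 0))
    rw [Fin.castSucc_zero] at h
    exact h.trans ((congrArg (fun w => mulTo (k + s + 1) w (x (Fin.last (s + 1))))
      (ih (Fin.init x))).trans
      (mulTo_lact (p := k + s + 1) (by omega) (by omega) (by omega) _ _ _))

theorem iterMul_ract (hj : j + 1 = k) (s : ℕ) (x : Fin (s + 1) → A.P k) (a : A.P j) :
    iterMul s (Function.update x (Fin.last s) (ract (x (Fin.last s)) a)) =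
      ract (iterMul s x) a := by
  cases s with
  | zero =>
    rw [show Fin.last 0 = 0 from rfl]
    simp only [iterMul, Function.update_self]
  | succ s =>
    rw [iterMul_update_last, iterMul_succ, mulTo_ract (by omega) (by omega) (by omega)]

/-- Away from the last factor this is the statement for a shorter product. At the last factor, the
product of the preceding ones is a single element on which `a` acts from the right, and the case of
two factors applies. -/
theorem iterMul_balanced (hj : j + 1 = k) (s : ℕ) (x : Fin (s + 1) → A.P k) (i : Fin s)
    (a : A.P j) :
    iterMul s (Function.update x i.castSucc (ract (x i.castSucc) a)) =
      iterMul s (Function.update x i.succ (lact a (x i.succ))) := by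
  induction s with
  | zero => exact i.elim0
  | succ s ih =>
    induction i using Fin.lastCases with
    | last =>
      rw [iterMul_update_castSucc, Fin.succ_last, iterMul_update_last,
        ← mulTo_ract_lact (by omega) (by omega) (by omega), ← iterMul_ract hj]
      rfl
    | cast i =>
      rw [iterMul_update_castSucc, Fin.succ_castSucc, iterMul_update_castSucc]
      congr 1
      exact ih (Fin.init x) i

/-- The iterated multiplication on the tensor power over `P_j`. -/
def powMul (hj : j + 1 = k) (s : ℕ) : A.BalPow j k s →ₗ[K] A.P (k + s) :=
  (A.balancedPow j k s).liftQ (PiTensorProduct.lift (iterMulₗ s)) <| by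
    unfold balancedPow
    rw [Submodule.span_le]
    rintro _ ⟨x, i, a, rfl⟩
    rw [SetLike.mem_coe, LinearMap.mem_ker, map_sub, PiTensorProduct.lift.tprod,
      PiTensorProduct.lift.tprod, sub_eq_zero]
    exact iterMul_balanced hj s x i a

theorem powMul_mk (hj : j + 1 = k) (s : ℕ) (x : Fin (s + 1) → A.P k) :
    powMul hj s (Submodule.Quotient.mk (PiTensorProduct.tprod K x)) = iterMul s x :=
  PiTensorProduct.lift.tprod (φ := iterMulₗ s) x

theorem balPow_ext {s : ℕ} {M : Type*} [AddCommGroup M] [Module K M]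
    {f g : A.BalPow j k s →ₗ[K] M}
    (h : ∀ x, f (Submodule.Quotient.mk (PiTensorProduct.tprod K x)) =
      g (Submodule.Quotient.mk (PiTensorProduct.tprod K x))) : f = g := by
  refine Submodule.linearMap_qext _ (PiTensorProduct.ext (MultilinearMap.ext fun x => ?_))
  exact h x

theorem balPow_mk_update {s : ℕ} (x : Fin (s + 1) → A.P k) (i : Fin s) (a : A.P j) :
    (Submodule.Quotient.mk (PiTensorProduct.tprod K
      (Function.update x i.castSucc (ract (x i.castSucc) a))) : A.BalPow j k s) =
      Submodule.Quotient.mk (PiTensorProduct.tprod K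
        (Function.update x i.succ (lact a (x i.succ)))) :=
  (Submodule.Quotient.eq _).2 (Submodule.subset_span ⟨x, i, a, rfl⟩)

/-- Appending a factor to the tensor power. -/
def balSnoc (j k s : ℕ) : A.BalPow j k s →ₗ[K] A.P k →ₗ[K] A.BalPow j k (s + 1) :=
  (A.balancedPow j k s).liftQ (PiTensorProduct.lift (MultilinearMap.curryRight
    ((A.balancedPow j k (s + 1)).mkQ.compMultilinearMap
      (PiTensorProduct.tprod K (s := fun _ : Fin (s + 2) => A.P k))))) <| by
    conv_lhs => unfold balancedPow
    rw [Submodule.span_le]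
    rintro _ ⟨x, i, a, rfl⟩
    rw [SetLike.mem_coe, LinearMap.mem_ker, map_sub, PiTensorProduct.lift.tprod,
      PiTensorProduct.lift.tprod, sub_eq_zero]
    ext y
    have h := balPow_mk_update (Fin.snoc (α := fun _ => A.P k) x y) i.castSucc a
    rw [Fin.succ_castSucc, ← Fin.snoc_update, ← Fin.snoc_update, Fin.snoc_castSucc,
      Fin.snoc_castSucc] at h
    exact h

theorem balSnoc_mk (s : ℕ) (x : Fin (s + 1) → A.P k) (y : A.P k) :
    balSnoc j k s (Submodule.Quotient.mk (PiTensorProduct.tprod K x)) y =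
      Submodule.Quotient.mk (PiTensorProduct.tprod K (Fin.snoc (α := fun _ => A.P k) x y)) :=
  LinearMap.congr_fun (PiTensorProduct.lift.tprod x) y

theorem iterMul_snoc (s : ℕ) (x : Fin (s + 1) → A.P k) (y : A.P k) :
    iterMul (s + 1) (Fin.snoc (α := fun _ => A.P k) x y) = mulTo (k + s + 1) (iterMul s x) y := by
  rw [iterMul_succ, Fin.init_snoc, Fin.snoc_last]

theorem powMul_balSnoc (hj : j + 1 = k) (s : ℕ) (b : A.BalPow j k s) (y : A.P k) :
    powMul hj (s + 1) (balSnoc j k s b y) = mulTo (k + s + 1) (powMul hj s b) y := by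
  have : ((balSnoc j k s).compr₂ (powMul hj (s + 1))).flip y =
      ((mulToₗ (k + s + 1)).flip y).comp (powMul (A := A) hj s) := by
    refine balPow_ext fun x => ?_
    rw [LinearMap.flip_apply, LinearMap.compr₂_apply, balSnoc_mk, powMul_mk, LinearMap.comp_apply,
      powMul_mk, iterMul_snoc]
    rfl
  exact LinearMap.congr_fun this b

/-- By induction the first factors give P_{k+s}. The tensor power is then identified with P_{k+s}
⊗_{P_j} P_k, to which `balMul_bijective` applies; the map `H` below is this identification. -/
theorem powMul_bijective (hk : 0 < k) (h : A.one (k + 1) ∈ A.PEP k) (hj : j + 1 = k) (s : ℕ) :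
    Function.Bijective (powMul (A := A) hj s) := by
  induction s with
  | zero =>
    -- A single factor leaves nothing to balance.
    have hbot : A.balancedPow j k 0 = ⊥ := by
      unfold balancedPow
      rw [Submodule.span_eq_bot]
      rintro _ ⟨x, i, a, rfl⟩
      exact i.elim0
    have hcomp : (powMul (A := A) hj 0).comp (A.balancedPow j k 0).mkQ =
        (PiTensorProduct.subsingletonEquiv (R := K) (s := fun _ : Fin 1 => A.P k) (0 : Fin 1)).toLinearMap := by
      refine PiTensorProduct.ext (MultilinearMap.ext fun x => ?_)
      refine (powMul_mk hj 0 x).trans ?_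
      exact (PiTensorProduct.subsingletonEquiv_apply_tprod (R := K) (s := fun _ : Fin 1 => A.P k)
        (0 : Fin 1) x).symm
    constructor
    · intro b b' hb
      obtain ⟨t, rfl⟩ := Submodule.Quotient.mk_surjective _ b
      obtain ⟨t', rfl⟩ := Submodule.Quotient.mk_surjective _ b'
      rw [(PiTensorProduct.subsingletonEquiv (R := K) (s := fun _ : Fin 1 => A.P k)
        (0 : Fin 1)).injective
        ((LinearMap.congr_fun hcomp t).symm.trans (hb.trans (LinearMap.congr_fun hcomp t')))]
    · intro z
      obtain ⟨t, rfl⟩ := (PiTensorProduct.subsingletonEquiv (R := K) (s := fun _ : Fin 1 => A.P k)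
        (0 : Fin 1)).surjective z
      exact ⟨Submodule.Quotient.mk t, LinearMap.congr_fun hcomp t⟩
  | succ s ih =>
    let e := LinearEquiv.ofBijective _ ih
    have he : ∀ x, e (Submodule.Quotient.mk (PiTensorProduct.tprod K x)) = iterMul s x :=
      powMul_mk hj s
    -- Under `e` the right action on P_{k+s} is the action on the last factor, so the required
    -- identity is the balancing relation between the last two factors of the longer power. This
    -- makes `H` well defined.
    have hbal : ∀ (w : A.P (k + s)) (a : A.P j) (y : A.P k),
        balSnoc j k s (e.symm (ract w a)) y = balSnoc j k s (e.symm w) (lact a y) := by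
      intro w a y
      have : (((balSnoc j k s).flip y).comp (e.symm.toLinearMap.comp
          ((mulToₗ (k + s)).flip a))).comp e.toLinearMap = (balSnoc j k s).flip (lact a y) := by
        refine balPow_ext fun x => ?_
        have h1 : e.symm (mulTo (k + s) (iterMul s x) a) = Submodule.Quotient.mk
            (PiTensorProduct.tprod K
              (Function.update x (Fin.last s) (ract (x (Fin.last s)) a))) := by
          rw [LinearEquiv.symm_apply_eq, he, iterMul_ract hj, ract_eq_mulTo (by omega)]
        change balSnoc j k s (e.symm (mulTo (k + s)
          (e (Submodule.Quotient.mk (PiTensorProduct.tprod K x))) a)) y = _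
        rw [he, h1, balSnoc_mk, LinearMap.flip_apply, balSnoc_mk]
        have h2 := balPow_mk_update (Fin.snoc (α := fun _ => A.P k) x y) (Fin.last s) a
        rw [← Fin.snoc_update, Fin.succ_last, Fin.update_snoc_last, Fin.snoc_castSucc,
          Fin.snoc_last] at h2
        exact h2
      have h3 := LinearMap.congr_fun this (e.symm w)
      rw [ract_eq_mulTo (by omega)]
      simpa [mulToₗ_apply] using h3
    let H : A.BalTensor j (k + s) k →ₗ[K] A.BalPow j k (s + 1) :=
      (A.balanced j (k + s) k).liftQ
        (TensorProduct.lift ((balSnoc j k s).comp e.symm.toLinearMap)) <| by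
        unfold balanced
        rw [Submodule.span_le]
        rintro _ ⟨w, a, y, rfl⟩
        rw [SetLike.mem_coe, LinearMap.mem_ker, map_sub, TensorProduct.lift.tmul,
          TensorProduct.lift.tmul, sub_eq_zero]
        exact hbal w a y
    have hH : ∀ w y, H (Submodule.Quotient.mk (w ⊗ₜ[K] y)) = balSnoc j k s (e.symm w) y :=
      fun _ _ => rfl
    have hφ := balMul_bijective (m := k + s) (n := k) (p := k + s + 1) hk h hj (by omega) le_rfl
      (by omega)
    let φ := LinearEquiv.ofBijective _ hφ
    have hφm : ∀ w y, φ (Submodule.Quotient.mk (w ⊗ₜ[K] y)) = mulTo (k + s + 1) w y :=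
      fun _ _ => rfl
    have h₁ : (powMul hj (s + 1)).comp H = φ.toLinearMap := by
      refine balTensor_ext fun w y => ?_
      rw [LinearMap.comp_apply, hH, powMul_balSnoc]
      exact (congrArg (fun w => mulTo (k + s + 1) w y) (e.apply_symm_apply w)).trans (hφm w y).symm
    have h₂ : (H.comp φ.symm.toLinearMap).comp (powMul hj (s + 1)) = LinearMap.id := by
      refine balPow_ext fun x => ?_
      have h3 : φ.symm (iterMul (s + 1) x) =
          Submodule.Quotient.mk (iterMul s (Fin.init x) ⊗ₜ[K] x (Fin.last (s + 1))) := by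
        rw [LinearEquiv.symm_apply_eq, hφm, iterMul_succ]
      rw [LinearMap.comp_apply, powMul_mk]
      change H (φ.symm (iterMul (s + 1) x)) = _
      rw [h3, hH, ← he, e.symm_apply_apply, balSnoc_mk, Fin.snoc_init_self]
      rfl
    refine ⟨Function.LeftInverse.injective (g := H.comp φ.symm.toLinearMap)
      fun t => LinearMap.congr_fun h₂ t, fun z => ⟨H (φ.symm z), ?_⟩⟩
    exact (LinearMap.congr_fun h₁ (φ.symm z)).trans (φ.apply_symm_apply z)

end

end PlanarAlgebra

/-! ### The two isomorphisms -/

theorem proposition2p1 {K : Type u} [Field K] (A : PlanarAlgebra.{u, v} K) (k : ℕ) (hk : 0 < k)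
    (h : A.one (k + 1) ∈ A.PEP k) :
    (∀ m n : ℕ, k ≤ m → k ≤ n →
      ∃ φ : A.BalTensor (k - 1) m n ≃ₗ[K] A.P (m + n - (k - 1)),
        (∀ (x : A.P m) (y : A.P n), φ (Submodule.Quotient.mk (x ⊗ₜ[K] y)) =
          PlanarAlgebra.mulTo (m + n - (k - 1)) x y) ∧
        (∀ (a : A.P (k - 1)) (x : A.P m) (y : A.P n),
          φ (Submodule.Quotient.mk (PlanarAlgebra.lact a x ⊗ₜ[K] y)) =
            PlanarAlgebra.lact a (φ (Submodule.Quotient.mk (x ⊗ₜ[K] y)))) ∧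
        (∀ (x : A.P m) (y : A.P n) (b : A.P (k - 1)),
          φ (Submodule.Quotient.mk (x ⊗ₜ[K] PlanarAlgebra.ract y b)) =
            PlanarAlgebra.ract (φ (Submodule.Quotient.mk (x ⊗ₜ[K] y))) b)) ∧
    (∀ s : ℕ, ∃ φ : A.BalPow (k - 1) k s ≃ₗ[K] A.P (k + s),
        (∀ x : Fin (s + 1) → A.P k,
          φ (Submodule.Quotient.mk (PiTensorProduct.tprod K x)) = PlanarAlgebra.iterMul s x) ∧
        (∀ (a : A.P (k - 1)) (x : Fin (s + 1) → A.P k),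
          φ (Submodule.Quotient.mk (PiTensorProduct.tprod K
              (Function.update x 0 (PlanarAlgebra.lact a (x 0))))) =
            PlanarAlgebra.lact a (φ (Submodule.Quotient.mk (PiTensorProduct.tprod K x)))) ∧
        (∀ (x : Fin (s + 1) → A.P k) (b : A.P (k - 1)),
          φ (Submodule.Quotient.mk (PiTensorProduct.tprod K
              (Function.update x (Fin.last s) (PlanarAlgebra.ract (x (Fin.last s)) b)))) =
            PlanarAlgebra.ract (φ (Submodule.Quotient.mk (PiTensorProduct.tprod K x))) b)) := by
  have hj : k - 1 + 1 = k := by omega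
  constructor
  · intro m n hm hn
    have hp : m + n = m + n - (k - 1) + (k - 1) := by omega
    refine ⟨LinearEquiv.ofBijective _ (PlanarAlgebra.balMul_bijective hk h hj hm hn hp),
      fun _ _ => rfl, ?_, ?_⟩
    · intro a x y
      exact PlanarAlgebra.mulTo_lact (by omega) (by omega) hp a x y
    · intro x y b
      exact PlanarAlgebra.mulTo_ract (by omega) (by omega) hp x y b
  -- Here n = k + s, so that n + 1 - k = s + 1 is the number of factors.
  · intro s
    have hmk := PlanarAlgebra.powMul_mk (A := A) hj s
    refine ⟨LinearEquiv.ofBijective _ (PlanarAlgebra.powMul_bijective hk h hj s), hmk, ?_, ?_⟩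
    · intro a x
      rw [LinearEquiv.ofBijective_apply, LinearEquiv.ofBijective_apply, hmk, hmk,
        PlanarAlgebra.iterMul_lact hj]
    · intro x b
      rw [LinearEquiv.ofBijective_apply, LinearEquiv.ofBijective_apply, hmk, hmk,
        PlanarAlgebra.iterMul_ract hj]
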